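/- Let $\mathcal{O}$ be a complete discrete valuation ring with fraction field $K$ and perfect residue field $k$. Let $K_0(\mathrm{Var}_k)$ be the Grothendieck ring of $k$-varieties, $\mathbb{L}=[\mathbb{A}^1_k]$, and $K_0(\mathrm{Var}_k)_{\mathbb{Q}}=K_0(\mathrm{Var}_k)\otimes_{\mathbb{Z}}\mathbb{Q}$. Let $\mathcal{X}$ be a regular flat $\mathcal{O}$-scheme of finite type such that the generic fiber $\mathcal{X}_K$ is smooth over $K$ and the special fiber $\mathcal{X}_k=\sum_{i\in I}a_iD_i$ is a simple normal crossing divisor in $\mathcal{X}$, where the $D_i$ are the irreducible components of $\mathcal{X}_k$ and the $a_i$ their multiplicities. For $H\subset I$ put $D_H^\circ=\bigcap_{h\in H}D_h\setminus\bigcup_{i\in I\setminus H}D_i$, and write $D_i^\circ=D_{\{i\}}^\circ$, $D_{ij}^\circ=D_{\{i,j\}}^\circ$. For a constructible subset $C\subset\mathcal{X}_k$ define $$\tilde S(\mathcal{X},C)=\sum_{i\in I,\ a_i=1}[D_i^\circ\cap C]+\sum_{\{i,j\}\subset I,\ i\ne j,\ \gcd(a_i,a_j)=1}\frac{1}{a_ia_j}[D_{ij}^\circ\cap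 C](1-\mathbb{L})\ \in\ K_0(\mathrm{Var}_k)_{\mathbb{Q}}/(\mathbb{L}-1)^2 .$$ Let $f\colon\mathcal{Y}\to\mathcal{X}$ be the blowup along a closed subscheme $Z\subset\mathcal{X}_k$ that is smooth over $k$, irreducible, and has normal crossings with $\mathcal{X}_k$: for every closed point $x\in Z$ there are a regular system of parameters $x_1,\dots,x_d$ of $\mathcal{O}_{\mathcal{X},x}$ and subsets $V,W\subset\{1,\dots,d\}$ such that, in a neighborhood of $x$, the support of $\mathcal{X}_k$ is the zero locus of $\prod_{v\in V}x_v$ and $Z$ is the common zero locus of the $x_w$, $w\in W$. Define $\tilde S(\mathcal{Y},C')$ for constructible $C'\subset\mathcal{Y}_k$ by the same formula, using the irreducible components of $\mathcal{Y}_k$ and their multiplicities. Then for every constructible subset $C\subset\mathcal{X}_k$, $$\tilde S(\mathcal{X},C)=\tilde S(\mathcal{Y},f^{-1}(C))\quad\text{in } K_0(\mathrm{Var}_k)_{\mathbb{Q}}/(\mathbb{L}-1)^2 .$$ -/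

import Mathlib

open CategoryTheory CategoryTheory.Limits AlgebraicGeometry
open scoped TensorProduct

universe u

namespace MotivicSerre

noncomputable section

/-! ### The Grothendieck ring of varieties -/

/-- A `k`-variety: a separated scheme of finite type over the field `k`. -/
structure KVar (k : Type u) [Field k] where
  /-- the underlying scheme -/
  X : Scheme.{u}
  /-- the structure morphism -/
  str : X ⟶ Spec (CommRingCat.of k)
  [locallyOfFiniteType : LocallyOfFiniteType str]
  [quasiCompact : QuasiCompact str]
  [isSeparated : IsSeparated str]

/-- The point `Spec k`. -/
def KVar.point (k : Type u) [Field k] : KVar k where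
  X := Spec (CommRingCat.of k)
  str := 𝟙 _

instance affineLine_locallyOfFiniteType (k : Type u) [Field k] :
    LocallyOfFiniteType
      (Spec.map (CommRingCat.ofHom (Polynomial.C : k →+* Polynomial k))) := by
  rw [HasRingHomProperty.Spec_iff (P := @LocallyOfFiniteType)]
  have h : (algebraMap k (Polynomial k)).FiniteType :=
    RingHom.finiteType_algebraMap.mpr inferInstance
  exact h

/-- The affine line `Spec k[t]`. -/
def KVar.affineLine (k : Type u) [Field k] : KVar k where
  X := Spec (CommRingCat.of (Polynomial k))
  str := Spec.map (CommRingCat.ofHom (Polynomial.C : k →+* Polynomial k))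

/-- The relators of the Grothendieck ring, in the free commutative ring on the `k`-varieties:
isomorphic varieties are identified, a variety is the sum of a closed subscheme and its open
complement, the product is the fibre product over `k`, and the point is the unit. -/
inductive IsRelator (k : Type u) [Field k] : FreeCommRing (KVar k) → Prop
  | iso (V W : KVar k) (e : V.X ≅ W.X) (he : e.hom ≫ W.str = V.str) :
      IsRelator k (FreeCommRing.of V - FreeCommRing.of W)
  | scissor (V Z U : KVar k) (i : Z.X ⟶ V.X) (j : U.X ⟶ V.X)
      (hi : IsClosedImmersion i) (hj : IsOpenImmersion j)
      (hik : i ≫ V.str = Z.str) (hjk : j ≫ V.str = U.str)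
      (hij : Set.range j = (Set.range i)ᶜ) :
      IsRelator k (FreeCommRing.of V - (FreeCommRing.of Z + FreeCommRing.of U))
  | prod (V W P : KVar k) (p : P.X ⟶ V.X) (q : P.X ⟶ W.X)
      (h : IsPullback p q V.str W.str) (hP : p ≫ V.str = P.str) :
      IsRelator k (FreeCommRing.of P - FreeCommRing.of V * FreeCommRing.of W)
  | one : IsRelator k (FreeCommRing.of (KVar.point k) - 1)

/-- The Grothendieck ring `K₀(Var_k)`. -/
def K0Var (k : Type u) [Field k] : Type (u + 1) :=
  FreeCommRing (KVar k) ⧸ Ideal.span {r | IsRelator k r}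

instance (k : Type u) [Field k] : CommRing (K0Var k) :=
  inferInstanceAs (CommRing (FreeCommRing (KVar k) ⧸ Ideal.span {r | IsRelator k r}))

/-- The quotient map from the free commutative ring on the `k`-varieties to `K₀(Var_k)`. -/
def K0Var.quot (k : Type u) [Field k] : FreeCommRing (KVar k) →+* K0Var k :=
  Ideal.Quotient.mk (Ideal.span {r | IsRelator k r})

/-- The class `[V]` of a variety in `K₀(Var_k)`. -/
def K0Var.mk {k : Type u} [Field k] (V : KVar k) : K0Var k :=
  K0Var.quot k (FreeCommRing.of V)

/-- `K₀(Var_k)_ℚ = ℚ ⊗ K₀(Var_k)`. -/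
def K0VarQ (k : Type u) [Field k] : Type (u + 1) := ℚ ⊗[ℤ] K0Var k

instance (k : Type u) [Field k] : CommRing (K0VarQ k) :=
  inferInstanceAs (CommRing (ℚ ⊗[ℤ] K0Var k))

instance (k : Type u) [Field k] : Algebra ℚ (K0VarQ k) :=
  inferInstanceAs (Algebra ℚ (ℚ ⊗[ℤ] K0Var k))

/-- The canonical map `K₀(Var_k) → K₀(Var_k)_ℚ`, `x ↦ 1 ⊗ x`. -/
def K0VarQ.incl (k : Type u) [Field k] : K0Var k →+* K0VarQ k :=
  (Algebra.TensorProduct.includeRight : K0Var k →ₐ[ℤ] ℚ ⊗[ℤ] K0Var k).toRingHom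

/-- The ideal of `K₀(Var_k)_ℚ` generated by `(𝕃 - 1)²`, where `𝕃` is the class of the affine
line. -/
def sqIdeal (k : Type u) [Field k] : Ideal (K0VarQ k) :=
  Ideal.span {(K0VarQ.incl k (K0Var.mk (KVar.affineLine k)) - 1) ^ 2}

/-- `K₀(Var_k)_ℚ / (𝕃 - 1)²`. -/
def K0VarQMod (k : Type u) [Field k] : Type (u + 1) := K0VarQ k ⧸ sqIdeal k

instance (k : Type u) [Field k] : CommRing (K0VarQMod k) :=
  inferInstanceAs (CommRing (K0VarQ k ⧸ sqIdeal k))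

instance (k : Type u) [Field k] : Algebra ℚ (K0VarQMod k) :=
  inferInstanceAs (Algebra ℚ (K0VarQ k ⧸ sqIdeal k))

/-- The canonical map `K₀(Var_k)_ℚ → K₀(Var_k)_ℚ / (𝕃 - 1)²`. -/
def K0VarQMod.quot (k : Type u) [Field k] : K0VarQ k →+* K0VarQMod k :=
  Ideal.Quotient.mk (sqIdeal k)

/-- The class of a variety in `K₀(Var_k)_ℚ / (𝕃 - 1)²`. -/
def K0VarQMod.mk {k : Type u} [Field k] (V : KVar k) : K0VarQMod k :=
  K0VarQMod.quot k (K0VarQ.incl k (K0Var.mk V))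

/-- The class `𝕃` of the affine line. -/
def lefschetz (k : Type u) [Field k] : K0VarQMod k := K0VarQMod.mk (KVar.affineLine k)

/-! ### Classes of constructible subsets -/

/-- A finite partition of a subset `C` of a `k`-scheme `W` into (the images of) `k`-varieties
immersed in `W`. If `W` is of finite type, then such partitions exist exactly for the
constructible `C`. -/
structure VarPartition {k : Type u} [Field k] {W : Scheme.{u}}
    (q : W ⟶ Spec (CommRingCat.of k)) (C : Set W) where
  /-- the number of parts -/
  n : ℕ
  /-- the parts -/
  part : Fin n → KVar k
  /-- the inclusions of the parts -/
  incl : ∀ s, (part s).X ⟶ W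
  incl_over : ∀ s, incl s ≫ q = (part s).str
  isImmersion : ∀ s, IsImmersion (incl s)
  disjoint : ∀ s t, s ≠ t → Disjoint (Set.range (incl s)) (Set.range (incl t))
  iUnion_eq : ⋃ s, Set.range (incl s) = C

open Classical in
/-- The class `[C]` of a constructible subset `C` of a `k`-scheme `W` of finite type: the sum of
the classes of the parts of a partition of `C` into varieties. By the scissor relations and
noetherian induction it does not depend on the partition. -/
def classOf {k : Type u} [Field k] {W : Scheme.{u}}
    (q : W ⟶ Spec (CommRingCat.of k)) (C : Set W) : K0VarQMod k :=
  if h : Nonempty (VarPartition q C) then ∑ s, K0VarQMod.mk (h.some.part s) else 0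

/-! ### Special fibres, snc models -/

section Models

variable {O : Type u} [CommRing O] [IsDomain O] [IsDiscreteValuationRing O]
variable {X : Scheme.{u}}

/-- The special fibre `X_k` of an `O`-scheme `f : X ⟶ Spec O`. -/
def specialFiber (f : X ⟶ Spec (CommRingCat.of O)) : Scheme.{u} :=
  pullback f (Spec.map (CommRingCat.ofHom (IsLocalRing.residue O)))

/-- The inclusion `X_k ⟶ X`. -/
def specialFiberIncl (f : X ⟶ Spec (CommRingCat.of O)) : specialFiber f ⟶ X :=
  pullback.fst _ _

/-- The structure morphism of `X_k` over the residue field. -/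
def specialFiberStr (f : X ⟶ Spec (CommRingCat.of O)) :
    specialFiber f ⟶ Spec (CommRingCat.of (IsLocalRing.ResidueField O)) :=
  pullback.snd _ _

/-- The morphism `Y_k ⟶ X_k` induced by a morphism `b : Y ⟶ X` of `O`-schemes. -/
def specialFiberMap {Y : Scheme.{u}} (b : Y ⟶ X) (f : X ⟶ Spec (CommRingCat.of O)) :
    specialFiber (b ≫ f) ⟶ specialFiber f :=
  pullback.lift (specialFiberIncl (b ≫ f) ≫ b) (specialFiberStr (b ≫ f))
    ((Category.assoc _ _ _).trans pullback.condition)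

/-- The canonical homomorphism `O → 𝒪_{X,x}`. -/
def toStalk (f : X ⟶ Spec (CommRingCat.of O)) (x : X) : O →+* X.presheaf.stalk x :=
  ((Scheme.ΓSpecIso (CommRingCat.of O)).inv ≫ f.appTop ≫ X.presheaf.germ ⊤ x trivial).hom

/-- The ideal `𝔪_O · 𝒪_{X,x}` of the special fibre in the local ring of `X` at `x`. -/
def fiberIdeal (f : X ⟶ Spec (CommRingCat.of O)) (x : X) : Ideal (X.presheaf.stalk x) :=
  (IsLocalRing.maximalIdeal O).map (toStalk f x)

/-- `x₁, …, x_d` is a regular system of parameters of the regular local ring `R`. -/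
def IsRegularSystem {R : Type u} [CommRing R] [IsLocalRing R] {d : ℕ} (x : Fin d → R) : Prop :=
  ringKrullDim R = d ∧ Ideal.span (Set.range x) = IsLocalRing.maximalIdeal R

/-- `f : X ⟶ Spec O` is a regular flat `O`-scheme of finite type with smooth generic fibre whose
special fibre is a simple normal crossing divisor: at each of its points its support is the zero
locus of a product of members of a regular system of parameters of the (Zariski) local ring. -/
structure IsSNCModel (f : X ⟶ Spec (CommRingCat.of O)) : Prop where
  regular : ∀ x : X, IsRegularLocalRing (X.presheaf.stalk x)
  flat : Flat f
  locallyOfFiniteType : LocallyOfFiniteType f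
  quasiCompact : QuasiCompact f
  smooth_generic : Smooth
    (pullback.snd f (Spec.map (CommRingCat.ofHom (algebraMap O (FractionRing O)))))
  snc : ∀ p : specialFiber f, ∃ (d : ℕ)
    (x : Fin d → X.presheaf.stalk (specialFiberIncl f p)) (V : Finset (Fin d)),
    IsRegularSystem x ∧
    (fiberIdeal f (specialFiberIncl f p)).radical = Ideal.span {∏ v ∈ V, x v}

/-- The closed subscheme `i : Z ⟶ X` has normal crossings with the special fibre: at each closed
point of `Z` there is a regular system of parameters `x₁, …, x_d` of `X` such that locally the
support of the special fibre is the zero locus of `∏_{v ∈ V} x_v` and `Z` is the common zero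
locus of the `x_w`, `w ∈ W`. -/
def HasNormalCrossings (f : X ⟶ Spec (CommRingCat.of O)) {Z : Scheme.{u}} (i : Z ⟶ X) : Prop :=
  ∀ z : Z, IsClosed {i z} → ∃ (d : ℕ) (x : Fin d → X.presheaf.stalk (i z))
    (V W : Finset (Fin d)),
    IsRegularSystem x ∧
    (fiberIdeal f (i z)).radical = Ideal.span {∏ v ∈ V, x v} ∧
    RingHom.ker (i.stalkMap z).hom = Ideal.span (x '' W)

/-! ### The invariant -/

/-- The multiplicity in `X_k` of the irreducible component `D` of `X_k` with generic point `η`: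
the length of `𝒪_{X,η} / 𝔪_O 𝒪_{X,η}`, that is, the order along `D` of a uniformizer of `O`. -/
def multiplicity (f : X ⟶ Spec (CommRingCat.of O)) (η : specialFiber f) : ℕ :=
  (Module.length (X.presheaf.stalk (specialFiberIncl f η))
    (X.presheaf.stalk (specialFiberIncl f η) ⧸ fiberIdeal f (specialFiberIncl f η))).toNat

/-- The set `I` indexing the irreducible components of `X_k`: the generic points of the
components. The component `D_i` is the closure of the point `i`. -/
abbrev ComponentIndex (f : X ⟶ Spec (CommRingCat.of O)) : Type u :=
  genericPoints (specialFiber f)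

/-- The component `D_i`. -/
def component (f : X ⟶ Spec (CommRingCat.of O)) (i : ComponentIndex f) : Set (specialFiber f) :=
  closure {i.1}

/-- The stratum `D_H° = ⋂_{h ∈ H} D_h \ ⋃_{i ∉ H} D_i`. -/
def stratum (f : X ⟶ Spec (CommRingCat.of O)) (H : Finset (ComponentIndex f)) :
    Set (specialFiber f) :=
  (⋂ h ∈ H, component f h) \ ⋃ i ∉ H, component f i

/-- The invariant `S̃(X, C)`: the sum of the `[D_i° ∩ C]` over the `i` with `a_i = 1`, plus the
sum of the `(1 / (a_i a_j)) [D_{ij}° ∩ C] (1 - 𝕃)` over the two-element subsets `{i, j}` of `I`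
with `gcd(a_i, a_j) = 1`. (There are only finitely many components.) -/
def tildeS (f : X ⟶ Spec (CommRingCat.of O)) (C : Set (specialFiber f)) :
    K0VarQMod (IsLocalRing.ResidueField O) :=
  (∑ᶠ (i : ComponentIndex f) (_ : multiplicity f i.1 = 1),
      classOf (specialFiberStr f) (stratum f {i} ∩ C)) +
  ∑ᶠ (H : Finset (ComponentIndex f))
      (_ : H.card = 2 ∧ (H.gcd fun i => multiplicity f i.1) = 1),
      (1 / ((∏ i ∈ H, multiplicity f i.1 : ℕ) : ℚ)) •
        (classOf (specialFiberStr f) (stratum f H ∩ C) *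
          (1 - lefschetz (IsLocalRing.ResidueField O)))

end Models

/-! ### Blowups -/

/-- The closed subscheme defined by the ideal sheaf `I` is an effective Cartier divisor: locally
`I` is generated by one nonzerodivisor. -/
def IsCartier {T : Scheme.{u}} (I : T.IdealSheafData) : Prop :=
  ∀ t : T, ∃ U : T.affineOpens, t ∈ U.1 ∧
    ∃ g ∈ nonZeroDivisors Γ(T, U.1), I.ideal U = Ideal.span {g}

/-- `b : Y ⟶ X` is the blowup of `X` along the closed subscheme `i : Z ⟶ X`: the inverse image of
`Z` in `Y` is an effective Cartier divisor, and `b` is universal with this property. -/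
structure IsBlowup {Y X Z : Scheme.{u}} (b : Y ⟶ X) (i : Z ⟶ X) : Prop where
  cartier : IsCartier (i.ker.comap b)
  universal : ∀ (T : Scheme.{u}) (g : T ⟶ X), IsCartier (i.ker.comap g) →
    ∃! h : T ⟶ Y, h ≫ b = g

end

end MotivicSerre

/-! The invariant is a sum, over the strata of the special fibre, of a coefficient `weight m` times
the class of the part of C in that stratum, where m is the multiset of multiplicities of the
components through it (`tildeS_eq_sum`). It is additive in C, so both sides may be compared on small
disjoint pieces of C, locally on X_k.

Around each point of X_k there is an affine chart Spec A with functions x_i such that a uniformizer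
generates the same ideal as a monomial ∏_{v ∈ V} x_v^{a_v}, and the center is either absent or cut
out by the x_w, w ∈ W. Of regularity, only this is kept: every subfamily of the x_i generates a
prime ideal containing no other member (`IsStrictSystem`). Then the components through a point are
the hyperplanes x_v = 0, v ∈ V, that pass through it, with multiplicities a_v (`SNCChart.mults_eq`).
Strictness holds for regular systems of parameters, extends from a local ring to a neighbourhood
(`IsStrictSystem.spreadOut`) and passes to the charts A[x_w/x_s] of the blowup
(`IsStrictSystem.blowupSystem`). The same description is therefore available on Y, without proving
separately that Y is regular.

Off the center the blowup is an isomorphism. Over a piece E of the center through which exactly the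
hyperplanes indexed by H ⊆ V pass, the exceptional divisor is fibred in projective spaces with
homogeneous coordinates indexed by W. Let T ⊆ W be the nonempty set of coordinates that do not
vanish. The corresponding part is a torus of dimension |T| - 1 over E, of class [E](𝕃 - 1)^(|T| -
1). Through it pass the exceptional divisor, of multiplicity e = ∑_{v ∈ H ∩ W} a_v, and the strict
transforms of the hyperplanes in H \ T (`SNCChart.exc_image_class`).

What remains is the identity ∑_T weight(e, a_{H \ T}) (𝕃 - 1)^(|T| - 1) = weight(a_H), proved in
`sum_weight_eq`. For |H| = 1 the terms with T ≠ H cancel in pairs. For |H| ≥ 2, only the T = {t}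
with t ∈ H survive modulo (𝕃 - 1)². If H = {v, w} ⊆ W, the identity becomes 1/((a + b)a) + 1/((a +
b)b) = 1/(ab), together with gcd(a + b, a) = gcd(a + b, b) = gcd(a, b). -/

namespace MotivicSerre

/-! ### Classes of varieties and of immersed pieces -/

section GrothendieckRing

variable {k : Type u} [Field k]

attribute [instance] KVar.locallyOfFiniteType KVar.quasiCompact KVar.isSeparated

theorem K0Var.quot_eq_zero {r : FreeCommRing (KVar k)} (h : IsRelator k r) :
    K0Var.quot k r = 0 :=
  Ideal.Quotient.eq_zero_iff_mem.mpr (Ideal.subset_span h)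

/-- The class map on the free commutative ring. -/
noncomputable def classHom (k : Type u) [Field k] : FreeCommRing (KVar k) →+* K0VarQMod k :=
  (K0VarQMod.quot k).comp ((K0VarQ.incl k).comp (K0Var.quot k))

theorem classHom_of (V : KVar k) : classHom k (FreeCommRing.of V) = K0VarQMod.mk V := rfl

theorem classHom_eq_zero {r : FreeCommRing (KVar k)} (h : IsRelator k r) : classHom k r = 0 := by
  simp [classHom, K0Var.quot_eq_zero h]

theorem mk_scissor (V Z U : KVar k) (i : Z.X ⟶ V.X) (j : U.X ⟶ V.X)
    (hi : IsClosedImmersion i) (hj : IsOpenImmersion j)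
    (hik : i ≫ V.str = Z.str) (hjk : j ≫ V.str = U.str)
    (hij : Set.range j = (Set.range i)ᶜ) :
    K0VarQMod.mk V = K0VarQMod.mk Z + K0VarQMod.mk U := by
  have := classHom_eq_zero (IsRelator.scissor V Z U i j hi hj hik hjk hij)
  simpa [sub_eq_zero, classHom_of] using this

theorem mk_prod (V W P : KVar k) (p : P.X ⟶ V.X) (q : P.X ⟶ W.X)
    (h : IsPullback p q V.str W.str) (hP : p ≫ V.str = P.str) :
    K0VarQMod.mk P = K0VarQMod.mk V * K0VarQMod.mk W := by
  have := classHom_eq_zero (IsRelator.prod V W P p q h hP)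
  simpa [sub_eq_zero, classHom_of] using this

/-- An empty variety is both a closed subscheme of itself and the open complement of that subscheme,
so the scissor relation reads [V] = [V] + [V]. -/
theorem mk_of_isEmpty (V : KVar k) [IsEmpty V.X] : K0VarQMod.mk V = 0 := by
  have := mk_scissor V V V (𝟙 _) (𝟙 _) inferInstance inferInstance (by simp) (by simp)
    (by ext x; exact isEmptyElim x)
  simpa using this

instance (V : KVar k) : IsLocallyNoetherian V.X := LocallyOfFiniteType.isLocallyNoetherian V.str

instance (V : KVar k) : CompactSpace V.X :=
  (quasiCompact_iff_compactSpace V.str).mp inferInstance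

instance (V : KVar k) : IsNoetherian V.X where

/-- A variety from an immersion into a variety. -/
noncomputable def KVar.ofImmersion (V : KVar k) {T : Scheme.{u}} (i : T ⟶ V.X) [IsImmersion i] :
    KVar k where
  X := T
  str := i ≫ V.str
  quasiCompact := by
    have := i.isEmbedding.isInducing.noetherianSpace
    have : QuasiCompact i := inferInstance
    infer_instance

theorem mk_open_add_closed (V : KVar k) {T T' : Scheme.{u}} (i : T ⟶ V.X) [IsOpenImmersion i]
    (j : T' ⟶ V.X) [IsClosedImmersion j] (h : Set.range i = (Set.range j)ᶜ) :
    K0VarQMod.mk V = K0VarQMod.mk (V.ofImmersion j) + K0VarQMod.mk (V.ofImmersion i) :=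
  mk_scissor V (V.ofImmersion j) (V.ofImmersion i) j i ‹_› ‹_› rfl rfl h

/-- A surjective immersion is closed with empty open complement, so the scissor relation gives
equality of classes even when the immersion is not an isomorphism. Nilpotents are thus invisible. -/
theorem mk_ofImmersion_of_surjective (V : KVar k) {T : Scheme.{u}} (i : T ⟶ V.X) [IsImmersion i]
    (h : Set.range i = Set.univ) : K0VarQMod.mk (V.ofImmersion i) = K0VarQMod.mk V := by
  have : IsClosedImmersion i := .of_isPreimmersion i (by simp [h])
  have h1 := mk_open_add_closed V (⊥ : V.X.Opens).ι i (by simp [h])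
  have : IsEmpty (V.ofImmersion (⊥ : V.X.Opens).ι).X := by
    exact ⟨fun x ↦ x.2⟩
  rw [h1, mk_of_isEmpty (V.ofImmersion (⊥ : V.X.Opens).ι), add_zero]

/-- A variety immersed in the `k`-scheme `W`. -/
structure Piece {W : Scheme.{u}} (q : W ⟶ Spec (CommRingCat.of k)) where
  var : KVar k
  incl : var.X ⟶ W
  incl_over : incl ≫ q = var.str
  [isImmersion : IsImmersion incl]

attribute [instance] Piece.isImmersion

namespace Piece

variable {W : Scheme.{u}} {q : W ⟶ Spec (CommRingCat.of k)}

/-- The underlying set of a piece. -/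
def range (p : Piece q) : Set W := Set.range p.incl

/-- The class of a piece. -/
noncomputable def cls (p : Piece q) : K0VarQMod k := K0VarQMod.mk p.var

theorem cls_eq_zero (p : Piece q) (h : p.range = ∅) : p.cls = 0 := by
  have : IsEmpty p.var.X := Set.range_eq_empty_iff.mp h
  exact mk_of_isEmpty _

/-- A piece from an immersion into a piece. -/
noncomputable def ofImmersion (p : Piece q) {T : Scheme.{u}} (i : T ⟶ p.var.X) [IsImmersion i] :
    Piece q where
  var := p.var.ofImmersion i
  incl := i ≫ p.incl
  incl_over := (Category.assoc i p.incl q).trans (congrArg (i ≫ ·) p.incl_over)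
  isImmersion := inferInstanceAs (IsImmersion (i ≫ p.incl))

theorem range_ofImmersion (p : Piece q) {T : Scheme.{u}} (i : T ⟶ p.var.X) [IsImmersion i] :
    (p.ofImmersion i).range = p.incl '' Set.range i := by
  change Set.range (i ≫ p.incl) = _
  rw [Scheme.Hom.comp_base, TopCat.coe_comp, Set.range_comp]

/-- The fibre product of the two immersions is immersed in both pieces, and surjectively since the
ranges agree. The class of a piece therefore depends only on its underlying set. -/
theorem cls_eq_of_range_eq (p p' : Piece q) (h : p.range = p'.range) : p.cls = p'.cls := by
  have h1 : Set.range (pullback.fst p.incl p'.incl) = Set.univ := by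
    rw [Scheme.Pullback.range_fst, Set.eq_univ_iff_forall]
    intro x
    exact (h ▸ ⟨x, rfl⟩ : p.incl x ∈ p'.range)
  have h2 : Set.range (pullback.snd p.incl p'.incl) = Set.univ := by
    rw [Scheme.Pullback.range_snd, Set.eq_univ_iff_forall]
    intro x
    exact (h ▸ ⟨x, rfl⟩ : p'.incl x ∈ p.range)
  have e1 := mk_ofImmersion_of_surjective p.var _ h1
  have e2 := mk_ofImmersion_of_surjective p'.var _ h2
  rw [cls, cls, ← e1, ← e2]
  congr 1
  simp only [KVar.ofImmersion, KVar.mk.injEq, heq_eq_eq, true_and]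
  rw [← p.incl_over, ← p'.incl_over, pullback.condition_assoc]

theorem exists_split (p : Piece q) (O : W.Opens) : ∃ p₁ p₂ : Piece q,
    p₁.range = p.range ∩ O ∧ p₂.range = p.range \ O ∧ p.cls = p₁.cls + p₂.cls := by
  let U := p.incl ⁻¹ᵁ O
  let J := Scheme.IdealSheafData.vanishingIdeal (TopologicalSpace.Opens.compl U)
  have hJ : Set.range J.subschemeι = (U : Set p.var.X)ᶜ := by
    rw [Scheme.IdealSheafData.range_subschemeι]
    simp [J]
  refine ⟨p.ofImmersion U.ι, p.ofImmersion J.subschemeι, ?_, ?_, ?_⟩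
  · rw [range_ofImmersion, Scheme.Opens.range_ι]
    exact Set.image_preimage_eq_range_inter
  · rw [range_ofImmersion, hJ]
    ext w
    constructor
    · rintro ⟨x, hx, rfl⟩
      exact ⟨⟨x, rfl⟩, hx⟩
    · rintro ⟨⟨x, rfl⟩, hx⟩
      exact ⟨x, hx, rfl⟩
  · have := mk_open_add_closed p.var U.ι J.subschemeι (by rw [hJ]; simp)
    rw [cls, this, add_comm]
    rfl

end Piece

end GrothendieckRing

/-! ### Finite partitions and the class of a subset -/

section ClassOf

variable {k : Type u} [Field k] {W : Scheme.{u}} {q : W ⟶ Spec (CommRingCat.of k)}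

/-- The pieces `p s` form a partition of `C`. -/
structure IsPartition {κ : Type} (p : κ → Piece q) (C : Set W) : Prop where
  disjoint : ∀ s t, s ≠ t → Disjoint (p s).range (p t).range
  iUnion_eq : ⋃ s, (p s).range = C

namespace IsPartition

variable {κ κ' : Type} {p : κ → Piece q} {p' : κ' → Piece q} {C D : Set W}

theorem range_subset (h : IsPartition p C) (s : κ) : (p s).range ⊆ C :=
  h.iUnion_eq ▸ Set.subset_iUnion (fun s ↦ (p s).range) s

theorem exists_mem (h : IsPartition p C) {x : W} (hx : x ∈ C) : ∃ s, x ∈ (p s).range := by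
  rwa [← h.iUnion_eq, Set.mem_iUnion] at hx

theorem comp_equiv (h : IsPartition p C) (e : κ' ≃ κ) : IsPartition (p ∘ e) C where
  disjoint s t hst := h.disjoint _ _ (e.injective.ne hst)
  iUnion_eq := by
    rw [← h.iUnion_eq]
    exact e.surjective.iUnion_comp (fun s ↦ (p s).range)

theorem sum_elim (h : IsPartition p C) (h' : IsPartition p' D) (hCD : Disjoint C D) :
    IsPartition (Sum.elim p p') (C ∪ D) where
  disjoint := by
    have key : ∀ s t, Disjoint (p s).range (p' t).range := fun s t ↦
      hCD.mono (h.range_subset s) (h'.range_subset t)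
    rintro (s | s) (t | t) hst
    · exact h.disjoint s t (by simpa using hst)
    · exact key s t
    · exact (key t s).symm
    · exact h'.disjoint s t (by simpa using hst)
  iUnion_eq := by simp [Set.iUnion_sum, h.iUnion_eq, h'.iUnion_eq]

theorem of_range_inter {r : κ → Piece q} (h : IsPartition p C)
    (hr : ∀ s, (r s).range = (p s).range ∩ D) : IsPartition r (C ∩ D) where
  disjoint s t hst := by
    rw [hr, hr]
    exact (h.disjoint s t hst).mono Set.inter_subset_left Set.inter_subset_left
  iUnion_eq := by simp_rw [hr, ← Set.iUnion_inter, h.iUnion_eq]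

theorem sum_eq_cls [Fintype κ] (h : IsPartition p C) (s : κ) (hs : (p s).range = C) :
    ∑ t, (p t).cls = (p s).cls := by
  refine Finset.sum_eq_single s (fun t _ hts ↦ (p t).cls_eq_zero ?_) (by simp)
  have := h.disjoint t s hts
  rw [hs] at this
  exact Set.subset_eq_empty (this (le_refl _) (h.range_subset t)) rfl

/-- Cutting C successively by the opens of ℓ splits both sums additively. When no open is left,
every part is empty or all of C, and two parts equal to C have the same class. -/
theorem sum_eq_of_determined [Fintype κ] [Fintype κ'] (ℓ : List W.Opens)
    (h : IsPartition p C) (h' : IsPartition p' C)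
    (hd : ∀ s, ∀ x ∈ C, ∀ y ∈ C, (∀ O ∈ ℓ, x ∈ O ↔ y ∈ O) → x ∈ (p s).range → y ∈ (p s).range)
    (hd' : ∀ s, ∀ x ∈ C, ∀ y ∈ C, (∀ O ∈ ℓ, x ∈ O ↔ y ∈ O) →
      x ∈ (p' s).range → y ∈ (p' s).range) :
    ∑ s, (p s).cls = ∑ s, (p' s).cls := by
  induction ℓ generalizing C p p' with
  | nil =>
    rcases C.eq_empty_or_nonempty with rfl | ⟨x, hx⟩
    · rw [Finset.sum_eq_zero, Finset.sum_eq_zero]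
      · exact fun s _ ↦ (p' s).cls_eq_zero (Set.subset_empty_iff.mp (h'.range_subset s))
      · exact fun s _ ↦ (p s).cls_eq_zero (Set.subset_empty_iff.mp (h.range_subset s))
    · obtain ⟨s, hs⟩ := h.exists_mem hx
      obtain ⟨s', hs'⟩ := h'.exists_mem hx
      have e : (p s).range = C := (h.range_subset s).antisymm
        fun y hy ↦ hd s x hx y hy (by simp) hs
      have e' : (p' s').range = C := (h'.range_subset s').antisymm
        fun y hy ↦ hd' s' x hx y hy (by simp) hs'
      rw [h.sum_eq_cls s e, h'.sum_eq_cls s' e']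
      exact Piece.cls_eq_of_range_eq _ _ (e.trans e'.symm)
  | cons O ℓ ih =>
    choose p₁ p₂ h₁ h₂ hc using fun s ↦ (p s).exists_split O
    choose p₁' p₂' h₁' h₂' hc' using fun s ↦ (p' s).exists_split O
    simp_rw [hc, hc', Finset.sum_add_distrib]
    congr 1
    · refine ih (h.of_range_inter h₁) (h'.of_range_inter h₁') ?_ ?_
      · intro s x hx y hy hxy hxs
        rw [h₁] at hxs ⊢
        refine ⟨hd s x hx.1 y hy.1 (List.forall_mem_cons.mpr ⟨?_, hxy⟩) hxs.1, hy.2⟩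
        exact iff_of_true hx.2 hy.2
      · intro s x hx y hy hxy hxs
        rw [h₁'] at hxs ⊢
        refine ⟨hd' s x hx.1 y hy.1 (List.forall_mem_cons.mpr ⟨?_, hxy⟩) hxs.1, hy.2⟩
        exact iff_of_true hx.2 hy.2
    · refine ih (h.of_range_inter h₂) (h'.of_range_inter h₂') ?_ ?_
      · intro s x hx y hy hxy hxs
        rw [h₂] at hxs ⊢
        refine ⟨hd s x hx.1 y hy.1 (List.forall_mem_cons.mpr ⟨?_, hxy⟩) hxs.1, hy.2⟩
        exact iff_of_false hx.2 hy.2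
      · intro s x hx y hy hxy hxs
        rw [h₂'] at hxs ⊢
        refine ⟨hd' s x hx.1 y hy.1 (List.forall_mem_cons.mpr ⟨?_, hxy⟩) hxs.1, hy.2⟩
        exact iff_of_false hx.2 hy.2

/-- The range of an immersion is locally closed, hence a difference of two opens. These opens, for
all the parts together, form the list. -/
theorem exists_determining [Fintype κ] (p : κ → Piece q) : ∃ ℓ : List W.Opens, ∀ s x y,
    (∀ O ∈ ℓ, x ∈ O ↔ y ∈ O) → x ∈ (p s).range → y ∈ (p s).range := by
  have h : ∀ s, ∃ U V : W.Opens, (p s).range = (U : Set W) \ V := by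
    intro s
    obtain ⟨U, Z, hU, hZ, e⟩ := (p s).incl.isLocallyClosed_range
    exact ⟨⟨U, hU⟩, ⟨Zᶜ, hZ.isOpen_compl⟩, by simpa [Piece.range, Set.sdiff_eq] using e⟩
  choose U V hUV using h
  classical
  refine ⟨(Finset.univ.image U).toList ++ (Finset.univ.image V).toList, fun s x y hxy hx ↦ ?_⟩
  rw [hUV] at hx ⊢
  have h1 := hxy (U s) (by simp)
  have h2 := hxy (V s) (by simp)
  exact ⟨h1.mp hx.1, fun h ↦ hx.2 (h2.mpr h)⟩

theorem sum_eq [Fintype κ] [Fintype κ'] (h : IsPartition p C) (h' : IsPartition p' C) :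
    ∑ s, (p s).cls = ∑ s, (p' s).cls := by
  obtain ⟨ℓ, hℓ⟩ := exists_determining p
  obtain ⟨ℓ', hℓ'⟩ := exists_determining p'
  refine sum_eq_of_determined (ℓ ++ ℓ') h h' ?_ ?_
  · exact fun s x _ y _ hxy ↦ hℓ s x y fun O hO ↦ hxy O (List.mem_append_left _ hO)
  · exact fun s x _ y _ hxy ↦ hℓ' s x y fun O hO ↦ hxy O (List.mem_append_right _ hO)

end IsPartition

variable (q) in
/-- The subset `C` is a finite disjoint union of immersed varieties. -/
def HasClass (C : Set W) : Prop := ∃ (n : ℕ) (p : Fin n → Piece q), IsPartition p C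

theorem IsPartition.hasClass {κ : Type} [Finite κ] {p : κ → Piece q} {C : Set W}
    (h : IsPartition p C) : HasClass q C := by
  obtain ⟨n, ⟨e⟩⟩ := Finite.exists_equiv_fin κ
  exact ⟨n, _, h.comp_equiv e.symm⟩

/-- The partition chosen in `classOf` may be replaced by any other, by `IsPartition.sum_eq`. Every
evaluation of a class rests on this. -/
theorem IsPartition.classOf_eq {κ : Type} [Fintype κ] {p : κ → Piece q} {C : Set W}
    (h : IsPartition p C) : classOf q C = ∑ s, (p s).cls := by
  have hC : Nonempty (VarPartition q C) := by
    obtain ⟨n, r, hr⟩ := h.hasClass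
    exact ⟨⟨n, fun s ↦ (r s).var, fun s ↦ (r s).incl, fun s ↦ (r s).incl_over,
      fun s ↦ (r s).isImmersion, hr.disjoint, hr.iUnion_eq⟩⟩
  rw [classOf, dif_pos hC]
  let v := hC.some
  let r : Fin v.n → Piece q := fun s ↦
    { var := v.part s, incl := v.incl s, incl_over := v.incl_over s,
      isImmersion := v.isImmersion s }
  exact IsPartition.sum_eq (p := r) ⟨v.disjoint, v.iUnion_eq⟩ h

variable {C D : Set W}

theorem hasClass_empty : HasClass q (∅ : Set W) :=
  ⟨0, Fin.elim0, ⟨fun s ↦ s.elim0, by simp⟩⟩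

theorem classOf_empty : classOf q (∅ : Set W) = 0 := by
  have : IsPartition (q := q) (W := W) Fin.elim0 ∅ := ⟨fun s ↦ s.elim0, by simp⟩
  rw [this.classOf_eq]
  simp

theorem HasClass.union (hC : HasClass q C) (hD : HasClass q D) (h : Disjoint C D) :
    HasClass q (C ∪ D) := by
  obtain ⟨n, p, hp⟩ := hC
  obtain ⟨m, r, hr⟩ := hD
  exact (hp.sum_elim hr h).hasClass

theorem classOf_union (hC : HasClass q C) (hD : HasClass q D) (h : Disjoint C D) :
    classOf q (C ∪ D) = classOf q C + classOf q D := by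
  obtain ⟨n, p, hp⟩ := hC
  obtain ⟨m, r, hr⟩ := hD
  rw [(hp.sum_elim hr h).classOf_eq, hp.classOf_eq, hr.classOf_eq]
  simp

theorem HasClass.inter_open (hC : HasClass q C) (O : W.Opens) : HasClass q (C ∩ O) := by
  obtain ⟨n, p, hp⟩ := hC
  choose p₁ p₂ h₁ h₂ hc using fun s ↦ (p s).exists_split O
  exact ⟨n, p₁, hp.of_range_inter h₁⟩

theorem HasClass.diff_open (hC : HasClass q C) (O : W.Opens) : HasClass q (C \ O) := by
  obtain ⟨n, p, hp⟩ := hC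
  choose p₁ p₂ h₁ h₂ hc using fun s ↦ (p s).exists_split O
  exact ⟨n, p₂, hp.of_range_inter h₂⟩

variable (q) in
/-- Intersecting with `D`, or removing `D`, preserves having a class. -/
def IsClassTest (D : Set W) : Prop :=
  ∀ C, HasClass q C → HasClass q (C ∩ D) ∧ HasClass q (C \ D)

theorem isClassTest_of_isOpen (hD : IsOpen D) : IsClassTest q D :=
  fun _ hC ↦ ⟨hC.inter_open ⟨D, hD⟩, hC.diff_open ⟨D, hD⟩⟩

theorem IsClassTest.compl (hD : IsClassTest q D) : IsClassTest q Dᶜ :=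
  fun C hC ↦ ⟨by simpa [Set.sdiff_eq] using (hD C hC).2, by simpa [Set.sdiff_eq] using (hD C hC).1⟩

theorem isClassTest_of_isClosed (hD : IsClosed D) : IsClassTest q D := by
  simpa using (isClassTest_of_isOpen (q := q) hD.isOpen_compl).compl

theorem IsClassTest.inter {D' : Set W} (hD : IsClassTest q D) (hD' : IsClassTest q D') :
    IsClassTest q (D ∩ D') := by
  intro C hC
  refine ⟨by simpa [Set.inter_assoc] using (hD' _ (hD C hC).1).1, ?_⟩
  have : C \ (D ∩ D') = C \ D ∪ (C ∩ D) \ D' := by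
    ext x
    simp only [Set.mem_sdiff, Set.mem_inter_iff, Set.mem_union]
    tauto
  rw [this]
  refine (hD C hC).2.union (hD' _ (hD C hC).1).2 ?_
  exact Set.disjoint_left.mpr fun x hx hx' ↦ hx.2 hx'.1.2

theorem IsClassTest.union {D' : Set W} (hD : IsClassTest q D) (hD' : IsClassTest q D') :
    IsClassTest q (D ∪ D') := by
  simpa [Set.compl_inter] using (hD.compl.inter hD'.compl).compl

theorem isClassTest_univ : IsClassTest q (Set.univ : Set W) := isClassTest_of_isOpen isOpen_univ

theorem IsClassTest.biInter {κ : Type*} {E : κ → Set W} (s : Finset κ)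
    (h : ∀ i ∈ s, IsClassTest q (E i)) : IsClassTest q (⋂ i ∈ s, E i) := by
  classical
  induction s using Finset.induction_on with
  | empty => simpa using isClassTest_univ
  | insert a s _ ih =>
    rw [Finset.set_biInter_insert]
    exact (h a (by simp)).inter (ih fun i hi ↦ h i (by simp [hi]))

theorem IsClassTest.iUnion {κ : Type*} [Finite κ] {E : κ → Set W}
    (h : ∀ i, IsClassTest q (E i)) : IsClassTest q (⋃ i, E i) := by
  have := Fintype.ofFinite κ
  have h1 := (IsClassTest.biInter Finset.univ fun i _ ↦ (h i).compl).compl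
  simpa [Set.compl_iInter] using h1

theorem isClassTest_of_isConstructible (hD : Topology.IsConstructible D) : IsClassTest q D := by
  induction hD using Topology.IsConstructible.empty_union_induction with
  | open_retrocompact U hUo _ => exact isClassTest_of_isOpen hUo
  | union s hs t ht h1 h2 => exact h1.union h2
  | compl s hs h => exact h.compl

theorem hasClass_biUnion {κ : Type*} {E : κ → Set W} (s : Finset κ)
    (h : ∀ i ∈ s, HasClass q (E i)) (hd : ∀ i ∈ s, ∀ j ∈ s, i ≠ j → Disjoint (E i) (E j)) :
    HasClass q (⋃ i ∈ s, E i) ∧ classOf q (⋃ i ∈ s, E i) = ∑ i ∈ s, classOf q (E i) := by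
  classical
  induction s using Finset.induction_on with
  | empty => simpa using ⟨hasClass_empty, classOf_empty⟩
  | insert a s ha ih =>
    obtain ⟨h1, h2⟩ := ih (fun i hi ↦ h i (by simp [hi]))
      (fun i hi j hj ↦ hd i (by simp [hi]) j (by simp [hj]))
    have h3 : Disjoint (E a) (⋃ i ∈ s, E i) := by
      refine Set.disjoint_iUnion₂_right.mpr fun i hi ↦ hd a (by simp) i (by simp [hi]) ?_
      rintro rfl
      exact ha hi
    rw [Finset.set_biUnion_insert, Finset.sum_insert ha, ← h2]
    exact ⟨(h a (by simp)).union h1 h3, classOf_union (h a (by simp)) h1 h3⟩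

section Immersion

variable {W' : Scheme.{u}} {q' : W' ⟶ Spec (CommRingCat.of k)} (g : W' ⟶ W) [IsImmersion g]

/-- The image of a piece under an immersion. -/
def Piece.map (hg : g ≫ q = q') (p : Piece q') : Piece q where
  var := p.var
  incl := p.incl ≫ g
  incl_over := by rw [Category.assoc, hg, p.incl_over]

theorem Piece.range_map (hg : g ≫ q = q') (p : Piece q') : (p.map g hg).range = g '' p.range := by
  change Set.range (p.incl ≫ g) = g '' Set.range p.incl
  rw [Scheme.Hom.comp_base, TopCat.coe_comp, Set.range_comp]

theorem IsPartition.map (hg : g ≫ q = q') {κ : Type} {p : κ → Piece q'} {C : Set W'} (h : IsPartition p C) :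
    IsPartition (fun s ↦ (p s).map g hg) (g '' C) where
  disjoint s t hst := by
    rw [Piece.range_map, Piece.range_map]
    exact (Set.disjoint_image_iff g.isEmbedding.injective).mpr (h.disjoint s t hst)
  iUnion_eq := by simp_rw [Piece.range_map, ← Set.image_iUnion, h.iUnion_eq]

theorem HasClass.image (hg : g ≫ q = q') {C : Set W'} (hC : HasClass q' C) : HasClass q (g '' C) := by
  obtain ⟨n, p, hp⟩ := hC
  exact (hp.map g hg).hasClass

theorem classOf_image (hg : g ≫ q = q') {C : Set W'} (hC : HasClass q' C) : classOf q (g '' C) = classOf q' C := by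
  obtain ⟨n, p, hp⟩ := hC
  rw [(hp.map g hg).classOf_eq, hp.classOf_eq]
  rfl

end Immersion

end ClassOf


/-! ### Constructible subsets have a class -/

section FiniteType

variable {k : Type u} [Field k] {W : Scheme.{u}} {q : W ⟶ Spec (CommRingCat.of k)}

theorem hasClass_of_isAffineOpen [LocallyOfFiniteType q] {U : W.Opens} (hU : IsAffineOpen U) :
    HasClass q (U : Set W) := by
  have : IsAffine U.toScheme := hU
  let p : Piece q :=
    { var := { X := U.toScheme, str := U.ι ≫ q }
      incl := U.ι
      incl_over := rfl }
  refine IsPartition.hasClass (κ := Unit) (p := fun _ ↦ p) ⟨fun s t h ↦ (h rfl).elim, ?_⟩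
  rw [Set.iUnion_const]
  exact Scheme.Opens.range_ι U

/-- W is not assumed separated, so it need not be a piece itself. Its affine opens are pieces, and a
finite affine cover is made disjoint by removing from each member the union of the others already
treated. -/
theorem hasClass_univ [LocallyOfFiniteType q] [CompactSpace W] :
    HasClass q (Set.univ : Set W) := by
  obtain ⟨s, hs, e⟩ := (isCompact_and_isOpen_iff_finite_and_eq_biUnion_affineOpens
    (U := (Set.univ : Set W))).mp ⟨isCompact_univ, isOpen_univ⟩
  rw [e]
  clear e
  induction s, hs using Set.Finite.induction_on with
  | empty => simpa using hasClass_empty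
  | @insert U t _ _ ih =>
    rw [Set.biUnion_insert, ← Set.sdiff_union_self]
    have ht : IsOpen (⋃ V ∈ t, (V.1 : Set W)) := isOpen_biUnion fun V _ ↦ V.1.isOpen
    exact (isClassTest_of_isOpen ht _ (hasClass_of_isAffineOpen U.2)).2.union ih
      Set.disjoint_sdiff_left

theorem hasClass_of_isConstructible [LocallyOfFiniteType q] [CompactSpace W] {C : Set W}
    (hC : Topology.IsConstructible C) : HasClass q C := by
  simpa using (isClassTest_of_isConstructible hC _ hasClass_univ).1

end FiniteType

/-! ### Trivial line bundles -/

section AffineLine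

variable {k : Type u} [Field k] {W W' : Scheme.{u}} {q : W ⟶ Spec (CommRingCat.of k)}

/-- The pullback of a piece to the trivial line bundle. -/
noncomputable def Piece.line {g : W' ⟶ W} {r : W' ⟶ (KVar.affineLine k).X}
    (H : IsPullback g r q (KVar.affineLine k).str) (p : Piece q) : Piece (g ≫ q) :=
  have h1 : IsPullback (pullback.snd g p.incl) (pullback.fst g p.incl ≫ r) p.var.str
      (KVar.affineLine k).str := by
    rw [← p.incl_over]
    exact ((IsPullback.of_hasPullback g p.incl).paste_horiz H.flip).flip
  have h2 := MorphismProperty.of_isPullback (P := @LocallyOfFiniteType) h1.flip inferInstance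
  have h3 := MorphismProperty.of_isPullback (P := @QuasiCompact) h1.flip inferInstance
  have h4 := MorphismProperty.of_isPullback (P := @IsSeparated) h1.flip inferInstance
  { var := { X := pullback g p.incl, str := pullback.snd g p.incl ≫ p.var.str }
    incl := pullback.fst g p.incl
    incl_over := by rw [pullback.condition_assoc, p.incl_over] }

variable {g : W' ⟶ W} {r : W' ⟶ (KVar.affineLine k).X}

theorem Piece.range_line (H : IsPullback g r q (KVar.affineLine k).str) (p : Piece q) : (p.line H).range = g ⁻¹' p.range :=
  Scheme.Pullback.range_fst g p.incl

/-- Pasting the two cartesian squares exhibits the pulled back piece as the product of the piece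
with the affine line. -/
theorem Piece.cls_line (H : IsPullback g r q (KVar.affineLine k).str) (p : Piece q) : (p.line H).cls = p.cls * lefschetz k := by
  refine mk_prod p.var (KVar.affineLine k) (p.line H).var (pullback.snd g p.incl)
    (pullback.fst g p.incl ≫ r) ?_ rfl
  rw [← p.incl_over]
  exact ((IsPullback.of_hasPullback g p.incl).paste_horiz H.flip).flip

theorem IsPartition.line (H : IsPullback g r q (KVar.affineLine k).str) {κ : Type} {p : κ → Piece q} {C : Set W} (h : IsPartition p C) :
    IsPartition (fun s ↦ (p s).line H) (g ⁻¹' C) where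
  disjoint s t hst := by
    rw [Piece.range_line, Piece.range_line]
    exact (h.disjoint s t hst).preimage g
  iUnion_eq := by simp_rw [Piece.range_line, ← Set.preimage_iUnion, h.iUnion_eq]

theorem HasClass.preimage_line (H : IsPullback g r q (KVar.affineLine k).str) {C : Set W} (hC : HasClass q C) : HasClass (g ≫ q) (g ⁻¹' C) := by
  obtain ⟨n, p, hp⟩ := hC
  exact (hp.line H).hasClass

theorem classOf_preimage_line (H : IsPullback g r q (KVar.affineLine k).str) {C : Set W} (hC : HasClass q C) :
    classOf (g ≫ q) (g ⁻¹' C) = classOf q C * lefschetz k := by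
  obtain ⟨n, p, hp⟩ := hC
  rw [(hp.line H).classOf_eq, hp.classOf_eq, Finset.sum_mul]
  exact Finset.sum_congr rfl fun s _ ↦ Piece.cls_line H (p s)

end AffineLine

/-! ### Torus cells in affine spaces over a base -/

section Cells

variable (k : Type u) [Field k] (R : Type u) [CommRing R] [Algebra k R]

/-- The structure morphism `Spec R ⟶ Spec k`. -/
noncomputable def specStr : Spec (CommRingCat.of R) ⟶ Spec (CommRingCat.of k) :=
  Spec.map (CommRingCat.ofHom (algebraMap k R))

/-- The morphism of spectra of an algebra. -/
noncomputable abbrev specMap {R S : Type u} [CommRing R] [CommRing S] (φ : R →+* S) :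
    Spec (CommRingCat.of S) ⟶ Spec (CommRingCat.of R) :=
  Spec.map (CommRingCat.ofHom φ)

theorem specMap_comp {R S T : Type u} [CommRing R] [CommRing S] [CommRing T] (φ : R →+* S)
    (ψ : S →+* T) : specMap ψ ≫ specMap φ = specMap (ψ.comp φ) := by
  rw [specMap, specMap, ← Spec.map_comp]
  rfl

/-- The prime ideal of a point of `Spec R`. -/
def pt {R : Type u} [CommRing R] (r : Spec (CommRingCat.of R)) : Ideal R :=
  PrimeSpectrum.asIdeal (R := R) r

instance {R : Type u} [CommRing R] (r : Spec (CommRingCat.of R)) : (pt r).IsPrime :=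
  PrimeSpectrum.isPrime (R := R) r

theorem pt_injective {R : Type u} [CommRing R] :
    Function.Injective (pt : Spec (CommRingCat.of R) → Ideal R) :=
  fun _ _ h ↦ PrimeSpectrum.ext (R := R) h

theorem specMap_specMap {R S T : Type u} [CommRing R] [CommRing S] [CommRing T] (φ : R →+* S)
    (ψ : S →+* T) (r : Spec (CommRingCat.of T)) :
    specMap φ (specMap ψ r) = specMap (ψ.comp φ) r := by
  rw [← specMap_comp, Scheme.Hom.comp_apply]

theorem mem_specMap {R S : Type u} [CommRing R] [CommRing S] (φ : R →+* S)
    (r : Spec (CommRingCat.of S)) (a : R) :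
    a ∈ pt (specMap φ r) ↔ φ a ∈ pt r :=
  Iff.rfl

theorem specMap_congr {R S : Type u} [CommRing R] [CommRing S] {φ ψ : R →+* S} (h : φ = ψ)
    (r : Spec (CommRingCat.of S)) : specMap φ r = specMap ψ r := by
  rw [h]

theorem exists_specMap_eq {R S : Type u} [CommRing R] [CommRing S] {φ : R →+* S}
    (hφ : Function.Surjective φ) {r : Spec (CommRingCat.of R)} (hr : RingHom.ker φ ≤ pt r) :
    ∃ r', specMap φ r' = r := by
  have : r ∈ Set.range (PrimeSpectrum.comap φ) := by
    rw [range_comap_of_surjective _ _ hφ]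
    exact hr
  exact this

theorem isPullback_polynomial :
    IsPullback (specMap (Polynomial.C : R →+* Polynomial R))
      (specMap (Polynomial.mapRingHom (algebraMap k R)) :
        Spec (CommRingCat.of (Polynomial R)) ⟶ (KVar.affineLine k).X)
      (specStr k R) (KVar.affineLine k).str := by
  refine isPullback_SpecMap_of_isPushout _ _ _ _ (IsPushout.of_isColimit
    (c := PushoutCocone.mk (CommRingCat.ofHom (Polynomial.C : R →+* Polynomial R))
      (CommRingCat.ofHom (Polynomial.mapRingHom (algebraMap k R))) ?_) ?_)
  · ext x
    simp
  · refine PushoutCocone.IsColimit.mk _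
      (fun s ↦ CommRingCat.ofHom (Polynomial.eval₂RingHom s.inl.hom (s.inr.hom Polynomial.X)))
      ?_ ?_ ?_
    · intro s
      ext x
      simp
    · intro s
      ext x
      · have := congr($(s.condition).hom x)
        simpa using this
      · simp
    · intro s m h1 h2
      ext x
      · simpa using congr($(h1).hom x)
      · simpa using congr($(h2).hom Polynomial.X)

variable {R}

theorem classOf_preimage_algEquiv {S : Type u} [CommRing S] [Algebra k S] (e : R ≃ₐ[k] S)
    {C : Set (Spec (CommRingCat.of R))} (hC : HasClass (specStr k R) C) :
    HasClass (specStr k S) (specMap (e : R →+* S) ⁻¹' C) ∧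
      classOf (specStr k S) (specMap (e : R →+* S) ⁻¹' C) = classOf (specStr k R) C := by
  let g := specMap (e.symm : S →+* R)
  have hg : g ≫ specStr k S = specStr k R := by
    refine (specMap_comp _ _).trans ?_
    congr 2
    exact e.symm.toAlgHom.comp_algebraMap
  have h1 : specMap (e : R →+* S) ≫ g = 𝟙 _ := by
    refine (specMap_comp _ _).trans ?_
    rw [specMap, ← Spec.map_id]
    congr 1
    ext x
    simp
  have h2 : g ≫ specMap (e : R →+* S) = 𝟙 _ := by
    refine (specMap_comp _ _).trans ?_
    rw [specMap, ← Spec.map_id]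
    congr 1
    ext x
    simp
  have : IsIso g := ⟨_, h2, h1⟩
  have h3 : specMap (e : R →+* S) ⁻¹' C = g '' C := by
    ext r
    constructor
    · intro hr
      refine ⟨_, hr, ?_⟩
      rw [← Scheme.Hom.comp_apply, h1]
      rfl
    · rintro ⟨r, hr, rfl⟩
      rw [Set.mem_preimage, ← Scheme.Hom.comp_apply, h2]
      exact hr
  rw [h3]
  exact ⟨hC.image g hg, classOf_image g hg hC⟩

theorem hasClass_polynomial {C : Set (Spec (CommRingCat.of R))} (hC : HasClass (specStr k R) C) :
    HasClass (specStr k (Polynomial R)) (specMap (Polynomial.C : R →+* Polynomial R) ⁻¹' C) ∧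
      classOf (specStr k (Polynomial R)) (specMap (Polynomial.C : R →+* Polynomial R) ⁻¹' C) =
        classOf (specStr k R) C * lefschetz k := by
  have e : specMap (Polynomial.C : R →+* Polynomial R) ≫ specStr k R =
    specStr k (Polynomial R) := specMap_comp _ _
  rw [← e]
  exact ⟨hC.preimage_line (isPullback_polynomial k R),
    classOf_preimage_line (isPullback_polynomial k R) hC⟩

/-- The points of `Spec R[t]` over `C` at which `t` vanishes exactly if `b` fails. -/
def polyCell (b : Prop) (C : Set (Spec (CommRingCat.of R))) :
    Set (Spec (CommRingCat.of (Polynomial R))) :=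
  {r | specMap (Polynomial.C : R →+* Polynomial R) r ∈ C ∧
    (¬ (Polynomial.X : Polynomial R) ∈ pt r ↔ b)}

open Classical in
-- The locus t = 0 is the image of the zero section, a copy of C. The locus t ≠ 0 is what remains of
-- the line over C, of class [C]𝕃 - [C].
theorem polyCell_class (b : Prop) {C : Set (Spec (CommRingCat.of R))}
    (hC : HasClass (specStr k R) C) :
    HasClass (specStr k (Polynomial R)) (polyCell b C) ∧
      classOf (specStr k (Polynomial R)) (polyCell b C) =
        classOf (specStr k R) C * (if b then lefschetz k - 1 else 1) := by
  obtain ⟨h1, h2⟩ := hasClass_polynomial k hC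
  let ev : Polynomial R →+* R := Polynomial.evalRingHom 0
  have hev : Function.Surjective ev := fun r ↦ ⟨Polynomial.C r, by simp [ev]⟩
  have : IsClosedImmersion (specMap ev) := IsClosedImmersion.spec_of_surjective _ hev
  have e1 : specMap ev ≫ specStr k (Polynomial R) = specStr k R := by
    refine (specMap_comp _ _).trans ?_
    congr 2
    ext x
    simp [ev]
  have e2 : specMap ev ≫ specMap (Polynomial.C : R →+* Polynomial R) = 𝟙 _ := by
    refine (specMap_comp _ _).trans ?_
    rw [specMap, ← Spec.map_id]
    congr 1
    ext x
    simp [ev]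
  have h3 : specMap ev '' C = polyCell False C := by
    ext r
    constructor
    · rintro ⟨r, hr, rfl⟩
      refine ⟨?_, ?_⟩
      · rw [← Scheme.Hom.comp_apply, e2]
        exact hr
      · have : ev Polynomial.X ∈ pt r := by simp [ev]
        simpa using! this
    · rintro ⟨hr, hX⟩
      simp only [iff_false, not_not] at hX
      obtain ⟨r', rfl⟩ := exists_specMap_eq (φ := ev) hev fun f hf ↦ by
        have h5 : Polynomial.X ∣ f := by
          rw [Polynomial.X_dvd_iff, Polynomial.coeff_zero_eq_eval_zero]
          exact hf
        exact Ideal.mem_of_dvd _ h5 hX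
      refine ⟨r', ?_, rfl⟩
      have h6 : specMap (Polynomial.C : R →+* Polynomial R) (specMap ev r') = r' := by
        rw [← Scheme.Hom.comp_apply, e2]
        rfl
      rw [← h6]
      exact hr
  have h4 := hC.image _ e1
  have h5 := classOf_image _ e1 hC
  rw [h3] at h4 h5
  by_cases hb : b
  · simp only [hb, if_true]
    have hV : IsClassTest (specStr k (Polynomial R))
        {r : Spec (CommRingCat.of (Polynomial R)) | (Polynomial.X : Polynomial R) ∈ pt r} := by
      refine isClassTest_of_isClosed ?_
      have := PrimeSpectrum.isClosed_zeroLocus ({Polynomial.X} : Set (Polynomial R))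
      simpa [PrimeSpectrum.zeroLocus] using! this
    have e3 : polyCell True C = specMap (Polynomial.C : R →+* Polynomial R) ⁻¹' C \
        {r : Spec (CommRingCat.of (Polynomial R)) |
          (Polynomial.X : Polynomial R) ∈ pt r} := by
      ext r
      simp [polyCell]
    have h6 : HasClass (specStr k (Polynomial R)) (polyCell True C) := e3 ▸ (hV _ h1).2
    refine ⟨h6, ?_⟩
    have e4 : specMap (Polynomial.C : R →+* Polynomial R) ⁻¹' C =
        polyCell True C ∪ polyCell False C := by
      ext r
      simp only [polyCell, Set.mem_preimage, Set.mem_union, Set.mem_ofPred_eq]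
      tauto
    have hd : Disjoint (polyCell True C) (polyCell False C) :=
      Set.disjoint_left.mpr fun r hr hr' ↦ (hr'.2.mp (hr.2.mpr trivial))
    rw [e4, classOf_union h6 h4 hd, h5] at h2
    rw [mul_sub, mul_one, ← h2, add_sub_cancel_right]
  · simp only [hb, if_false, mul_one]
    exact ⟨h4, h5⟩

/-- The points of `Spec R[t_w]` over `C` at which exactly the `t_w`, `w ∈ T`, do not vanish. -/
def torusCell {σ : Type} (T : Set σ) (C : Set (Spec (CommRingCat.of R))) :
    Set (Spec (CommRingCat.of (MvPolynomial σ R))) :=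
  {r | specMap (MvPolynomial.C : R →+* MvPolynomial σ R) r ∈ C ∧
    ∀ w, ¬ (MvPolynomial.X w : MvPolynomial σ R) ∈ pt r ↔ w ∈ T}

open Classical in
-- Each variable contributes one factor: `polyCell_class` handles the variable `none`, and the
-- others are variables over R[t]. The base ring is quantified inside the statement because it grows
-- from R to R[t] in the induction.
theorem torusCell_class (σ : Type) [Fintype σ] : ∀ {R : Type u} [CommRing R] [Algebra k R]
    {C : Set (Spec (CommRingCat.of R))} (_ : HasClass (specStr k R) C) (T : Set σ),
    HasClass (specStr k (MvPolynomial σ R)) (torusCell T C) ∧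
      classOf (specStr k (MvPolynomial σ R)) (torusCell T C) =
        classOf (specStr k R) C * ∏ w, (if w ∈ T then lefschetz k - 1 else 1) := by
  refine Fintype.induction_empty_option (P := fun σ _ ↦ ∀ {R : Type u} [CommRing R] [Algebra k R]
    {C : Set (Spec (CommRingCat.of R))} (_ : HasClass (specStr k R) C) (T : Set σ),
    HasClass (specStr k (MvPolynomial σ R)) (torusCell T C) ∧
      classOf (specStr k (MvPolynomial σ R)) (torusCell T C) =
        classOf (specStr k R) C * ∏ w, (if w ∈ T then lefschetz k - 1 else 1)) ?_ ?_ ?_ σ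
  · intro α β _ e ih R _ _ C hC T
    let _ : Fintype α := Fintype.ofEquiv β e.symm
    obtain ⟨h1, h2⟩ := ih hC (e ⁻¹' T)
    obtain ⟨h3, h4⟩ := classOf_preimage_algEquiv k
      ((MvPolynomial.renameEquiv R e).restrictScalars k) h1
    have e1 : specMap (((MvPolynomial.renameEquiv R e).restrictScalars k :
        MvPolynomial α R ≃ₐ[k] MvPolynomial β R) : MvPolynomial α R →+* MvPolynomial β R) ⁻¹'
        torusCell (e ⁻¹' T) C = torusCell T C := by
      ext r
      simp only [torusCell, Set.mem_preimage, Set.mem_ofPred_eq, mem_specMap, specMap_specMap]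
      refine and_congr (iff_of_eq (congrArg (· ∈ C) (specMap_congr ?_ r))) ?_
      · ext x
        simp
      · rw [← e.forall_congr_right]
        simp
    rw [e1] at h3 h4
    refine ⟨h3, ?_⟩
    rw [h4, h2]
    congr 1
    exact Fintype.prod_equiv e _ _ (by simp)
  · intro R _ _ C hC T
    obtain ⟨h3, h4⟩ := classOf_preimage_algEquiv k
      ((MvPolynomial.isEmptyAlgEquiv R PEmpty.{1}).restrictScalars k).symm hC
    have e1 : specMap (((MvPolynomial.isEmptyAlgEquiv R PEmpty.{1}).restrictScalars k).symm :
        R →+* MvPolynomial PEmpty R) ⁻¹' C = torusCell T C := by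
      ext r
      simp only [torusCell, Set.mem_preimage, Set.mem_ofPred_eq, IsEmpty.forall_iff, and_true]
      rfl
    rw [e1] at h3 h4
    refine ⟨h3, ?_⟩
    rw [h4]
    simp
  · intro α _ ih R _ _ C hC T
    obtain ⟨h1, h2⟩ := polyCell_class k (none ∈ T) hC
    obtain ⟨h3, h4⟩ := ih h1 (some ⁻¹' T)
    obtain ⟨h5, h6⟩ := classOf_preimage_algEquiv k
      ((MvPolynomial.optionEquivRight R α).restrictScalars k).symm h3
    have e1 : specMap (((MvPolynomial.optionEquivRight R α).restrictScalars k).symm :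
        MvPolynomial α (Polynomial R) →+* MvPolynomial (Option α) R) ⁻¹'
        torusCell (some ⁻¹' T) (polyCell (none ∈ T) C) = torusCell T C := by
      have h7 : ∀ i, (MvPolynomial.optionEquivRight R α).symm (MvPolynomial.X i) =
          MvPolynomial.X (some i) := fun i ↦ by
        rw [AlgEquiv.symm_apply_eq, MvPolynomial.optionEquivRight_X_some]
      have h8 : (MvPolynomial.optionEquivRight R α).symm (MvPolynomial.C Polynomial.X) =
          MvPolynomial.X none := by
        rw [AlgEquiv.symm_apply_eq, MvPolynomial.optionEquivRight_X_none]
      have h9 : ∀ x, (MvPolynomial.optionEquivRight R α).symm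
          (MvPolynomial.C (Polynomial.C x)) = MvPolynomial.C x := fun x ↦ by
        rw [AlgEquiv.symm_apply_eq, MvPolynomial.optionEquivRight_C]
      ext r
      simp only [torusCell, polyCell, Set.mem_preimage, Set.mem_ofPred_eq, mem_specMap,
        specMap_specMap, Option.forall, and_assoc]
      refine and_congr (iff_of_eq (congrArg (· ∈ C) (specMap_congr ?_ r))) (and_congr ?_ ?_)
      · exact RingHom.ext h9
      · exact iff_congr (not_congr (iff_of_eq (congrArg (· ∈ pt r) h8))) Iff.rfl
      · refine forall_congr' fun w ↦ ?_
        refine iff_congr (not_congr (iff_of_eq ?_)) Iff.rfl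
        congr 1
        exact h7 w
    rw [e1] at h5 h6
    refine ⟨h5, ?_⟩
    rw [h6, h4, h2, Fintype.prod_option, mul_assoc]
    rfl

end Cells


/-! ### The invariant as a weighted sum over strata -/

section Weight

variable (k : Type u) [Field k]

open Classical in
/-- The coefficient in `S̃` of a stratum lying on components with multiplicities `m`. -/
noncomputable def weight (m : Multiset ℕ) : K0VarQMod k :=
  (if m = {1} then 1 else 0) +
    if m.card = 2 ∧ m.gcd = 1 then (1 / (m.prod : ℚ)) • (1 - lefschetz k) else 0

end Weight

section Multiplicities

variable {O : Type u} [CommRing O] [IsDomain O] [IsDiscreteValuationRing O]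
variable {X : Scheme.{u}} (f : X ⟶ Spec (CommRingCat.of O))

instance [TopologicalSpace.NoetherianSpace (specialFiber f)] : Finite (ComponentIndex f) := by
  have := TopologicalSpace.NoetherianSpace.finite_irreducibleComponents (α := specialFiber f)
  have : Finite (irreducibleComponents (specialFiber f)) := this
  exact Finite.of_equiv _ genericPoints.equiv.symm

variable {f} in
open Classical in
-- Both sums in the definition are absorbed into one sum over all sets of components, `weight` being
-- zero on the sets that do not contribute. In this form additivity in C is immediate.
theorem tildeS_eq_sum [Fintype (ComponentIndex f)] (C : Set (specialFiber f)) :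
    tildeS f C = ∑ H : Finset (ComponentIndex f),
      weight (IsLocalRing.ResidueField O) (H.val.map fun i ↦ multiplicity f i.1) *
        classOf (specialFiberStr f) (stratum f H ∩ C) := by
  simp_rw [weight, add_mul, Finset.sum_add_distrib, tildeS]
  congr 1
  · rw [finsum_eq_sum_of_fintype]
    simp_rw [finsum_eq_if, ite_mul, one_mul, zero_mul]
    symm
    refine (Finset.sum_of_injOn (fun i ↦ {i}) ?_ ?_ ?_ ?_).symm
    · exact fun i _ j _ h ↦ Finset.singleton_injective h
    · simp
    · intro H _ hH
      rw [if_neg]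
      intro h
      obtain ⟨i, hi, _⟩ := Multiset.map_eq_singleton.mp h
      exact hH ⟨i, by simp, (Finset.val_inj.mp hi).symm⟩
    · intro i _
      simp
  · rw [finsum_eq_sum_of_fintype]
    refine Finset.sum_congr rfl fun H _ ↦ ?_
    rw [finsum_eq_if, ite_mul, zero_mul]
    simp only [Multiset.card_map, Finset.card_val]
    refine if_congr Iff.rfl ?_ rfl
    rw [smul_mul_assoc, mul_comm]
    rfl

variable [TopologicalSpace.NoetherianSpace (specialFiber f)]

/-- The components of the special fibre through `p`. -/
noncomputable def comps (p : specialFiber f) : Finset (ComponentIndex f) :=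
  (Set.toFinite {i | p ∈ component f i}).toFinset

/-- The multiplicities of the components of the special fibre through `p`. -/
noncomputable def mults (p : specialFiber f) : Multiset ℕ :=
  (comps f p).val.map fun i ↦ multiplicity f i.1

variable {f}

theorem mem_comps {p : specialFiber f} {i : ComponentIndex f} :
    i ∈ comps f p ↔ p ∈ component f i := by
  simp [comps]

theorem mem_stratum {p : specialFiber f} {H : Finset (ComponentIndex f)} :
    p ∈ stratum f H ↔ comps f p = H := by
  simp only [stratum, Set.mem_sdiff, Set.mem_iInter, Set.mem_iUnion, not_exists, Finset.ext_iff,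
    mem_comps]
  constructor
  · rintro ⟨h1, h2⟩ i
    exact ⟨fun h ↦ by_contra fun hi ↦ h2 i hi h, h1 i⟩
  · intro h
    exact ⟨fun i hi ↦ (h i).mpr hi, fun i hi hp ↦ hi ((h i).mp hp)⟩

theorem isClassTest_stratum (H : Finset (ComponentIndex f)) :
    IsClassTest (specialFiberStr f) (stratum f H) := by
  rw [stratum, Set.sdiff_eq]
  refine (IsClassTest.biInter H fun i _ ↦ isClassTest_of_isClosed isClosed_closure).inter
    (IsClassTest.compl ?_)
  refine IsClassTest.iUnion fun i ↦ isClassTest_of_isClosed ?_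
  by_cases hi : i ∉ H
  · have : ⋃ (_ : i ∉ H), component f i = component f i := by simp [hi]
    rw [this]
    exact isClosed_closure
  · simp [hi]

theorem tildeS_union {C D : Set (specialFiber f)} (hC : HasClass (specialFiberStr f) C)
    (hD : HasClass (specialFiberStr f) D) (h : Disjoint C D) :
    tildeS f (C ∪ D) = tildeS f C + tildeS f D := by
  let _ := Fintype.ofFinite (ComponentIndex f)
  simp_rw [tildeS_eq_sum, ← Finset.sum_add_distrib, ← mul_add]
  refine Finset.sum_congr rfl fun H _ ↦ ?_
  congr 1
  rw [Set.inter_union_distrib_left, classOf_union]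
  · simpa [Set.inter_comm] using ((isClassTest_stratum H) _ hC).1
  · simpa [Set.inter_comm] using ((isClassTest_stratum H) _ hD).1
  · exact h.mono Set.inter_subset_right Set.inter_subset_right

/-- The strata partition C, and all those that meet C carry the same weight. -/
theorem tildeS_of_mults_eq {C : Set (specialFiber f)} (hC : HasClass (specialFiberStr f) C)
    {m : Multiset ℕ} (hm : ∀ p ∈ C, mults f p = m) :
    tildeS f C = weight (IsLocalRing.ResidueField O) m * classOf (specialFiberStr f) C := by
  classical
  let _ := Fintype.ofFinite (ComponentIndex f)
  obtain ⟨h1, h2⟩ := hasClass_biUnion (q := specialFiberStr f) (E := fun H ↦ stratum f H ∩ C)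
    Finset.univ (fun H _ ↦ by simpa [Set.inter_comm] using ((isClassTest_stratum H) _ hC).1)
    (fun H _ H' _ hH ↦ Set.disjoint_left.mpr fun p hp hp' ↦
      hH ((mem_stratum.mp hp.1).symm.trans (mem_stratum.mp hp'.1)))
  have e : ⋃ H ∈ (Finset.univ : Finset (Finset (ComponentIndex f))), stratum f H ∩ C = C := by
    ext p
    simp [mem_stratum]
  rw [e] at h2
  rw [tildeS_eq_sum, h2, Finset.mul_sum]
  refine Finset.sum_congr rfl fun H _ ↦ ?_
  rcases (stratum f H ∩ C).eq_empty_or_nonempty with h | ⟨p, hp, hpC⟩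
  · rw [h, classOf_empty, mul_zero, mul_zero]
  · rw [← hm p hpC, mults, mem_stratum.mp hp]

end Multiplicities


/-! ### Strict systems and adjoining one quotient -/

section StrictSystem

/-- Every subfamily of `x` generates a prime ideal that contains no other member of `x`. -/
def IsStrictSystem {A : Type*} [CommRing A] {ι : Type*} (x : ι → A) : Prop :=
  ∀ S : Set ι, (Ideal.span (x '' S)).IsPrime ∧ ∀ i ∉ S, x i ∉ Ideal.span (x '' S)

namespace IsStrictSystem

variable {A : Type*} [CommRing A] {ι : Type*} {x : ι → A}

theorem isDomain (h : IsStrictSystem x) : IsDomain A := by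
  have := (h ∅).1
  rw [Set.image_empty, Ideal.span_empty] at this
  exact IsDomain.of_bot_isPrime A

theorem ne_zero (h : IsStrictSystem x) (i : ι) : x i ≠ 0 := by
  simpa using (h ∅).2 i (by simp)

theorem isPrime_span_singleton (h : IsStrictSystem x) (i : ι) :
    (Ideal.span {x i}).IsPrime := by
  simpa using (h {i}).1

theorem prime (h : IsStrictSystem x) (i : ι) : Prime (x i) :=
  (Ideal.span_singleton_prime (h.ne_zero i)).mp (h.isPrime_span_singleton i)

theorem not_dvd (h : IsStrictSystem x) {i j : ι} (hij : i ≠ j) : ¬ x i ∣ x j := by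
  have := (h {i}).2 j (by simpa using hij.symm)
  rwa [Set.image_singleton, Ideal.mem_span_singleton] at this

theorem map_equiv {B : Type*} [CommRing B] (h : IsStrictSystem x) (e : A ≃+* B) :
    IsStrictSystem (e ∘ x) := by
  intro S
  have h1 : Ideal.span ((e ∘ x) '' S) = (Ideal.span (x '' S)).comap (e.symm : B →+* A) := by
    have := Ideal.map_span (e : A →+* B) (x '' S)
    rw [Set.image_image] at this
    rw [Set.image_comp, Set.image_image]
    refine this.symm.trans ?_
    exact (Ideal.map_comap_of_equiv e).trans rfl
  have := (h S).1
  rw [h1]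
  refine ⟨Ideal.comap_isPrime _ _, fun i hi ↦ ?_⟩
  simpa [Ideal.mem_comap] using (h S).2 i hi

/-- A homomorphism to a domain that kills y_i exactly for i ∈ S, and whose kernel lies in their
span, identifies this span with a prime kernel. Strictness is thus tested by one homomorphism for
each S. -/
theorem of_ker {B : Type*} [CommRing B] {y : ι → B} (h : ∀ S : Set ι, ∃ (E : Type _)
    (_ : CommRing E) (_ : IsDomain E) (θ : B →+* E), (∀ i, θ (y i) = 0 ↔ i ∈ S) ∧
    RingHom.ker θ ≤ Ideal.span (y '' S)) : IsStrictSystem y := by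
  intro S
  obtain ⟨E, _, _, θ, h1, h2⟩ := h S
  have h3 : Ideal.span (y '' S) = RingHom.ker θ := by
    refine le_antisymm (Ideal.span_le.mpr ?_) h2
    rintro _ ⟨i, hi, rfl⟩
    exact (h1 i).mpr hi
  rw [h3]
  exact ⟨RingHom.ker_isPrime θ, fun i hi hi' ↦ hi ((h1 i).mp hi')⟩

end IsStrictSystem

/-- The rational root argument, without unique factorization. Since q/p is a root, p divides the
leading coefficient times a power of q, hence the leading coefficient, p being prime and not
dividing q. Subtracting a multiple of pX - q then lowers the degree. -/
theorem linear_dvd_of_eval₂_eq_zero {A : Type*} [CommRing A] [IsDomain A] {p q : A}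
    (hp : Prime p) (hq : ¬ p ∣ q) (P : Polynomial A)
    (hP : P.eval₂ (algebraMap A (FractionRing A))
      (algebraMap A (FractionRing A) q / algebraMap A (FractionRing A) p) = 0) :
    Polynomial.C p * Polynomial.X - Polynomial.C q ∣ P := by
  have hp0 : algebraMap A (FractionRing A) p ≠ 0 := by simpa using hp.ne_zero
  generalize hn : P.natDegree = n
  induction n using Nat.strong_induction_on generalizing P with
  | _ n ih =>
    have hroot : (P.scaleRoots p).IsRoot q := by
      have h1 := Polynomial.scaleRoots_eval₂_eq_zero (s := p) (algebraMap A (FractionRing A)) hP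
      rw [mul_div_cancel₀ _ hp0, Polynomial.eval₂_at_apply] at h1
      exact (map_eq_zero_iff _ (IsFractionRing.injective A (FractionRing A))).mp h1
    have hdvd : p ∣ P.coeff n := by
      have h2 := Polynomial.dvd_term_of_isRoot_of_dvd_terms (p := p) n hroot fun j hj ↦ by
        rw [Polynomial.coeff_scaleRoots, hn]
        rcases lt_or_gt_of_ne hj with hj | hj
        · refine Dvd.dvd.mul_right (Dvd.dvd.mul_left (dvd_pow_self p (by omega)) _) _
        · simp [Polynomial.coeff_eq_zero_of_natDegree_lt (hn.trans_lt hj)]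
      rw [Polynomial.coeff_scaleRoots, hn, Nat.sub_self, pow_zero, mul_one] at h2
      exact (hp.dvd_or_dvd h2).resolve_right fun h ↦ hq (hp.dvd_of_dvd_pow h)
    obtain ⟨d, hd⟩ := hdvd
    rcases Nat.eq_zero_or_pos n with rfl | hpos
    · rw [Polynomial.natDegree_eq_zero] at hn
      obtain ⟨c, rfl⟩ := hn
      rw [Polynomial.eval₂_C, map_eq_zero_iff _ (IsFractionRing.injective A (FractionRing A))] at hP
      simp [hP]
    · set F := Polynomial.C p * Polynomial.X - Polynomial.C q with hF
      set P' := P - Polynomial.C d * Polynomial.X ^ (n - 1) * F with hP'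
      have hsplit : P = P' + Polynomial.C d * Polynomial.X ^ (n - 1) * F := by simp [hP']
      have he : Polynomial.C d * Polynomial.X ^ (n - 1) * F =
          Polynomial.C (d * p) * Polynomial.X ^ n - Polynomial.C (d * q) *
            Polynomial.X ^ (n - 1) := by
        obtain ⟨m, rfl⟩ : ∃ m, n = m + 1 := ⟨n - 1, by omega⟩
        simp only [hF, Nat.add_sub_cancel, map_mul]
        ring
      rcases eq_or_ne P' 0 with h0 | h0
      · rw [hsplit, h0, zero_add]
        exact Dvd.intro_left _ rfl
      have hdeg : P'.natDegree < n := by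
        rw [Polynomial.natDegree_lt_iff_degree_lt h0, Polynomial.degree_lt_iff_coeff_zero]
        intro m hm
        rw [hP', he, Polynomial.coeff_sub, Polynomial.coeff_sub, Polynomial.coeff_C_mul_X_pow,
          Polynomial.coeff_C_mul_X_pow, if_neg (show ¬ m = n - 1 by omega)]
        rcases eq_or_lt_of_le hm with rfl | hm
        · rw [if_pos rfl, hd]
          ring
        · rw [if_neg hm.ne', Polynomial.coeff_eq_zero_of_natDegree_lt (hn.trans_lt hm)]
          simp
      have hFe : F.eval₂ (algebraMap A (FractionRing A))
          (algebraMap A (FractionRing A) q / algebraMap A (FractionRing A) p) = 0 := by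
        simp [hF, mul_div_cancel₀ _ hp0]
      have hP'e : P'.eval₂ (algebraMap A (FractionRing A))
          (algebraMap A (FractionRing A) q / algebraMap A (FractionRing A) p) = 0 := by
        rw [hP', Polynomial.eval₂_sub, hP, Polynomial.eval₂_mul, hFe, mul_zero, sub_zero]
      rw [hsplit]
      exact dvd_add (ih _ hdeg P' hP'e rfl) (Dvd.intro_left _ rfl)

/-- The ring `A[t] / (p t - q)`. -/
abbrev stepRing {A : Type u} [CommRing A] (p q : A) : Type u :=
  Polynomial A ⧸ Ideal.span {Polynomial.C p * Polynomial.X - Polynomial.C q}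

/-- The quotient map onto `A[t] / (p t - q)`. -/
noncomputable abbrev stepMk {A : Type u} [CommRing A] (p q : A) : Polynomial A →+* stepRing p q :=
  Ideal.Quotient.mk _

theorem stepMk_C {A : Type u} [CommRing A] (p q : A) :
    stepMk p q (Polynomial.C q) = stepMk p q (Polynomial.C p) * stepMk p q Polynomial.X := by
  rw [← map_mul, eq_comm, Ideal.Quotient.mk_eq_mk_iff_sub_mem]
  exact Ideal.mem_span_singleton_self _

open Classical in
-- The homomorphism required by `of_ker` depends on S. If w ∈ S, send t to 0 in A/(x_S). If s ∈ S
-- and w ∉ S, the relation is empty modulo x_s and x_w, and t is a free variable over A/(x_{S ∪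
-- {w}}). If neither is in S, send t to x_w/x_s in the fraction field of A/(x_S);
-- `linear_dvd_of_eval₂_eq_zero` computes the kernel.
theorem IsStrictSystem.step {A : Type u} [CommRing A] {ι : Type*} {x : ι → A}
    (h : IsStrictSystem x) {s w : ι} (hsw : s ≠ w) :
    IsStrictSystem (fun i ↦ if i = w then stepMk (x s) (x w) Polynomial.X else
      stepMk (x s) (x w) (Polynomial.C (x i))) := by
  set p := x s with hp
  set q := x w with hq
  set y : ι → stepRing p q := fun i ↦ if i = w then stepMk p q Polynomial.X else
      stepMk p q (Polynomial.C (x i)) with hy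
  have yw : y w = stepMk p q Polynomial.X := by simp [hy]
  have yi : ∀ i, i ≠ w → y i = stepMk p q (Polynomial.C (x i)) := fun i hi ↦ by simp [hy, hi]
  have hC : ∀ (S : Set ι) (J : Ideal (stepRing p q)),
      (∀ i ∈ S, stepMk p q (Polynomial.C (x i)) ∈ J) →
      ∀ P ∈ (Ideal.span (x '' S)).map (Polynomial.C : A →+* Polynomial A), stepMk p q P ∈ J := by
    intro S J hJ P hP
    have : (Ideal.span (x '' S)).map (Polynomial.C : A →+* Polynomial A) ≤
        J.comap (stepMk p q) := by
      rw [Ideal.map_span, Ideal.span_le]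
      rintro _ ⟨_, ⟨i, hi, rfl⟩, rfl⟩
      exact hJ i hi
    exact this hP
  have hker : ∀ (I : Ideal A) (P : Polynomial A), P.map (Ideal.Quotient.mk I) = 0 →
      P ∈ I.map (Polynomial.C : A →+* Polynomial A) := by
    intro I P hP
    rw [Ideal.mem_map_C_iff]
    intro n
    have := congr(Polynomial.coeff $hP n)
    rwa [Polynomial.coeff_map, Polynomial.coeff_zero, Ideal.Quotient.eq_zero_iff_mem] at this
  have sub_y : ∀ S : Set ι, ∀ i ∈ S, y i ∈ Ideal.span (y '' S) :=
    fun S i hi ↦ Ideal.subset_span ⟨i, hi, rfl⟩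
  refine IsStrictSystem.of_ker fun S ↦ ?_
  have hy0 : ∀ {E : Type u} [CommRing E] (θ : stepRing p q →+* E),
      (θ (stepMk p q Polynomial.X) = 0 ↔ w ∈ S) →
      (∀ i ≠ w, θ (stepMk p q (Polynomial.C (x i))) = 0 ↔ i ∈ S) →
      ∀ i, θ (y i) = 0 ↔ i ∈ S := by
    intro E _ θ h1 h2 i
    rcases eq_or_ne i w with rfl | hi
    · rw [yw, h1]
    · rw [yi i hi, h2 i hi]
  have hqx : ∀ T : Ideal (stepRing p q), (y s ∈ T ∨ y w ∈ T) →
      stepMk p q (Polynomial.C (x w)) ∈ T := by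
    intro T hT
    rw [yi s hsw, yw] at hT
    rw [← hq, stepMk_C]
    exact hT.elim (fun h ↦ Ideal.mul_mem_right _ _ h) (fun h ↦ Ideal.mul_mem_left _ _ h)
  by_cases hwS : w ∈ S
  · have := (h S).1
    let θ₀ := Polynomial.eval₂RingHom (Ideal.Quotient.mk (Ideal.span (x '' S))) 0
    have hθ₀ : ∀ P ∈ Ideal.span {Polynomial.C p * Polynomial.X - Polynomial.C q}, θ₀ P = 0 := by
      intro P hP
      obtain ⟨Q, rfl⟩ := Ideal.mem_span_singleton'.mp hP
      have : Ideal.Quotient.mk (Ideal.span (x '' S)) q = 0 :=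
        Ideal.Quotient.eq_zero_iff_mem.mpr (Ideal.subset_span ⟨w, hwS, rfl⟩)
      simp [θ₀, this]
    refine ⟨A ⧸ Ideal.span (x '' S), inferInstance, inferInstance,
      Ideal.Quotient.lift _ θ₀ hθ₀, hy0 _ ?_ ?_, ?_⟩
    · simp [θ₀, hwS]
    · intro i hi
      rw [Ideal.Quotient.lift_mk]
      simp only [θ₀, Polynomial.coe_eval₂RingHom, Polynomial.eval₂_C,
        Ideal.Quotient.eq_zero_iff_mem]
      exact ⟨fun hi ↦ by_contra fun h' ↦ (h S).2 i h' hi, fun hi ↦ Ideal.subset_span ⟨i, hi, rfl⟩⟩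
    · intro z hz
      obtain ⟨P, rfl⟩ := Ideal.Quotient.mk_surjective z
      rw [RingHom.mem_ker, Ideal.Quotient.lift_mk] at hz
      have h1 : P.coeff 0 ∈ Ideal.span (x '' S) := by
        rw [← Ideal.Quotient.eq_zero_iff_mem]
        simpa [θ₀, Polynomial.eval₂_eq_eval_map, Polynomial.eval_zero,
          ← Polynomial.coeff_zero_eq_eval_zero] using hz
      rw [← Polynomial.divX_mul_X_add P, map_add, map_mul]
      refine add_mem (Ideal.mul_mem_left _ _ (yw ▸ sub_y S w hwS)) ?_
      refine hC S _ (fun i hi ↦ ?_) _ (Ideal.mem_map_of_mem _ h1)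
      rcases eq_or_ne i w with rfl | hiw
      · exact hqx _ (Or.inr (sub_y S _ hi))
      · exact yi i hiw ▸ sub_y S i hi
  by_cases hsS : s ∈ S
  · have := (h (insert w S)).1
    let θ₀ := Polynomial.mapRingHom (Ideal.Quotient.mk (Ideal.span (x '' insert w S)))
    have hθ₀ : ∀ P ∈ Ideal.span {Polynomial.C p * Polynomial.X - Polynomial.C q}, θ₀ P = 0 := by
      intro P hP
      obtain ⟨Q, rfl⟩ := Ideal.mem_span_singleton'.mp hP
      have h1 : Ideal.Quotient.mk (Ideal.span (x '' insert w S)) q = 0 :=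
        Ideal.Quotient.eq_zero_iff_mem.mpr (Ideal.subset_span ⟨w, by simp, rfl⟩)
      have h2 : Ideal.Quotient.mk (Ideal.span (x '' insert w S)) p = 0 :=
        Ideal.Quotient.eq_zero_iff_mem.mpr (Ideal.subset_span ⟨s, by simp [hsS], rfl⟩)
      simp [θ₀, h1, h2]
    refine ⟨Polynomial (A ⧸ Ideal.span (x '' insert w S)), inferInstance, inferInstance,
      Ideal.Quotient.lift _ θ₀ hθ₀, hy0 _ ?_ ?_, ?_⟩
    · simp [θ₀, hwS]
    · intro i hi
      rw [Ideal.Quotient.lift_mk]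
      simp only [θ₀, Polynomial.coe_mapRingHom, Polynomial.map_C, Polynomial.C_eq_zero,
        Ideal.Quotient.eq_zero_iff_mem]
      refine ⟨fun hi' ↦ by_contra fun h' ↦ (h (insert w S)).2 i (by simp [hi, h']) hi',
        fun hi ↦ Ideal.subset_span ⟨i, by simp [hi], rfl⟩⟩
    · intro z hz
      obtain ⟨P, rfl⟩ := Ideal.Quotient.mk_surjective z
      rw [RingHom.mem_ker, Ideal.Quotient.lift_mk] at hz
      refine hC (insert w S) _ (fun i hi ↦ ?_) _ (hker _ P hz)
      rcases eq_or_ne i w with rfl | hiw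
      · exact hqx _ (Or.inl (sub_y S s hsS))
      · exact yi i hiw ▸ sub_y S i (Set.mem_of_mem_insert_of_ne hi hiw)
  · have := (h S).1
    let Ā := A ⧸ Ideal.span (x '' S)
    let mk : A →+* Ā := Ideal.Quotient.mk _
    let K := FractionRing Ā
    have hne : ∀ i, algebraMap Ā K (mk (x i)) = 0 ↔ i ∈ S := by
      intro i
      rw [map_eq_zero_iff _ (IsFractionRing.injective Ā K), Ideal.Quotient.eq_zero_iff_mem]
      exact ⟨fun hi' ↦ by_contra fun h' ↦ (h S).2 i h' hi', fun hi ↦ Ideal.subset_span ⟨i, hi, rfl⟩⟩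
    have hp0 : algebraMap Ā K (mk p) ≠ 0 := fun h0 ↦ hsS ((hne s).mp h0)
    have hq0 : algebraMap Ā K (mk q) ≠ 0 := fun h0 ↦ hwS ((hne w).mp h0)
    let θ₀ := Polynomial.eval₂RingHom ((algebraMap Ā K).comp mk)
      (algebraMap Ā K (mk q) / algebraMap Ā K (mk p))
    have hθ₀ : ∀ P ∈ Ideal.span {Polynomial.C p * Polynomial.X - Polynomial.C q}, θ₀ P = 0 := by
      intro P hP
      obtain ⟨Q, rfl⟩ := Ideal.mem_span_singleton'.mp hP
      simp [θ₀, mul_div_cancel₀ _ hp0]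
    refine ⟨K, inferInstance, inferInstance,
      Ideal.Quotient.lift _ θ₀ hθ₀, hy0 _ ?_ ?_, ?_⟩
    · simp [θ₀, hwS, hp0, hq0]
    · intro i hi
      rw [Ideal.Quotient.lift_mk]
      simpa [θ₀] using hne i
    · intro z hz
      obtain ⟨P, rfl⟩ := Ideal.Quotient.mk_surjective z
      rw [RingHom.mem_ker, Ideal.Quotient.lift_mk] at hz
      have hmem : ∀ i ∉ S, ∀ T : Set ι, T = insert i S → ∀ a, mk (x i) ∣ mk a →
          a ∈ Ideal.span (x '' T) := by
        rintro i - T rfl a ⟨b, hb⟩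
        obtain ⟨b, rfl⟩ := Ideal.Quotient.mk_surjective b
        rw [← map_mul, Ideal.Quotient.mk_eq_mk_iff_sub_mem] at hb
        rw [← sub_add_cancel a (x i * b)]
        exact add_mem (Ideal.span_mono (Set.image_mono (Set.subset_insert _ _)) hb)
          (Ideal.mul_mem_right _ _ (Ideal.subset_span ⟨i, by simp, rfl⟩))
      -- The preimage of the ideal generated by x_s modulo x_S is the span of the family S ∪ {s},
      -- which is prime by strictness.
      have hpp : Prime (mk p) := by
        rw [← Ideal.span_singleton_prime (fun h0 ↦ hp0 (by rw [h0, map_zero]))]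
        have h1 : (Ideal.span {mk p}).comap mk = Ideal.span (x '' insert s S) := by
          refine le_antisymm (fun a ha ↦ hmem s hsS _ rfl a (Ideal.mem_span_singleton.mp ha)) ?_
          rw [Ideal.span_le]
          rintro _ ⟨i, rfl | hi, rfl⟩
          · exact Ideal.mem_span_singleton_self _
          · have : mk (x i) = 0 :=
              Ideal.Quotient.eq_zero_iff_mem.mpr (Ideal.subset_span ⟨i, hi, rfl⟩)
            simp [this]
        have h2 := (h (insert s S)).1
        rw [← h1] at h2
        have h3 := Ideal.map_isPrime_of_surjective (f := mk) Ideal.Quotient.mk_surjective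
          (I := (Ideal.span {mk p}).comap mk) (Ideal.comap_mono bot_le)
        rwa [Ideal.map_comap_of_surjective mk Ideal.Quotient.mk_surjective] at h3
      have hpq : ¬ mk p ∣ mk q := fun hd ↦
        (h (insert s S)).2 w (by simp [hsw.symm, hwS]) (hmem s hsS _ rfl q hd)
      obtain ⟨G, hG⟩ := linear_dvd_of_eval₂_eq_zero hpp hpq (P.map mk) (by
        rw [Polynomial.eval₂_map]
        exact hz)
      obtain ⟨G, rfl⟩ := Polynomial.map_surjective mk Ideal.Quotient.mk_surjective G
      have h3 := hker (Ideal.span (x '' S)) (P - (Polynomial.C p * Polynomial.X - Polynomial.C q) * G) (by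
        rw [Polynomial.map_sub]
        simp [hG, mk])
      have h4 := hC S (Ideal.span (y '' S)) (fun i hi ↦ by
        have hiw : i ≠ w := fun e ↦ hwS (e ▸ hi)
        exact yi i hiw ▸ sub_y S i hi) _ h3
      have h5 : stepMk p q ((Polynomial.C p * Polynomial.X - Polynomial.C q) * G) = 0 :=
        Ideal.Quotient.eq_zero_iff_mem.mpr
          (Ideal.mul_mem_right _ _ (Ideal.mem_span_singleton_self _))
      rwa [map_sub, h5, sub_zero] at h4

theorem IsStrictSystem.exists_step {A : Type u} [CommRing A] {ι : Type*} {x : ι → A}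
    (h : IsStrictSystem x) {s w : ι} (hsw : s ≠ w) : ∃ y : ι → stepRing (x s) (x w),
    IsStrictSystem y ∧ y w = stepMk (x s) (x w) Polynomial.X ∧
      ∀ i ≠ w, y i = stepMk (x s) (x w) (Polynomial.C (x i)) := by
  classical
  exact ⟨_, h.step hsw, by simp, fun i hi ↦ by simp [hi]⟩

/-! ### Coordinate rings of blowup charts -/

section ChartRing

variable {A : Type u} [CommRing A] {σ : Type} (p : A) (y : σ → A)

/-- The ring `A[t_w] / (p t_w - y_w)`, the coordinate ring of a chart of the blowup of the ideal
generated by `p` and the `y_w`. -/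
def chartRing : Type u :=
  MvPolynomial σ A ⧸ Ideal.span
    (Set.range fun w ↦ MvPolynomial.C p * MvPolynomial.X w - MvPolynomial.C (y w))

noncomputable instance : CommRing (chartRing p y) :=
  inferInstanceAs (CommRing (MvPolynomial σ A ⧸ Ideal.span
    (Set.range fun w ↦ MvPolynomial.C p * MvPolynomial.X w - MvPolynomial.C (y w))))

namespace chartRing

/-- The quotient map. -/
noncomputable def mk : MvPolynomial σ A →+* chartRing p y := Ideal.Quotient.mk _

noncomputable instance : Algebra A (chartRing p y) :=
  ((mk p y).comp MvPolynomial.C).toAlgebra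

theorem mk_C (a : A) : mk p y (MvPolynomial.C a) = algebraMap A (chartRing p y) a := rfl

theorem mk_surjective : Function.Surjective (mk p y) := Ideal.Quotient.mk_surjective

instance [Finite σ] : Algebra.FiniteType A (chartRing p y) :=
  Algebra.FiniteType.of_surjective (A := MvPolynomial σ A)
    { mk p y with commutes' := mk_C p y } (mk_surjective p y)

/-- The coordinate `t_w = y_w / p`. -/
noncomputable def t (w : σ) : chartRing p y := mk p y (MvPolynomial.X w)

theorem algebraMap_eq (w : σ) :
    algebraMap A (chartRing p y) (y w) = algebraMap A (chartRing p y) p * t p y w := by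
  rw [← mk_C, ← mk_C, t, ← map_mul, eq_comm]
  exact Ideal.Quotient.mk_eq_mk_iff_sub_mem _ _ |>.mpr (Ideal.subset_span ⟨w, rfl⟩)

variable {p y}

/-- The universal property of the chart. -/
noncomputable def lift {R : Type*} [CommRing R] (φ : A →+* R) (r : σ → R)
    (h : ∀ w, φ (y w) = φ p * r w) : chartRing p y →+* R :=
  Ideal.Quotient.lift _ (MvPolynomial.eval₂Hom φ r) (by
    intro a ha
    rw [← RingHom.mem_ker]
    refine (Ideal.span_le (I := RingHom.ker (MvPolynomial.eval₂Hom φ r))).mpr ?_ ha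
    rintro _ ⟨w, rfl⟩
    simp [RingHom.mem_ker, h])

theorem lift_mk {R : Type*} [CommRing R] (φ : A →+* R) (r : σ → R)
    (h : ∀ w, φ (y w) = φ p * r w) (P : MvPolynomial σ A) :
    lift φ r h (mk p y P) = MvPolynomial.eval₂Hom φ r P :=
  Ideal.Quotient.lift_mk _ _ _

@[simp]
theorem lift_algebraMap {R : Type*} [CommRing R] (φ : A →+* R) (r : σ → R)
    (h : ∀ w, φ (y w) = φ p * r w) (a : A) :
    lift φ r h (algebraMap A (chartRing p y) a) = φ a := by
  rw [← mk_C, lift_mk]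
  simp

@[simp]
theorem lift_t {R : Type*} [CommRing R] (φ : A →+* R) (r : σ → R)
    (h : ∀ w, φ (y w) = φ p * r w) (w : σ) : lift φ r h (t p y w) = r w := by
  rw [t, lift_mk]
  simp

theorem ringHom_ext {R : Type*} [CommRing R] {φ ψ : chartRing p y →+* R}
    (h : ∀ a, φ (algebraMap A (chartRing p y) a) = ψ (algebraMap A (chartRing p y) a))
    (h' : ∀ w, φ (t p y w) = ψ (t p y w)) : φ = ψ :=
  Ideal.Quotient.ringHom_ext (MvPolynomial.ringHom_ext h h')

/-- Morphisms out of the chart are determined on `A` as soon as `p` is a nonzerodivisor. -/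
theorem ringHom_ext_of_nonZeroDivisor {R : Type*} [CommRing R] {φ ψ : chartRing p y →+* R}
    (h : ∀ a, φ (algebraMap A (chartRing p y) a) = ψ (algebraMap A (chartRing p y) a))
    (hp : φ (algebraMap A (chartRing p y) p) ∈ nonZeroDivisors R) : φ = ψ := by
  refine ringHom_ext h fun w ↦ ?_
  refine (mul_cancel_left_mem_nonZeroDivisors hp).mp ?_
  rw [← map_mul, h p, ← map_mul, ← algebraMap_eq, h]

variable (p y)

/-- The chart modulo `p` is a polynomial ring over the quotient by the center. -/
noncomputable def toPoly (I : Ideal A) (hI : I = Ideal.span (insert p (Set.range y))) :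
    chartRing p y →+* MvPolynomial σ (A ⧸ I) :=
  lift (MvPolynomial.C.comp (Ideal.Quotient.mk I)) MvPolynomial.X (by
    intro w
    have h1 : Ideal.Quotient.mk I p = 0 :=
      Ideal.Quotient.eq_zero_iff_mem.mpr (hI ▸ Ideal.subset_span (by simp))
    have h2 : Ideal.Quotient.mk I (y w) = 0 :=
      Ideal.Quotient.eq_zero_iff_mem.mpr (hI ▸ Ideal.subset_span (by simp))
    simp [h1, h2])

variable {I : Ideal A} (hI : I = Ideal.span (insert p (Set.range y)))

theorem toPoly_mk (P : MvPolynomial σ A) :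
    toPoly p y I hI (mk p y P) = MvPolynomial.map (Ideal.Quotient.mk I) P := by
  rw [toPoly, lift_mk, MvPolynomial.map_eq_eval₂Hom_C_comp]

theorem toPoly_algebraMap (a : A) :
    toPoly p y I hI (algebraMap _ _ a) = MvPolynomial.C (Ideal.Quotient.mk I a) :=
  lift_algebraMap _ _ _ _

theorem toPoly_t (w : σ) : toPoly p y I hI (t p y w) = MvPolynomial.X w :=
  lift_t _ _ _ _

theorem toPoly_surjective : Function.Surjective (toPoly p y I hI) := by
  intro Q
  obtain ⟨P, rfl⟩ := MvPolynomial.map_surjective _ Ideal.Quotient.mk_surjective Q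
  exact ⟨mk p y P, toPoly_mk p y hI P⟩

/-- A polynomial that dies has all its coefficients in I, and the generators y_w = p t_w of I are
multiples of p in the chart. The exceptional divisor p = 0 is therefore an affine space over the
center. -/
theorem ker_toPoly :
    RingHom.ker (toPoly p y I hI) = Ideal.span {algebraMap A (chartRing p y) p} := by
  apply le_antisymm
  · intro z hz
    obtain ⟨P, rfl⟩ := mk_surjective p y z
    rw [RingHom.mem_ker, toPoly_mk] at hz
    have h1 : P ∈ I.map (MvPolynomial.C : A →+* MvPolynomial σ A) := by
      rw [MvPolynomial.mem_map_C_iff]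
      intro m
      have := congr(MvPolynomial.coeff m $hz)
      rwa [MvPolynomial.coeff_map, MvPolynomial.coeff_zero, Ideal.Quotient.eq_zero_iff_mem] at this
    have h2 : I.map (MvPolynomial.C : A →+* MvPolynomial σ A) ≤
        (Ideal.span {algebraMap A (chartRing p y) p}).comap (mk p y) := by
      rw [hI, Ideal.map_span, Ideal.span_le]
      rintro _ ⟨a, rfl | ⟨w, rfl⟩, rfl⟩
      · exact Ideal.mem_span_singleton_self _
      · rw [SetLike.mem_coe, Ideal.mem_comap, mk_C, algebraMap_eq]
        exact Ideal.mul_mem_right _ _ (Ideal.mem_span_singleton_self _)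
    exact h2 h1
  · rw [Ideal.span_singleton_le_iff_mem, RingHom.mem_ker, toPoly_algebraMap,
      Ideal.Quotient.eq_zero_iff_mem.mpr (hI ▸ Ideal.subset_span (by simp)), map_zero]

end chartRing

end ChartRing

end StrictSystem


/-! ### Strictness on blowup charts -/

section ChartStrict

namespace chartRing

/-- Reindexing the variables of a chart. -/
noncomputable def reindex {A : Type u} [CommRing A] {σ τ : Type} (e : σ ≃ τ) (p : A) (y : τ → A) :
    chartRing p (y ∘ e) ≃+* chartRing p y :=
  RingEquiv.ofRingHom
    (lift (algebraMap A _) (fun w ↦ t p y (e w)) (fun w ↦ algebraMap_eq p y (e w)))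
    (lift (algebraMap A _) (fun w ↦ t p (y ∘ e) (e.symm w)) (fun w ↦ by
      have := algebraMap_eq p (y ∘ e) (e.symm w)
      simpa using this))
    (ringHom_ext (by simp) (by simp))
    (ringHom_ext (by simp) (by simp))

theorem reindex_t {A : Type u} [CommRing A] {σ τ : Type} (e : σ ≃ τ) (p : A) (y : τ → A) (w : σ) :
    reindex e p y (t p (y ∘ e) w) = t p y (e w) := by
  rw [reindex, RingEquiv.ofRingHom_apply, lift_t]

theorem reindex_algebraMap {A : Type u} [CommRing A] {σ τ : Type} (e : σ ≃ τ) (p : A) (y : τ → A)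
    (a : A) : reindex e p y (algebraMap A _ a) = algebraMap A _ a := by
  rw [reindex, RingEquiv.ofRingHom_apply, lift_algebraMap]

/-- A chart without variables. -/
noncomputable def emptyEquiv {A : Type u} [CommRing A] {σ : Type} [IsEmpty σ] (p : A) (y : σ → A) :
    A ≃+* chartRing p y :=
  RingEquiv.ofRingHom (algebraMap A _) (lift (RingHom.id A) isEmptyElim isEmptyElim)
    (ringHom_ext (by simp) isEmptyElim) (by ext; simp)

section Option

variable {A : Type u} [CommRing A] {σ : Type} (p : A) (y : Option σ → A)

/-- The composite `A → A[t]/(pt - q) → chart`. -/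
noncomputable def stepAlg : A →+* chartRing (stepMk p (y none) (Polynomial.C p))
    (fun w ↦ stepMk p (y none) (Polynomial.C (y (some w)))) :=
  (algebraMap (stepRing p (y none)) _).comp ((stepMk p (y none)).comp Polynomial.C)

/-- Adjoining first one variable to a chart and then the others. -/
noncomputable def ofStep : chartRing (stepMk p (y none) (Polynomial.C p))
    (fun w ↦ stepMk p (y none) (Polynomial.C (y (some w)))) →+* chartRing p y :=
  lift (Ideal.Quotient.lift _
      (Polynomial.eval₂RingHom (algebraMap A (chartRing p y)) (t p y none)) (by
        intro P hP
        obtain ⟨Q, rfl⟩ := Ideal.mem_span_singleton'.mp hP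
        simp [algebraMap_eq]))
    (fun w ↦ t p y (some w)) (fun w ↦ by simp [algebraMap_eq])

/-- The inverse of `ofStep`. -/
noncomputable def toStep : chartRing p y →+* chartRing (stepMk p (y none) (Polynomial.C p))
    (fun w ↦ stepMk p (y none) (Polynomial.C (y (some w)))) :=
  lift (stepAlg p y) (fun w ↦ w.elim (algebraMap (stepRing p (y none)) _
    (stepMk p (y none) Polynomial.X)) (t _ _)) (by
      rintro (_ | w)
      · simp [stepAlg, stepMk_C]
      · exact algebraMap_eq (stepMk p (y none) (Polynomial.C p))
          (fun w ↦ stepMk p (y none) (Polynomial.C (y (some w)))) w)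

theorem toStep_t (w : Option σ) : toStep p y (t p y w) =
    w.elim (algebraMap (stepRing p (y none)) _ (stepMk p (y none) Polynomial.X)) (t _ _) :=
  lift_t _ _ _ _

theorem toStep_algebraMap (a : A) : toStep p y (algebraMap A _ a) = stepAlg p y a :=
  lift_algebraMap _ _ _ _

/-- Charts can be built one variable at a time. -/
noncomputable def optionEquiv : chartRing (stepMk p (y none) (Polynomial.C p))
    (fun w ↦ stepMk p (y none) (Polynomial.C (y (some w)))) ≃+* chartRing p y :=
  RingEquiv.ofRingHom (ofStep p y) (toStep p y)
    (ringHom_ext (by simp [toStep, ofStep, stepAlg]) (by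
      rintro (_ | w)
      · simp [toStep, ofStep]
      · simp [toStep, ofStep]))
    (ringHom_ext (by
      intro d
      obtain ⟨P, rfl⟩ := Ideal.Quotient.mk_surjective d
      have : (toStep p y).comp ((ofStep p y).comp ((algebraMap (stepRing p (y none)) _).comp
          (stepMk p (y none)))) = (algebraMap (stepRing p (y none)) _).comp
          (stepMk p (y none)) := by
        refine Polynomial.ringHom_ext (fun a ↦ ?_) ?_
        · simp [toStep, ofStep, stepAlg]
        · simp [toStep, ofStep]
      exact congr($this P)) (by simp [toStep, ofStep]))

end Option

/-- The quotients x_w/x_s are adjoined one at a time, each by `IsStrictSystem.exists_step`; x_s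
remains a member of the system and can serve again. The elements p, y and x' enter through equations
so that the statement can be transported along `reindex` and `optionEquiv`. -/
theorem isStrictSystem (σ : Type) [Fintype σ] : ∀ {A : Type u} [CommRing A] {ι : Type}
    {x : ι → A} (_ : IsStrictSystem x) (s : ι) (e : σ → ι) (_ : Function.Injective e)
    (_ : ∀ w, e w ≠ s) (p : A) (y : σ → A) (_ : x s = p) (_ : ∀ w, x (e w) = y w)
    (x' : ι → chartRing p y)
    (_ : ∀ w, x' (e w) = t _ _ w) (_ : ∀ i, (∀ w, e w ≠ i) → x' i = algebraMap A _ (x i)),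
    IsStrictSystem x' := by
  refine Fintype.induction_empty_option (P := fun σ _ ↦ ∀ {A : Type u} [CommRing A] {ι : Type}
    {x : ι → A} (_ : IsStrictSystem x) (s : ι) (e : σ → ι) (_ : Function.Injective e)
    (_ : ∀ w, e w ≠ s) (p : A) (y : σ → A) (_ : x s = p) (_ : ∀ w, x (e w) = y w)
    (x' : ι → chartRing p y)
    (_ : ∀ w, x' (e w) = t _ _ w) (_ : ∀ i, (∀ w, e w ≠ i) → x' i = algebraMap A _ (x i)),
    IsStrictSystem x') ?_ ?_ ?_ σ
  · intro α β _ g ih A _ ι x hx s e he hs p y hp hy x' h1 h2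
    let E := reindex g p y
    have h3 := ih hx s (e ∘ g) (he.comp g.injective) (fun w ↦ hs _) p (y ∘ g) hp
      (fun w ↦ hy _) (E.symm ∘ x') (fun w ↦ ?_) (fun i hi ↦ ?_)
    · have := h3.map_equiv E
      rwa [← Function.comp_assoc, show E ∘ E.symm = id from funext E.apply_symm_apply] at this
    · rw [Function.comp_apply, Function.comp_apply, h1, RingEquiv.symm_apply_eq, reindex_t]
    · rw [Function.comp_apply, h2 i (fun w hw ↦ hi (g.symm w) (by simpa using hw)),
        RingEquiv.symm_apply_eq, reindex_algebraMap]
  · intro A _ ι x hx s e he hs p y hp hy x' h1 h2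
    have : x' = emptyEquiv p y ∘ x := funext fun i ↦ h2 i isEmptyElim
    rw [this]
    exact hx.map_equiv (emptyEquiv p y)
  · intro α _ ih A _ ι x hx s e he hs p y hp hy x' h1 h2
    obtain ⟨xD, h3, hDe, hDi⟩ := hx.exists_step (hs none).symm
    subst hp
    obtain rfl : x ∘ e = y := funext hy
    let E := optionEquiv (x s) (x ∘ e)
    have h5 := ih h3 s (e ∘ some) (he.comp (Option.some_injective _)) (fun w ↦ hs _)
      (stepMk (x s) (x (e none)) (Polynomial.C (x s)))
      (fun w ↦ stepMk (x s) (x (e none)) (Polynomial.C (x (e (some w)))))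
      (hDi s (hs none).symm) (fun w ↦ hDi _ (he.ne (by simp)))
      (E.symm ∘ x') (fun w ↦ ?_) (fun i hi ↦ ?_)
    · have := h5.map_equiv E
      rwa [← Function.comp_assoc, show E ∘ E.symm = id from funext E.apply_symm_apply] at this
    · exact (congrArg E.symm (h1 (some w))).trans (toStep_t (x s) (x ∘ e) _)
    · rcases eq_or_ne i (e none) with rfl | hin
      · rw [hDe]
        exact (congrArg E.symm (h1 none)).trans (toStep_t (x s) (x ∘ e) _)
      · rw [hDi i hin]
        exact (congrArg E.symm (h2 i (by rintro (_ | w); exacts [hin.symm, hi w]))).trans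
          (toStep_algebraMap (x s) (x ∘ e) _)

end chartRing

end ChartStrict


/-! ### Regular systems of parameters are strict -/

section RegularLocal

theorem le_of_add_le_add_natCast {a c : ℕ} {D : WithBot ℕ∞}
    (h : ((a + c : ℕ) : WithBot ℕ∞) ≤ D + c) : (a : WithBot ℕ∞) ≤ D := by
  induction D with
  | bot => simp at h
  | coe D =>
    induction D with
    | top => exact le_top
    | coe n =>
      norm_cast at h ⊢
      omega

/-- The family `x` generates the maximal ideal and has `dim R` members. -/
structure IsParameterSystem (R : Type u) [CommRing R] [IsLocalRing R] {ι : Type*} [Fintype ι]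
    (x : ι → R) : Prop where
  span_eq : Ideal.span (Set.range x) = IsLocalRing.maximalIdeal R
  dim_eq : ringKrullDim R = Fintype.card ι

variable {R : Type u} [CommRing R] [IsLocalRing R] [IsNoetherianRing R] {ι : Type*} [Fintype ι]
  {x : ι → R}

theorem isLocalRing_quotient {I : Ideal R} (h : I ≤ IsLocalRing.maximalIdeal R) :
    IsLocalRing (R ⧸ I) := by
  have : Nontrivial (R ⧸ I) := Ideal.Quotient.nontrivial_iff.mpr
    (ne_top_of_le_ne_top (IsLocalRing.maximalIdeal.isMaximal R).ne_top h)
  exact .of_surjective' (Ideal.Quotient.mk I) Ideal.Quotient.mk_surjective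

theorem map_mk_maximalIdeal {I : Ideal R} (h : I ≤ IsLocalRing.maximalIdeal R)
    [IsLocalRing (R ⧸ I)] : (IsLocalRing.maximalIdeal R).map (Ideal.Quotient.mk I) =
      IsLocalRing.maximalIdeal (R ⧸ I) := by
  rcases Ideal.map_eq_top_or_isMaximal_of_surjective (Ideal.Quotient.mk I)
    Ideal.Quotient.mk_surjective (IsLocalRing.maximalIdeal.isMaximal R) with h1 | h1
  · have h2 := Ideal.comap_map_of_surjective (Ideal.Quotient.mk I)
      Ideal.Quotient.mk_surjective (IsLocalRing.maximalIdeal R)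
    rw [h1, Ideal.comap_top, ← RingHom.ker_eq_comap_bot, Ideal.mk_ker, sup_eq_left.mpr h] at h2
    exact absurd h2.symm (IsLocalRing.maximalIdeal.isMaximal R).ne_top
  · exact IsLocalRing.eq_maximalIdeal h1

theorem ringKrullDim_le_card (h : Ideal.span (Set.range x) =
    IsLocalRing.maximalIdeal R) : ringKrullDim R ≤ Fintype.card ι := by
  refine (ringKrullDim_le_spanFinrank_maximalIdeal R).trans ?_
  rw [← h]
  norm_cast
  refine (Submodule.spanFinrank_span_le_ncard_of_finite (Set.finite_range x)).trans ?_
  rw [← Set.image_univ, ← Nat.card_eq_fintype_card, ← Set.ncard_univ]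
  exact Set.ncard_image_le Set.finite_univ

namespace IsParameterSystem

theorem span_image_le (hx : IsParameterSystem R x) (S : Set ι) :
    Ideal.span (x '' S) ≤ IsLocalRing.maximalIdeal R :=
  hx.span_eq ▸ Ideal.span_mono (Set.image_subset_range x S)

/-- The remaining parameters generate the maximal ideal of the quotient, which bounds its dimension
above by their number. Dividing by |S| elements lowers the dimension by at most |S|, which gives the
other bound. -/
theorem quotient [DecidableEq ι] (hx : IsParameterSystem R x) (S : Finset ι) :
    ∃ _ : IsLocalRing (R ⧸ Ideal.span (x '' S)), IsParameterSystem (R ⧸ Ideal.span (x '' S))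
      (fun i : {i // i ∉ S} ↦ Ideal.Quotient.mk (Ideal.span (x '' S)) (x i)) := by
  classical
  have hloc := isLocalRing_quotient (hx.span_image_le S)
  have hspan : Ideal.span (Set.range fun i : {i // i ∉ S} ↦
      Ideal.Quotient.mk (Ideal.span (x '' S)) (x i)) =
      IsLocalRing.maximalIdeal (R ⧸ Ideal.span (x '' S)) := by
    have h1 : (IsLocalRing.maximalIdeal R).map (Ideal.Quotient.mk (Ideal.span (x '' S))) =
        IsLocalRing.maximalIdeal (R ⧸ Ideal.span (x '' S)) :=
      map_mk_maximalIdeal (hx.span_image_le S)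
    rw [← h1, ← hx.span_eq, Ideal.map_span]
    apply le_antisymm
    · refine Ideal.span_mono ?_
      rintro _ ⟨i, rfl⟩
      exact ⟨_, ⟨i, rfl⟩, rfl⟩
    · rw [Ideal.span_le]
      rintro _ ⟨_, ⟨i, rfl⟩, rfl⟩
      by_cases hi : i ∈ S
      · have : Ideal.Quotient.mk (Ideal.span (x '' S)) (x i) = 0 :=
          Ideal.Quotient.eq_zero_iff_mem.mpr (Ideal.subset_span ⟨i, hi, rfl⟩)
        rw [this]
        exact zero_mem _
      · exact Ideal.subset_span ⟨⟨i, hi⟩, rfl⟩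
  refine ⟨hloc, hspan, le_antisymm (ringKrullDim_le_card hspan) ?_⟩
  have h2 := ringKrullDim_le_ringKrullDim_quotient_add_card (S.image x) (by
    rw [IsLocalRing.ringJacobson_eq_maximalIdeal]
    intro a ha
    rw [Finset.coe_image] at ha
    exact hx.span_image_le S (Ideal.subset_span ha))
  rw [Finset.coe_image, hx.dim_eq] at h2
  refine le_of_add_le_add_natCast (c := S.card) ?_
  refine le_trans (le_of_eq ?_) (h2.trans ?_)
  · norm_cast
    rw [Fintype.card_subtype_compl, Fintype.card_coe]
    exact Nat.sub_add_cancel (Finset.card_le_univ S)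
  · gcongr
    exact Finset.card_image_le

end IsParameterSystem

theorem exists_prime_le_dim_quotient {R : Type u} [CommRing R] {n : ℕ} (h : n ≤ ringKrullDim R) :
    ∃ q : Ideal R, q.IsPrime ∧ n ≤ ringKrullDim (R ⧸ q) := by
  obtain ⟨l, hl⟩ := Order.le_krullDim_iff.mp h
  refine ⟨l.head.asIdeal, l.head.isPrime, ?_⟩
  rw [ringKrullDim_quotient]
  refine Order.le_krullDim_iff.mpr ⟨⟨l.length, fun i ↦ ⟨l i, l.head_le i⟩, l.step⟩, hl⟩

/-- Induction on the dimension: for a parameter a, the ring R/(a) is a domain of dimension n. A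
prime q with dim R/q ≥ n + 1 cannot contain a, and it must lie in (a). Then q = aq, and q = 0 by
Nakayama. -/
theorem IsParameterSystem.isDomain_aux (n : ℕ) : ∀ {R : Type u} [CommRing R] [IsLocalRing R]
    [IsNoetherianRing R] {ι : Type} [Fintype ι] {x : ι → R} (_ : IsParameterSystem R x)
    (_ : Fintype.card ι = n), IsDomain R := by
  induction n with
  | zero =>
    intro R _ _ _ ι _ x hx hn
    have : IsEmpty ι := Fintype.card_eq_zero_iff.mp hn
    have h1 := hx.span_eq
    rw [Set.range_eq_empty, Ideal.span_empty] at h1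
    exact (IsLocalRing.isField_iff_maximalIdeal_eq.mpr h1.symm).isDomain
  | succ n ih =>
    intro R _ _ _ ι _ x hx hn
    classical
    obtain ⟨i₀⟩ : Nonempty ι := Fintype.card_pos_iff.mp (by omega)
    obtain ⟨hloc, h1⟩ := hx.quotient {i₀}
    have hcard : Fintype.card {i // i ∉ ({i₀} : Finset ι)} = n := by
      rw [Fintype.card_subtype_compl, Fintype.card_coe, hn]
      simp
    have hdom := ih h1 hcard
    have hdim := h1.dim_eq
    rw [hcard] at hdim
    set I := Ideal.span (x '' ({i₀} : Finset ι)) with hI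
    set a := x i₀ with ha
    have hIa : I = Ideal.span {a} := by simp [hI, ha]
    obtain ⟨q, hq, hqdim⟩ := exists_prime_le_dim_quotient (n := n + 1) (R := R)
      (by rw [hx.dim_eq, hn])
    have haq : a ∉ q := by
      intro haq
      have h2 : I ≤ q := by rwa [hIa, Ideal.span_singleton_le_iff_mem]
      have h3 := ringKrullDim_le_of_surjective _ (Ideal.Quotient.factor_surjective h2)
      rw [hdim] at h3
      have := hqdim.trans h3
      norm_cast at this
      omega
    -- For b in q but not in (a), the ring R/(a, b) would have dimension less than n, as R/(a) is a
    -- domain. Yet it surjects onto R/(q + (a)), of dimension at least n.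
    have hqI : q ≤ I := by
      by_contra hqI
      obtain ⟨b, hbq, hbI⟩ := SetLike.not_le_iff_exists.mp hqI
      have hb0 : Ideal.Quotient.mk I b ≠ 0 := fun h ↦ hbI (Ideal.Quotient.eq_zero_iff_mem.mp h)
      have h2 := ringKrullDim_quotient_succ_le_of_nonZeroDivisor
        (mem_nonZeroDivisors_of_ne_zero hb0)
      have h3 := ringKrullDim_le_ringKrullDim_quotient_add_card (R := R ⧸ q)
        {Ideal.Quotient.mk q a} (by
          have hqm : q ≤ IsLocalRing.maximalIdeal R := IsLocalRing.le_maximalIdeal hq.ne_top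
          have := isLocalRing_quotient hqm
          rw [IsLocalRing.ringJacobson_eq_maximalIdeal, Finset.coe_singleton,
            Set.singleton_subset_iff, ← map_mk_maximalIdeal hqm]
          exact Ideal.mem_map_of_mem _ (hx.span_eq ▸ Ideal.subset_span ⟨i₀, rfl⟩))
      let θ : (R ⧸ I) ⧸ Ideal.span {Ideal.Quotient.mk I b} →+*
          (R ⧸ q) ⧸ Ideal.span (({Ideal.Quotient.mk q a} : Finset (R ⧸ q)) : Set (R ⧸ q)) :=
        Ideal.Quotient.lift _ (Ideal.Quotient.lift I ((Ideal.Quotient.mk _).comp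
          (Ideal.Quotient.mk q)) (by
            intro c hc
            rw [hIa, Ideal.mem_span_singleton] at hc
            obtain ⟨c, rfl⟩ := hc
            refine Ideal.Quotient.eq_zero_iff_mem.mpr ?_
            rw [map_mul]
            exact Ideal.mul_mem_right _ _ (Ideal.subset_span (by simp)))) (by
            intro c hc
            obtain ⟨c, rfl⟩ := Ideal.mem_span_singleton.mp hc
            rw [map_mul, Ideal.Quotient.lift_mk, RingHom.comp_apply,
              Ideal.Quotient.eq_zero_iff_mem.mpr hbq, map_zero, zero_mul])
      have hθ : Function.Surjective θ := by
        refine Ideal.Quotient.lift_surjective_of_surjective _ _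
          (Ideal.Quotient.lift_surjective_of_surjective _ _ ?_)
        exact Ideal.Quotient.mk_surjective.comp Ideal.Quotient.mk_surjective
      have h4 := ringKrullDim_le_of_surjective θ hθ
      rw [hdim] at h2
      have h5 := hqdim.trans (h3.trans (add_le_add_left h4 _))
      rw [Finset.card_singleton] at h5
      have h6 := le_of_add_le_add_natCast (a := n) (c := 1) (by exact_mod_cast h5)
      have h7 := (add_le_add_left h6 1).trans h2
      norm_cast at h7
      omega
    -- An element of q has the form ac, and c lies in q because a does not.
    have hq0 : q = ⊥ := by
      refine Submodule.eq_bot_of_le_smul_of_le_jacobson_bot I q (IsNoetherian.noetherian q) ?_ ?_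
      · intro b hb
        have := hqI hb
        rw [hIa, Ideal.mem_span_singleton] at this
        obtain ⟨c, rfl⟩ := this
        have hc := (hq.mem_or_mem hb).resolve_left haq
        rw [hIa]
        exact Submodule.smul_mem_smul (Ideal.mem_span_singleton_self a) hc
      · rw [IsLocalRing.jacobson_eq_maximalIdeal _ bot_ne_top]
        exact hx.span_image_le _
    subst hq0
    exact IsDomain.of_bot_isPrime R

theorem IsParameterSystem.isDomain {R : Type u} [CommRing R] [IsLocalRing R]
    [IsNoetherianRing R] {ι : Type} [Fintype ι] {x : ι → R} (hx : IsParameterSystem R x) :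
    IsDomain R :=
  isDomain_aux _ hx rfl

/-- Quotients by subfamilies again have parameter systems, hence are domains. If a further x_i lay
in the span, adjoining i to S would leave the quotient unchanged while lowering its dimension. -/
theorem IsParameterSystem.isStrictSystem {R : Type u} [CommRing R] [IsLocalRing R]
    [IsNoetherianRing R] {ι : Type} [Fintype ι] {x : ι → R} (hx : IsParameterSystem R x) :
    IsStrictSystem x := by
  classical
  intro S
  obtain ⟨S, rfl⟩ := S.toFinite.exists_finset_coe
  obtain ⟨hloc, h1⟩ := hx.quotient S
  refine ⟨(Ideal.Quotient.isDomain_iff_prime _).mp h1.isDomain, fun i hi hmem ↦ ?_⟩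
  obtain ⟨hloc', h2⟩ := hx.quotient (insert i S)
  have h3 : Ideal.span (x '' (insert i S : Finset ι)) = Ideal.span (x '' S) := by
    rw [Finset.coe_insert, Set.image_insert_eq, Ideal.span_insert, sup_eq_right,
      Ideal.span_singleton_le_iff_mem]
    exact hmem
  have h4 := h2.dim_eq
  rw [h3, h1.dim_eq, Fintype.card_subtype_compl, Fintype.card_subtype_compl, Fintype.card_coe,
    Fintype.card_coe, Finset.card_insert_of_notMem hi] at h4
  norm_cast at h4
  have := Finset.card_le_univ (insert i S)
  rw [Finset.card_insert_of_notMem hi] at this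
  omega

theorem IsRegularSystem.isStrictSystem {R : Type u} [CommRing R] [IsLocalRing R]
    [IsNoetherianRing R] {d : ℕ} {x : Fin d → R} (hx : IsRegularSystem x) :
    IsStrictSystem x :=
  IsParameterSystem.isStrictSystem (R := R) ⟨hx.2, by simpa using hx.1⟩

end RegularLocal


/-! ### Monomial factorization -/

section Factorization

variable {R : Type*} [CommRing R] [IsDomain R]

theorem dvd_of_dvd_prime_mul {p u b : R} (hp : Prime p) (hu : ¬ p ∣ u) (h : u ∣ p * b) :
    u ∣ b := by
  obtain ⟨c, hc⟩ := h
  obtain ⟨d, rfl⟩ := (hp.dvd_or_dvd (Dvd.intro _ hc : p ∣ u * c)).resolve_left hu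
  exact ⟨d, mul_left_cancel₀ hp.ne_zero (by rw [hc]; ring)⟩

theorem isUnit_of_dvd_prod_pow {ι : Type*} {x : ι → R} {V : Finset ι} (n : ℕ) {u : R}
    (hx : ∀ v ∈ V, Prime (x v)) (hu : ∀ v ∈ V, ¬ x v ∣ u) (h : u ∣ (∏ v ∈ V, x v) ^ n) :
    IsUnit u := by
  classical
  have key : ∀ b v, v ∈ V → ∀ m : ℕ, u ∣ x v ^ m * b → u ∣ b := by
    intro b v hv m
    induction m with
    | zero => simp
    | succ m ih =>
      intro h
      rw [pow_succ', mul_assoc] at h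
      exact ih (dvd_of_dvd_prime_mul (hx v hv) (hu v hv) h)
  rw [← Finset.prod_pow] at h
  have : ∀ s ⊆ V, u ∣ ∏ v ∈ s, x v ^ n → IsUnit u := by
    intro s
    induction s using Finset.induction_on with
    | empty => simp [isUnit_iff_dvd_one]
    | insert v s hv ih =>
      intro hs h
      rw [Finset.prod_insert hv] at h
      exact ih ((Finset.subset_insert _ _).trans hs) (key _ v (hs (Finset.mem_insert_self _ _)) n h)
  exact this V subset_rfl h

/-- The largest powers of the given primes are extracted one after another; they exist by the
noetherian condition, and no unique factorization is needed. -/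
theorem exists_eq_prod_pow_mul [IsNoetherianRing R] {ι : Type*} {x : ι → R} (V : Finset ι)
    (hx : ∀ v ∈ V, Prime (x v)) {r : R} (hr : r ≠ 0) :
    ∃ (a : ι → ℕ) (u : R), r = (∏ v ∈ V, x v ^ a v) * u ∧ ∀ v ∈ V, ¬ x v ∣ u := by
  classical
  induction V using Finset.induction_on with
  | empty => exact ⟨0, r, by simp⟩
  | insert v s hv ih =>
    obtain ⟨a, u, h, hu⟩ := ih fun w hw ↦ hx w (Finset.mem_insert_of_mem hw)
    have hu0 : u ≠ 0 := by
      rintro rfl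
      simp [hr] at h
    obtain ⟨n, c, hc, hn⟩ := WfDvdMonoid.max_power_factor hu0
      (hx v (Finset.mem_insert_self _ _)).irreducible
    refine ⟨Function.update a v n, c, ?_, ?_⟩
    · rw [Finset.prod_insert hv, Function.update_self, h, hn]
      have : ∏ w ∈ s, x w ^ Function.update a v n w = ∏ w ∈ s, x w ^ a w :=
        Finset.prod_congr rfl fun w hw ↦ by
          rw [Function.update_of_ne (by rintro rfl; exact hv hw)]
      rw [this]
      ring
    · intro w hw
      rcases Finset.mem_insert.mp hw with rfl | hw
      · exact hc
      · exact fun h ↦ hu w hw (hn ▸ h.mul_left _)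

/-- A principal ideal whose radical is generated by a product of members of a strict system is
generated by a monomial in these members. -/
theorem IsStrictSystem.exists_span_eq_of_radical_eq [IsNoetherianRing R] {ι : Type*} {x : ι → R}
    (hx : IsStrictSystem x) (V : Finset ι) {r : R}
    (h : (Ideal.span {r}).radical = Ideal.span {∏ v ∈ V, x v}) :
    ∃ a : ι → ℕ, (∀ v ∈ V, 1 ≤ a v) ∧ Ideal.span {r} = Ideal.span {∏ v ∈ V, x v ^ a v} := by
  classical
  have hr : r ≠ 0 := by
    rintro rfl
    rw [Ideal.span_singleton_zero, (Ideal.isPrime_bot (α := R)).radical, eq_comm,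
      Ideal.span_singleton_eq_bot] at h
    exact Finset.prod_ne_zero_iff.mpr (fun v _ ↦ hx.ne_zero v) h
  obtain ⟨a, u, hru, hu⟩ := exists_eq_prod_pow_mul V (fun v _ ↦ hx.prime v) hr
  -- The product of the x_v lies in the radical, so r, and with it u, divides a power of this
  -- product, while no x_v divides u.
  have hunit : IsUnit u := by
    have h1 : ∏ v ∈ V, x v ∈ (Ideal.span {r}).radical := h ▸ Ideal.mem_span_singleton_self _
    obtain ⟨n, hn⟩ := h1
    refine isUnit_of_dvd_prod_pow n (fun v _ ↦ hx.prime v) hu ?_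
    exact (Dvd.intro_left _ hru.symm).trans (Ideal.mem_span_singleton.mp hn)
  refine ⟨a, fun v hv ↦ ?_, ?_⟩
  -- Every x_v divides r, because r lies in its own radical. With exponent zero, x_v would have to
  -- divide another x_w.
  · by_contra hav
    have h1 : x v ∣ r := by
      have h2 : r ∈ (Ideal.span {r}).radical := Ideal.le_radical (Ideal.mem_span_singleton_self _)
      rw [h, Ideal.mem_span_singleton] at h2
      exact (Finset.dvd_prod_of_mem _ hv).trans h2
    rw [hru] at h1
    have h3 := ((hx.prime v).dvd_or_dvd h1).resolve_right (hu v hv)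
    obtain ⟨w, hw, h4⟩ := ((hx.prime v).dvd_finsetProd_iff _).mp h3
    have h5 := (hx.prime v).dvd_of_dvd_pow h4
    by_cases hvw : v = w
    · subst hvw
      have : a v = 0 := by omega
      rw [this, pow_zero] at h4
      exact (hx.prime v).not_unit (isUnit_of_dvd_one h4)
    · exact hx.not_dvd hvw h5
  · rw [hru, Ideal.span_singleton_mul_right_unit hunit]

end Factorization

/-! ### Spreading out from a local ring to a neighbourhood -/

section SpreadOut

variable {A R : Type*} [CommRing A] [CommRing R] [Algebra A R] (q : Ideal A) [q.IsPrime]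
  [IsLocalization.AtPrime R q]

theorem exists_mul_mem_of_map_le {I J : Ideal A} (hI : I.FG)
    (h : I.map (algebraMap A R) ≤ J.map (algebraMap A R)) :
    ∃ g ∉ q, ∀ a ∈ I, g * a ∈ J := by
  classical
  obtain ⟨s, rfl⟩ := hI
  have h1 : ∀ a ∈ s, ∃ g ∉ q, g * a ∈ J := by
    intro a ha
    have := h (Ideal.mem_map_of_mem _ (Ideal.subset_span ha))
    obtain ⟨⟨⟨b, hb⟩, ⟨m, hm⟩⟩, h2⟩ := (IsLocalization.mem_map_algebraMap_iff q.primeCompl R).mp this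
    rw [← map_mul] at h2
    obtain ⟨c, hc⟩ := (IsLocalization.eq_iff_exists q.primeCompl R).mp h2
    refine ⟨c * m, q.primeCompl.mul_mem c.2 hm, ?_⟩
    have h3 : (c : A) * m * a = c * b := by rw [← hc]; ring
    rw [h3]
    exact J.mul_mem_left _ hb
  choose! g hg hga using h1
  refine ⟨∏ a ∈ s, g a, fun hmem ↦ ?_, fun a ha ↦ ?_⟩
  · obtain ⟨a, ha, h2⟩ := (Ideal.IsPrime.prod_mem_iff (p := q)).mp hmem
    exact hg a ha h2
  · have : Ideal.span (s : Set A) ≤ J.colon {∏ a ∈ s, g a} := by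
      rw [Ideal.span_le]
      intro a ha
      rw [SetLike.mem_coe, Submodule.mem_colon_singleton, smul_eq_mul, mul_comm,
        ← Finset.prod_erase_mul s g ha, mul_assoc]
      exact J.mul_mem_left _ (hga a ha)
    have := Submodule.mem_colon_singleton.mp (this ha)
    rwa [smul_eq_mul, mul_comm] at this

theorem map_le_map_of_isUnit {B : Type*} [CommRing B] (β : A →+* B) {I J : Ideal A} {g : A}
    (h : ∀ a ∈ I, g * a ∈ J) (hg : IsUnit (β g)) : I.map β ≤ J.map β := by
  rw [Ideal.map_le_iff_le_comap]
  intro a ha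
  have := Ideal.mem_map_of_mem β (h a ha)
  rw [map_mul] at this
  exact (Ideal.unit_mul_mem_iff_mem _ hg).mp this

/-- Two ideals with the same extension to the localization at a prime agree on a neighbourhood
of this prime. -/
theorem exists_map_eq_map [IsNoetherianRing A] {I J : Ideal A}
    (h : I.map (algebraMap A R) = J.map (algebraMap A R)) :
    ∃ g ∉ q, ∀ {B : Type u} [CommRing B] (β : A →+* B), IsUnit (β g) → I.map β = J.map β := by
  obtain ⟨g₁, hg₁, h₁⟩ := exists_mul_mem_of_map_le q (IsNoetherian.noetherian I) h.le
  obtain ⟨g₂, hg₂, h₂⟩ := exists_mul_mem_of_map_le q (IsNoetherian.noetherian J) h.ge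
  refine ⟨g₁ * g₂, q.primeCompl.mul_mem hg₁ hg₂, fun β hβ ↦ ?_⟩
  rw [map_mul, IsUnit.mul_iff] at hβ
  exact le_antisymm (map_le_map_of_isUnit β h₁ hβ.1) (map_le_map_of_isUnit β h₂ hβ.2)

theorem exists_forall_map_eq_map [IsNoetherianRing A] {κ : Type*} [Finite κ] {I J : κ → Ideal A}
    (h : ∀ c, (I c).map (algebraMap A R) = (J c).map (algebraMap A R)) :
    ∃ g ∉ q, ∀ {B : Type u} [CommRing B] (β : A →+* B), IsUnit (β g) →
      ∀ c, (I c).map β = (J c).map β := by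
  classical
  have := Fintype.ofFinite κ
  choose g hg hB using fun c ↦ exists_map_eq_map.{u} q (h c)
  refine ⟨∏ c, g c, fun hmem ↦ ?_, fun β hβ c ↦ hB c β ?_⟩
  · obtain ⟨a, _, h2⟩ := (Ideal.IsPrime.prod_mem_iff (p := q)).mp hmem
    exact hg a h2
  · rw [map_prod, IsUnit.prod_iff] at hβ
    exact hβ c (Finset.mem_univ _)

theorem span_image_units_mul {ι : Type*} {x r : ι → R} (h : ∀ i, Associated (x i) (r i))
    (S : Set ι) : Ideal.span (x '' S) = Ideal.span (r '' S) := by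
  apply le_antisymm <;> rw [Ideal.span_le]
  · rintro _ ⟨i, hi, rfl⟩
    exact Ideal.mem_of_dvd _ (h i).symm.dvd (Ideal.subset_span ⟨i, hi, rfl⟩)
  · rintro _ ⟨i, hi, rfl⟩
    exact Ideal.mem_of_dvd _ (h i).dvd (Ideal.subset_span ⟨i, hi, rfl⟩)

/-- A strict system in the local ring at a prime, adapted to a principal ideal and an ideal,
extends to a neighbourhood of the prime. -/
theorem IsStrictSystem.spreadOut [IsNoetherianRing A] {ι : Type} [Fintype ι] {x : ι → R}
    (hx : IsStrictSystem x) (V : Finset ι) (a : ι → ℕ) (W : Set ι) {c : A} {J : Ideal A}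
    (hc : Ideal.span {algebraMap A R c} = Ideal.span {∏ v ∈ V, x v ^ a v})
    (hJ : J.map (algebraMap A R) = Ideal.span (x '' W)) :
    ∃ (g : A) (r : ι → A), g ∉ q ∧ (∀ {B : Type u} [CommRing B] [Algebra A B]
      [IsLocalization.Away g B],
      IsStrictSystem (fun i ↦ algebraMap A B (r i)) ∧
      Ideal.span {algebraMap A B c} = Ideal.span {∏ v ∈ V, algebraMap A B (r v) ^ a v} ∧
      J.map (algebraMap A B) = Ideal.span ((fun i ↦ algebraMap A B (r i)) '' W)) := by
  classical
  -- Clearing the denominator of x_i multiplies it by a unit of R, which changes none of the ideals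
  -- involved.
  have h1 : ∀ i, ∃ r : A, Associated (x i) (algebraMap A R r) := by
    intro i
    obtain ⟨⟨r, m⟩, h⟩ := IsLocalization.surj q.primeCompl (x i)
    exact ⟨r, (IsLocalization.map_units R m).unit, h⟩
  choose r hr using h1
  have hspan : ∀ S : Set ι, (Ideal.span (r '' S)).map (algebraMap A R) = Ideal.span (x '' S) := by
    intro S
    rw [span_image_units_mul hr, Ideal.map_span, Set.image_image]
  -- The contraction of the prime (x_S) is a prime of A that agrees with the span of the r_i, i ∈ S,
  -- after localization at q, hence near q. There are finitely many S, so a single g serves for all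
  -- of them and for c and J as well.
  let P : Set ι → Ideal A := fun S ↦ (Ideal.span (x '' S)).comap (algebraMap A R)
  have hP : ∀ S, (P S).IsPrime := fun S ↦ by
    have := (hx S).1
    exact Ideal.IsPrime.comap _
  have hPq : ∀ S, P S ≤ q := by
    intro S b hb
    by_contra hbq
    exact (hx S).1.ne_top (Ideal.eq_top_of_isUnit_mem _ hb
      (IsLocalization.map_units R (⟨b, hbq⟩ : q.primeCompl)))
  have hPmap : ∀ S, (P S).map (algebraMap A R) = Ideal.span (x '' S) := fun S ↦
    IsLocalization.map_under q.primeCompl R _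
  obtain ⟨g, hg, hB⟩ := exists_forall_map_eq_map.{u} (A := A) (R := R) q
    (κ := Set ι ⊕ Bool)
    (I := Sum.elim P fun b ↦ if b then Ideal.span {c} else J)
    (J := Sum.elim (fun S ↦ Ideal.span (r '' S))
      fun b ↦ if b then Ideal.span {∏ v ∈ V, r v ^ a v} else Ideal.span (r '' W)) (by
      rintro (S | b)
      · simp only [Sum.elim_inl]
        rw [hPmap, hspan]
      · cases b
        · simp only [Sum.elim_inr, Bool.false_eq_true, if_false]
          rw [hJ, hspan]
        · simp only [Sum.elim_inr, if_true, Ideal.map_span, Set.image_singleton]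
          have hass : Associated (∏ v ∈ V, x v ^ a v) (∏ v ∈ V, algebraMap A R (r v) ^ a v) :=
            Associated.prod _ _ _ fun v _ ↦ (hr v).pow_pow
          rw [hc, map_prod]
          simp only [map_pow]
          exact le_antisymm (Ideal.span_singleton_le_span_singleton.mpr hass.symm.dvd)
            (Ideal.span_singleton_le_span_singleton.mpr hass.dvd))
  refine ⟨g, r, hg, fun {B} _ _ _ ↦ ?_⟩
  have h2 := hB (algebraMap A B) (IsLocalization.Away.algebraMap_isUnit g)
  refine ⟨fun S ↦ ?_, ?_, ?_⟩
  · have h3 := h2 (Sum.inl S)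
    simp only [Sum.elim_inl, Ideal.map_span, Set.image_image] at h3
    rw [← h3]
    have hdisj : Disjoint (Submonoid.powers g : Set A) (P S) := by
      rw [Set.disjoint_left]
      rintro _ ⟨n, rfl⟩ hn
      exact hg (hPq S ((hP S).mem_of_pow_mem _ hn))
    refine ⟨IsLocalization.isPrime_of_isPrime_disjoint (Submonoid.powers g) B _ (hP S) hdisj,
      fun i hi hmem ↦ (hx S).2 i hi ?_⟩
    have h4 : r i ∈ ((P S).map (algebraMap A B)).comap (algebraMap A B) := hmem
    have h5 := IsLocalization.comap_map_of_isPrime_disjoint (Submonoid.powers g) B (I := P S)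
      (hP S) hdisj
    change r i ∈ Ideal.under A ((P S).map (algebraMap A B)) at h4
    rw [h5] at h4
    exact Ideal.mem_of_dvd _ (hr i).symm.dvd h4
  · simpa [Ideal.map_span] using h2 (Sum.inr true)
  · simpa [Ideal.map_span, Set.image_image] using h2 (Sum.inr false)

end SpreadOut


/-! ### Ideal sheaves on affine schemes and Cartier divisors -/

section IdealOn

/-- The ideal of `R` corresponding to an ideal sheaf on `Spec R`. -/
noncomputable def topIdeal {R : Type u} [CommRing R]
    (I : (Spec (CommRingCat.of R)).IdealSheafData) : Ideal R :=
  (I.ideal ⟨⊤, isAffineOpen_top _⟩).comap (Scheme.ΓSpecIso (CommRingCat.of R)).inv.hom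

theorem ΓSpecIso_inv_bijective (R : Type u) [CommRing R] :
    Function.Bijective (Scheme.ΓSpecIso (CommRingCat.of R)).inv.hom :=
  ConcreteCategory.bijective_of_isIso _

theorem ideal_top_eq {R : Type u} [CommRing R] (I : (Spec (CommRingCat.of R)).IdealSheafData) :
    I.ideal ⟨⊤, isAffineOpen_top _⟩ =
      (topIdeal I).map (Scheme.ΓSpecIso (CommRingCat.of R)).inv.hom :=
  (Ideal.map_comap_of_surjective _ (ΓSpecIso_inv_bijective R).2 _).symm

theorem topIdeal_le_topIdeal {R : Type u} [CommRing R]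
    {I J : (Spec (CommRingCat.of R)).IdealSheafData} : topIdeal I ≤ topIdeal J ↔ I ≤ J := by
  refine ⟨fun h ↦ Scheme.IdealSheafData.le_of_isAffine ?_, fun h ↦ Ideal.comap_mono (h _)⟩
  rw [ideal_top_eq, ideal_top_eq]
  exact Ideal.map_mono h

theorem exists_topIdeal_eq {R : Type u} [CommRing R] (a : Ideal R) :
    ∃ I : (Spec (CommRingCat.of R)).IdealSheafData, topIdeal I = a := by
  refine ⟨.ofIdealTop (a.map (Scheme.ΓSpecIso (CommRingCat.of R)).inv.hom), ?_⟩
  have : (Scheme.IdealSheafData.ofIdealTop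
      (a.map (Scheme.ΓSpecIso (CommRingCat.of R)).inv.hom)).ideal ⟨⊤, isAffineOpen_top _⟩ =
      a.map (Scheme.ΓSpecIso (CommRingCat.of R)).inv.hom :=
    Scheme.IdealSheafData.equivOfIsAffine.right_inv _
  rw [topIdeal, this]
  exact Ideal.comap_map_of_bijective _ (ΓSpecIso_inv_bijective R)

theorem topIdeal_map {R S : Type u} [CommRing R] [CommRing S] (α : R →+* S)
    (I : (Spec (CommRingCat.of S)).IdealSheafData) :
    topIdeal (I.map (specMap α)) = (topIdeal I).comap α := by
  rw [topIdeal, Scheme.IdealSheafData.ideal_map_of_isAffineHom, topIdeal, Ideal.comap_comap,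
    Ideal.comap_comap]
  congr 1
  exact congrArg CommRingCat.Hom.hom
    (Scheme.ΓSpecIso_inv_naturality (CommRingCat.ofHom α)).symm

/-- Pullback of ideal sheaves and extension of ideals are left adjoint to pushforward and
contraction, which `topIdeal_map` identifies; so they contain one another's test ideals and agree.
-/
theorem topIdeal_comap {R S : Type u} [CommRing R] [CommRing S] (α : R →+* S)
    (I : (Spec (CommRingCat.of R)).IdealSheafData) :
    topIdeal (I.comap (specMap α)) = (topIdeal I).map α := by
  refine eq_of_forall_ge_iff fun a ↦ ?_
  obtain ⟨K, rfl⟩ := exists_topIdeal_eq a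
  rw [topIdeal_le_topIdeal, ← Scheme.IdealSheafData.le_map_iff_comap_le, ← topIdeal_le_topIdeal,
    topIdeal_map, Ideal.map_le_iff_le_comap]

variable {X : Scheme.{u}} (I : X.IdealSheafData)

/-- The ideal of `R` generated by the pullback of an ideal sheaf along `g : Spec R ⟶ X`. -/
noncomputable def idealOn {R : Type u} [CommRing R] (g : Spec (CommRingCat.of R) ⟶ X) : Ideal R :=
  topIdeal (I.comap g)

theorem idealOn_specMap_comp {R S : Type u} [CommRing R] [CommRing S] (α : R →+* S)
    (g : Spec (CommRingCat.of R) ⟶ X) : idealOn I (specMap α ≫ g) = (idealOn I g).map α := by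
  rw [idealOn, Scheme.IdealSheafData.comap_comp, topIdeal_comap, idealOn]

theorem idealOn_comp {Y : Scheme.{u}} {R : Type u} [CommRing R]
    (g : Spec (CommRingCat.of R) ⟶ Y) (b : Y ⟶ X) : idealOn I (g ≫ b) = idealOn (I.comap b) g := by
  rw [idealOn, Scheme.IdealSheafData.comap_comp, idealOn]

theorem mem_nonZeroDivisors_of_bijective {R S : Type*} [CommRing R] [CommRing S] (e : R →+* S)
    (he : Function.Bijective e) {r : R} (hr : r ∈ nonZeroDivisors R) :
    e r ∈ nonZeroDivisors S := by
  have := MulEquivClass.map_nonZeroDivisors (RingEquiv.ofBijective e he)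
  rw [← this]
  exact ⟨r, hr, rfl⟩

theorem isCartier_comap_of_idealOn_eq_span {R : Type u} [CommRing R]
    {g : Spec (CommRingCat.of R) ⟶ X} {r : R} (hr : r ∈ nonZeroDivisors R)
    (h : idealOn I g = Ideal.span {r}) : IsCartier (I.comap g) := by
  refine fun t ↦ ⟨⟨⊤, isAffineOpen_top _⟩, trivial,
    (Scheme.ΓSpecIso (CommRingCat.of R)).inv.hom r,
    mem_nonZeroDivisors_of_bijective _ (ΓSpecIso_inv_bijective R) hr, ?_⟩
  rw [ideal_top_eq, ← idealOn, h, Ideal.map_span, Set.image_singleton]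

theorem idealOn_fromSpec {U : X.Opens} (hU : IsAffineOpen U) :
    idealOn (R := Γ(X, U)) I hU.fromSpec = I.ideal ⟨U, hU⟩ := by
  have hV : hU.fromSpec ''ᵁ ⊤ = U := by
    rw [Scheme.Hom.image_top_eq_opensRange, hU.opensRange_fromSpec]
  rw [idealOn, topIdeal, Scheme.IdealSheafData.ideal_comap_of_isOpenImmersion, Ideal.comap_comap]
  have key : (hU.fromSpec.appIso ⊤).inv.hom.comp
      (Scheme.ΓSpecIso (CommRingCat.of Γ(X, U))).inv.hom =
      (X.presheaf.map (homOfLE hV.le).op).hom := by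
    have e : (⊤ : (Spec Γ(X, U)).Opens) ≤ hU.fromSpec ⁻¹ᵁ U := hU.fromSpec_preimage_self.ge
    have h1 : (Scheme.ΓSpecIso Γ(X, U)).inv = hU.fromSpec.appLE U ⊤ e := by
      rw [Scheme.Hom.appLE, hU.fromSpec_app_self, Category.assoc, ← Functor.map_comp]
      exact ((congrArg _ (CategoryTheory.Functor.map_id _ _)).trans (Category.comp_id _)).symm
    have h2 : (Scheme.ΓSpecIso Γ(X, U)).inv ≫ (hU.fromSpec.appIso ⊤).inv =
        X.presheaf.map (homOfLE hV.le).op := by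
      rw [h1]
      exact hU.fromSpec.appLE_appIso_inv e
    exact congrArg CommRingCat.Hom.hom h2
  rw [key]
  apply le_antisymm
  · intro a ha
    have h3 := I.ideal_le_comap_ideal (U := ⟨U, hU⟩)
      (V := ⟨hU.fromSpec ''ᵁ ⊤, hV.symm ▸ hU⟩) (show U ≤ _ from hV.ge) ha
    have h4 : X.presheaf.map (homOfLE hV.le).op ≫ X.presheaf.map (homOfLE hV.ge).op =
        𝟙 Γ(X, U) := by
      rw [← Functor.map_comp]
      exact CategoryTheory.Functor.map_id _ _
    have h5 : (X.presheaf.map (homOfLE hV.ge).op).hom ((X.presheaf.map (homOfLE hV.le).op).hom a) =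
        a := congrArg (fun e ↦ e.hom a) h4
    exact (congrArg (· ∈ I.ideal ⟨U, hU⟩) h5).mp h3
  · exact I.ideal_le_comap_ideal (V := ⟨U, hU⟩)
      (U := ⟨hU.fromSpec ''ᵁ ⊤, hV.symm ▸ hU⟩) (show _ ≤ U from hV.le)

/-- Locally on the source, a morphism along which an ideal sheaf pulls back to an effective
Cartier divisor is given by a ring homomorphism along which the ideal becomes principal. -/
theorem exists_idealOn_eq_span_of_isCartier {Y : Scheme.{u}} {b : Y ⟶ X}
    (hb : IsCartier (I.comap b)) {A : Type u} [CommRing A] (φ : Spec (CommRingCat.of A) ⟶ X)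
    [IsOpenImmersion φ] (y : Y) (hy : b y ∈ Set.range φ) :
    ∃ (S : Type u) (_ : CommRing S) (n : Spec (CommRingCat.of S) ⟶ Y) (_ : IsOpenImmersion n)
      (ρ : A →+* S), y ∈ Set.range n ∧ n ≫ b = specMap ρ ≫ φ ∧
      ∃ s ∈ nonZeroDivisors S, (idealOn I φ).map ρ = Ideal.span {s} := by
  obtain ⟨⟨U, hU⟩, hyU, s, hs, hIs⟩ := hb y
  -- Shrinking to a basic open that maps into the chart keeps the local generator a nonzerodivisor,
  -- since localization preserves nonzerodivisors.
  obtain ⟨c, hc, hyc⟩ := hU.exists_basicOpen_le (V := b ⁻¹ᵁ φ.opensRange) ⟨y, hy⟩ hyU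
  have hD := hU.basicOpen c
  have hrange : Set.range (hD.fromSpec ≫ b) ⊆ Set.range φ := by
    rintro _ ⟨z, rfl⟩
    rw [Scheme.Hom.comp_apply]
    refine hc ?_
    have : hD.fromSpec z ∈ Set.range hD.fromSpec := ⟨z, rfl⟩
    rwa [hD.range_fromSpec] at this
  let l := IsOpenImmersion.lift φ (hD.fromSpec ≫ b) hrange
  have hl : l ≫ φ = hD.fromSpec ≫ b := IsOpenImmersion.lift_fac _ _ _
  have hρ : specMap (S := Γ(Y, Y.basicOpen c)) (R := A) (Spec.preimage l).hom = l :=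
    Spec.map_preimage l
  refine ⟨Γ(Y, Y.basicOpen c), inferInstance, hD.fromSpec, inferInstance,
    (Spec.preimage l).hom, ?_, ?_, (Y.presheaf.map (homOfLE (Y.basicOpen_le c)).op).hom s, ?_, ?_⟩
  · rw [hD.range_fromSpec]
    exact hyc
  · rw [hρ, hl]
  · have := hU.isLocalization_basicOpen c
    exact IsLocalization.map_nonZeroDivisors_le (Submonoid.powers c) _ ⟨s, hs, rfl⟩
  · rw [← idealOn_specMap_comp, hρ, hl]
    refine (idealOn_comp I (R := Γ(Y, Y.basicOpen c)) hD.fromSpec b).trans ?_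
    rw [idealOn_fromSpec]
    have h1 := (I.comap b).map_ideal (U := ⟨Y.basicOpen c, hD⟩) (V := ⟨U, hU⟩)
      (show Y.basicOpen c ≤ U from Y.basicOpen_le c)
    rw [← h1, hIs, Ideal.map_span, Set.image_singleton]
    rfl

/-- The kernel of a closed immersion on stalks is generated by its ideal on an affine open. -/
theorem ker_stalkMap_eq {Z : Scheme.{u}} (i : Z ⟶ X) [IsClosedImmersion i] {U : X.Opens}
    (hU : IsAffineOpen U) (z : Z) (hz : i z ∈ U) :
    RingHom.ker (i.stalkMap z).hom =
      (i.ker.ideal ⟨U, hU⟩).map (X.presheaf.germ U (i z) hz).hom := by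
  apply le_antisymm
  · intro a ha
    obtain ⟨V, hzV, s, rfl⟩ := X.presheaf.exists_germ_eq a
    rw [RingHom.mem_ker] at ha
    have h1 : i.stalkMap z (X.presheaf.germ V (i z) hzV s) =
        Z.presheaf.germ (i ⁻¹ᵁ V) z hzV (i.app V s) := Scheme.Hom.germ_stalkMap_apply _ _ _ _ _
    have h2 : Z.presheaf.germ (i ⁻¹ᵁ V) z hzV (i.app V s) =
        Z.presheaf.germ (i ⁻¹ᵁ V) z hzV 0 := by
      rw [← h1, map_zero]
      exact ha
    -- A germ killed on Z vanishes on a neighbourhood of z in Z. As i is an embedding, this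
    -- neighbourhood contains the preimage of a basic open of U, so the restricted section lies in
    -- the ideal there.
    obtain ⟨T, hzT, j₁, j₂, h3⟩ := Z.presheaf.germ_eq z hzV hzV _ _ h2
    obtain ⟨T', hT', hTT'⟩ := i.isEmbedding.isInducing.isOpen_iff.mp T.2
    have hzT' : i z ∈ T' := by
      have : z ∈ i ⁻¹' T' := hTT' ▸ hzT
      exact this
    obtain ⟨c, hc, hzc⟩ := hU.exists_basicOpen_le (V := V ⊓ ⟨T', hT'⟩) ⟨i z, hzV, hzT'⟩ hz
    have hcV : X.basicOpen c ≤ V := hc.trans inf_le_left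
    have hcT : i ⁻¹ᵁ X.basicOpen c ≤ T := by
      intro w hw
      have : w ∈ i ⁻¹' T' := (hc hw).2
      rw [hTT'] at this
      exact this
    let t := X.presheaf.map (homOfLE hcV).op s
    have ht : t ∈ i.ker.ideal ⟨X.basicOpen c, hU.basicOpen c⟩ := by
      rw [Scheme.Hom.ker_apply, RingHom.mem_ker]
      have h4 : i.app (X.basicOpen c) t =
          Z.presheaf.map (homOfLE (i.preimage_mono hcV)).op (i.app V s) :=
        congrArg (fun e ↦ e.hom s) (i.naturality (homOfLE hcV).op)
      have h5 : Z.presheaf.map (homOfLE (i.preimage_mono hcV)).op (i.app V s) =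
          Z.presheaf.map (homOfLE hcT).op (Z.presheaf.map j₁.op (i.app V s)) :=
        congrArg (fun e ↦ e.hom (i.app V s)) (Z.presheaf.map_comp j₁.op (homOfLE hcT).op)
      have h6 := h4.trans h5
      rw [h3] at h6
      simpa using h6
    rw [← i.ker.map_ideal (U := ⟨X.basicOpen c, hU.basicOpen c⟩) (V := ⟨U, hU⟩)
      (show X.basicOpen c ≤ U from X.basicOpen_le c)] at ht
    have h7 := Ideal.mem_map_of_mem (X.presheaf.germ (X.basicOpen c) (i z) hzc).hom ht
    rw [Ideal.map_map, ← CommRingCat.hom_comp] at h7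
    have e7 : X.presheaf.map (homOfLE (X.basicOpen_le c)).op ≫
        X.presheaf.germ (X.basicOpen c) (i z) hzc = X.presheaf.germ U (i z) hz :=
      X.presheaf.germ_res _ _ _
    replace h7 := (congrArg (fun e : Γ(X, U) ⟶ X.presheaf.stalk (i z) ↦
      (i.ker.ideal ⟨U, hU⟩).map e.hom) e7).le h7
    have h8 : X.presheaf.germ (X.basicOpen c) (i z) hzc t = X.presheaf.germ V (i z) hzV s :=
      X.presheaf.germ_res_apply _ _ _ _
    rw [← h8]
    exact h7
  · rw [Ideal.map_le_iff_le_comap]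
    intro s hs
    have h1 := i.ideal_ker_le ⟨U, hU⟩ hs
    rw [RingHom.mem_ker] at h1
    rw [Ideal.mem_comap, RingHom.mem_ker]
    refine (Scheme.Hom.germ_stalkMap_apply i U z hz s).trans ?_
    exact (congrArg _ h1).trans (map_zero _)

end IdealOn


/-! ### Monomial charts of a model -/

section Chart

variable {O : Type u} [CommRing O] [IsDomain O] [IsDiscreteValuationRing O]
variable {X : Scheme.{u}}

/-- An affine open chart of `X` on which the divisor of `ϖ` is given by a monomial in a strict
system of functions. -/
structure SNCChart (f : X ⟶ Spec (CommRingCat.of O)) (ϖ : O) where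
  /-- the coordinate ring -/
  A : Type u
  [commRing : CommRing A]
  /-- the structure homomorphism -/
  α : O →+* A
  /-- the inclusion -/
  φ : Spec (CommRingCat.of A) ⟶ X
  [isOpenImmersion : IsOpenImmersion φ]
  φ_comp : φ ≫ f = specMap α
  /-- the number of coordinates -/
  n : ℕ
  /-- the coordinates -/
  x : Fin n → A
  strict : IsStrictSystem x
  /-- the coordinates that divide `ϖ` -/
  V : Finset (Fin n)
  /-- the exponents -/
  a : Fin n → ℕ
  one_le : ∀ v ∈ V, 1 ≤ a v
  span_eq : Ideal.span {α ϖ} = Ideal.span {∏ v ∈ V, x v ^ a v}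

attribute [instance] SNCChart.commRing SNCChart.isOpenImmersion

variable {f : X ⟶ Spec (CommRingCat.of O)}

theorem mem_range_specialFiberIncl {p : X} :
    p ∈ Set.range (specialFiberIncl f) ↔ f p = IsLocalRing.closedPoint O := by
  have h1 : Set.range (specialFiberIncl f) =
      f ⁻¹' Set.range (Spec.map (CommRingCat.ofHom (IsLocalRing.residue O))) :=
    Scheme.Pullback.range_fst _ _
  rw [h1, Set.mem_preimage]
  have : Set.range (Spec.map (CommRingCat.ofHom (IsLocalRing.residue O))) =
      {IsLocalRing.closedPoint O} := by
    refine (range_comap_of_surjective _ _ (IsLocalRing.residue_surjective)).trans ?_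
    rw [IsLocalRing.ker_residue]
    ext q
    simp only [PrimeSpectrum.mem_zeroLocus, SetLike.coe_subset_coe]
    refine ⟨fun h ↦ PrimeSpectrum.ext ?_, fun h ↦ h ▸ le_rfl⟩
    exact ((IsLocalRing.maximalIdeal.isMaximal O).eq_of_le q.2.ne_top h).symm
  rw [this]
  exact Iff.rfl

theorem specMap_eq_closedPoint_iff {ϖ : O} (hϖ : Ideal.span {ϖ} = IsLocalRing.maximalIdeal O)
    {A : Type u} [CommRing A] (α : O →+* A) (q : Spec (CommRingCat.of A)) :
    specMap α q = IsLocalRing.closedPoint O ↔ α ϖ ∈ pt q := by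
  rw [← mem_specMap]
  constructor
  · intro h
    rw [h]
    change ϖ ∈ IsLocalRing.maximalIdeal O
    rw [← hϖ]
    exact Ideal.mem_span_singleton_self ϖ
  · intro h
    refine pt_injective ?_
    have h1 : IsLocalRing.maximalIdeal O ≤ pt (specMap α q) := by
      rwa [← hϖ, Ideal.span_singleton_le_iff_mem]
    exact ((IsLocalRing.maximalIdeal.isMaximal O).eq_of_le
      (Ideal.IsPrime.ne_top (I := pt (specMap α q)) inferInstance) h1).symm

/-- The structure homomorphism of the coordinate ring of an affine open. -/
noncomputable def sectionsHom (f : X ⟶ Spec (CommRingCat.of O)) (U : X.Opens) : O →+* Γ(X, U) :=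
  ((Scheme.ΓSpecIso (CommRingCat.of O)).inv ≫ f.appLE ⊤ U le_top).hom

theorem specMap_sectionsHom {U : X.Opens} (hU : IsAffineOpen U) :
    hU.fromSpec ≫ f = specMap (S := Γ(X, U)) (sectionsHom f U) := by
  have h1 := (isAffineOpen_top (Spec (CommRingCat.of O))).SpecMap_appLE_fromSpec f hU
    (show U ≤ f ⁻¹ᵁ ⊤ from le_top)
  rw [← h1, IsAffineOpen.fromSpec_top, Scheme.isoSpec_Spec_inv, ← Spec.map_comp]
  rfl

theorem germ_comp_sectionsHom {U : X.Opens} (p : X) (hp : p ∈ U) :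
    (X.presheaf.germ U p hp).hom.comp (sectionsHom f U) = toStalk f p := by
  have : f.appLE ⊤ U le_top ≫ X.presheaf.germ U p hp = f.appTop ≫ X.presheaf.germ ⊤ p trivial := by
    exact (Category.assoc _ _ _).trans (congrArg _ (X.presheaf.germ_res _ _ _))
  rw [toStalk, sectionsHom, ← CommRingCat.hom_comp, Category.assoc, this]

theorem fiberIdeal_eq {ϖ : O} (hϖ : Ideal.span {ϖ} = IsLocalRing.maximalIdeal O) (p : X) :
    fiberIdeal f p = Ideal.span {toStalk f p ϖ} := by
  rw [fiberIdeal, ← hϖ, Ideal.map_span, Set.image_singleton]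

/-- Charts around a point with an adapted regular system of parameters. -/
theorem exists_chart_of_isStrictSystem {ϖ : O}
    (hϖ : Ideal.span {ϖ} = IsLocalRing.maximalIdeal O)
    (p : X) {U : X.Opens} (hU : IsAffineOpen U) (hp : p ∈ U) [IsNoetherianRing Γ(X, U)]
    [IsNoetherianRing (X.presheaf.stalk p)]
    {d : ℕ} {x : Fin d → X.presheaf.stalk p} (hx : IsStrictSystem x) {V : Finset (Fin d)}
    (hV : (fiberIdeal f p).radical = Ideal.span {∏ v ∈ V, x v}) {J : Ideal Γ(X, U)}
    {W : Finset (Fin d)} (hW : J.map (X.presheaf.germ U p hp).hom = Ideal.span (x '' W)) :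
    ∃ (c : SNCChart f ϖ) (W : Finset (Fin c.n)) (ρ : Γ(X, U) →+* c.A), p ∈ Set.range c.φ ∧
      c.φ = specMap (R := Γ(X, U)) ρ ≫ hU.fromSpec ∧ J.map ρ = Ideal.span (c.x '' W) := by
  have := hx.isDomain
  rw [fiberIdeal_eq hϖ] at hV
  obtain ⟨a, ha, hspan⟩ := hx.exists_span_eq_of_radical_eq V hV
  let : Algebra Γ(X, U) (X.presheaf.stalk p) := X.presheaf.algebra_section_stalk ⟨p, hp⟩
  have hloc : IsLocalization.AtPrime (X.presheaf.stalk p) (hU.primeIdealOf ⟨p, hp⟩).asIdeal :=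
    hU.isLocalization_stalk ⟨p, hp⟩
  have halg : algebraMap Γ(X, U) (X.presheaf.stalk p) = (X.presheaf.germ U p hp).hom := rfl
  obtain ⟨g, r, hg, H⟩ := hx.spreadOut (A := Γ(X, U)) (hU.primeIdealOf ⟨p, hp⟩).asIdeal V a W
    (c := sectionsHom f U ϖ) (J := J) (by
      rw [← hspan, halg, ← germ_comp_sectionsHom p hp]
      rfl) hW
  obtain ⟨h1, h2, h3⟩ := H (B := Localization.Away g)
  let c : SNCChart f ϖ :=
    { A := Localization.Away g
      α := (algebraMap Γ(X, U) (Localization.Away g)).comp (sectionsHom f U)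
      φ := specMap (R := Γ(X, U)) (algebraMap Γ(X, U) (Localization.Away g)) ≫ hU.fromSpec
      isOpenImmersion := inferInstance
      φ_comp := by
        rw [Category.assoc, specMap_sectionsHom]
        exact specMap_comp _ _
      n := d
      x := _
      strict := h1
      V := V
      a := a
      one_le := ha
      span_eq := h2 }
  refine ⟨c, W, algebraMap Γ(X, U) (Localization.Away g), ?_, rfl, h3⟩
  have h4 : hU.primeIdealOf ⟨p, hp⟩ ∈ Set.range (PrimeSpectrum.comap
      (algebraMap Γ(X, U) (Localization.Away g))) := by
    rw [PrimeSpectrum.localization_away_comap_range (Localization.Away g) g]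
    exact hg
  obtain ⟨s, hs⟩ := h4
  refine ⟨s, ?_⟩
  refine (Scheme.Hom.comp_apply (specMap (R := Γ(X, U))
    (algebraMap Γ(X, U) (Localization.Away g))) hU.fromSpec s).trans ?_
  exact (congrArg hU.fromSpec hs).trans (hU.fromSpec_primeIdealOf ⟨p, hp⟩)

theorem IsSNCModel.isLocallyNoetherian (hf : IsSNCModel f) : IsLocallyNoetherian X := by
  have := hf.locallyOfFiniteType
  exact LocallyOfFiniteType.isLocallyNoetherian f

/-- Charts around the points of the special fibre outside the center. -/
theorem exists_chart_of_notMem {ϖ : O} (hϖ : Ideal.span {ϖ} = IsLocalRing.maximalIdeal O)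
    (hf : IsSNCModel f) {Z : Scheme.{u}} (i : Z ⟶ X) [IsClosedImmersion i]
    (p : specialFiber f) (hp : specialFiberIncl f p ∉ Set.range i) :
    ∃ c : SNCChart f ϖ, specialFiberIncl f p ∈ Set.range c.φ ∧ idealOn i.ker c.φ = ⊤ := by
  have := hf.isLocallyNoetherian
  have hreg := hf.regular (specialFiberIncl f p)
  obtain ⟨d, x, V, hx, hV⟩ := hf.snc p
  obtain ⟨U, hU, hpU, hUZ⟩ := exists_isAffineOpen_mem_and_subset
    (U := ⟨(Set.range i)ᶜ, i.isClosedEmbedding.isClosed_range.isOpen_compl⟩) hp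
  have : IsNoetherianRing Γ(X, U) := IsLocallyNoetherian.component_noetherian ⟨U, hU⟩
  -- U already avoids the center, so no ideal has to be carried along: J = ⊥ and W = ∅ are
  -- placeholders.
  obtain ⟨c, W, ρ, h1, h2, -⟩ := exists_chart_of_isStrictSystem hϖ _ hU hpU hx.isStrictSystem hV
    (J := ⊥) (W := ∅) (by simp [Ideal.map_bot])
  refine ⟨c, h1, ?_⟩
  have hker : i.ker.ideal ⟨U, hU⟩ = ⊤ := by
    have h3 : i ⁻¹ᵁ U = ⊥ := by
      ext z
      exact ⟨fun hz ↦ hUZ hz ⟨z, rfl⟩, fun hz ↦ hz.elim⟩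
    have : Subsingleton Γ(Z, i ⁻¹ᵁ U) := by
      rw [h3]
      infer_instance
    rw [Scheme.Hom.ker_apply, Ideal.eq_top_iff_one, RingHom.mem_ker]
    exact Subsingleton.elim (α := Γ(Z, i ⁻¹ᵁ U)) _ _
  rw [h2, idealOn_specMap_comp, idealOn_fromSpec, hker, Ideal.map_top]

/-- Charts around the points of the center. -/
theorem exists_chart_of_mem {ϖ : O} (hϖ : Ideal.span {ϖ} = IsLocalRing.maximalIdeal O)
    (hf : IsSNCModel f) {Z : Scheme.{u}} (i : Z ⟶ X) [IsClosedImmersion i]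
    (hnc : HasNormalCrossings f i) (z : Z) :
    ∃ (c : SNCChart f ϖ) (W : Finset (Fin c.n)), i z ∈ Set.range c.φ ∧
      idealOn i.ker c.φ = Ideal.span (c.x '' W) := by
  have := hf.isLocallyNoetherian
  have := hf.locallyOfFiniteType
  have := hf.quasiCompact
  -- Normal crossings are given at closed points only. A chart around a closed specialization z' of
  -- z is open, hence contains z as well.
  obtain ⟨z', hz', hzz'⟩ : ∃ z' : Z, IsClosed {i z'} ∧ z ⤳ z' := by
    have : CompactSpace X := QuasiCompact.compactSpace_of_compactSpace f
    have : CompactSpace Z := i.isClosedEmbedding.compactSpace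
    obtain ⟨z', h2, h3⟩ := IsClosed.exists_closed_singleton (S := closure {z}) isClosed_closure
      ⟨z, subset_closure rfl⟩
    refine ⟨z', ?_, specializes_iff_mem_closure.mpr h2⟩
    rw [← Set.image_singleton]
    exact i.isClosedEmbedding.isClosedMap _ h3
  have hreg := hf.regular (i z')
  obtain ⟨d, x, V, W, hx, hV, hW⟩ := hnc z' hz'
  obtain ⟨U, hU, hpU, -⟩ := exists_isAffineOpen_mem_and_subset (TopologicalSpace.Opens.mem_top (i z'))
  have : IsNoetherianRing Γ(X, U) := IsLocallyNoetherian.component_noetherian ⟨U, hU⟩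
  obtain ⟨c, W, ρ, h1, h2, h3⟩ := exists_chart_of_isStrictSystem hϖ _ hU hpU hx.isStrictSystem hV
    (J := i.ker.ideal ⟨U, hU⟩) (W := W) (by rw [← ker_stalkMap_eq, hW])
  refine ⟨c, W, ?_, ?_⟩
  · exact (hzz'.map i.continuous).mem_open c.φ.isOpenEmbedding.isOpen_range h1
  · rw [h2, idealOn_specMap_comp, idealOn_fromSpec, h3]

end Chart


/-! ### Stalks, lengths and components in a chart -/

section Stalk

/-- The canonical homomorphism from a ring to the stalks of its spectrum. -/
noncomputable def topStalk {A : Type u} [CommRing A] (q : Spec (CommRingCat.of A)) :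
    A →+* (Spec (CommRingCat.of A)).presheaf.stalk q :=
  ((Scheme.ΓSpecIso (CommRingCat.of A)).inv ≫
    (Spec (CommRingCat.of A)).presheaf.germ ⊤ q trivial).hom

theorem isLocalization_topStalk {A : Type u} [CommRing A] (q : Spec (CommRingCat.of A)) :
    letI := (topStalk q).toAlgebra
    IsLocalization.AtPrime ((Spec (CommRingCat.of A)).presheaf.stalk q) (pt q) := by
  have := StructureSheaf.IsLocalization.to_stalk A q
  exact this

variable {X : Scheme.{u}} {A : Type u} [CommRing A] (φ : Spec (CommRingCat.of A) ⟶ X)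
  [IsOpenImmersion φ]

/-- The canonical homomorphism from the coordinate ring of an open affine to a stalk. -/
noncomputable def chartStalk (q : Spec (CommRingCat.of A)) : A →+* X.presheaf.stalk (φ q) :=
  ((asIso (φ.stalkMap q)).commRingCatIsoToRingEquiv.symm :
    (Spec (CommRingCat.of A)).presheaf.stalk q →+* X.presheaf.stalk (φ q)).comp (topStalk q)

theorem isLocalization_chartStalk (q : Spec (CommRingCat.of A)) :
    letI := (chartStalk φ q).toAlgebra
    IsLocalization.AtPrime (X.presheaf.stalk (φ q)) (pt q) := by
  let := (chartStalk φ q).toAlgebra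
  let := (topStalk q).toAlgebra
  have h1 := isLocalization_topStalk q
  let e : (Spec (CommRingCat.of A)).presheaf.stalk q ≃ₐ[A] X.presheaf.stalk (φ q) :=
    AlgEquiv.ofRingEquiv (f := (asIso (φ.stalkMap q)).commRingCatIsoToRingEquiv.symm)
      fun a ↦ rfl
  exact IsLocalization.isLocalization_of_algEquiv (pt q).primeCompl e

theorem toStalk_eq_chartStalk_comp {O : Type u} [CommRing O] {f : X ⟶ Spec (CommRingCat.of O)}
    {α : O →+* A} (hα : φ ≫ f = specMap α) (q : Spec (CommRingCat.of A)) :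
    toStalk f (φ q) = (chartStalk φ q).comp α := by
  have h1 : (Scheme.ΓSpecIso (CommRingCat.of O)).inv ≫ f.appTop ≫
      X.presheaf.germ ⊤ (φ q) trivial ≫ φ.stalkMap q =
      CommRingCat.ofHom α ≫ (Scheme.ΓSpecIso (CommRingCat.of A)).inv ≫
        (Spec (CommRingCat.of A)).presheaf.germ ⊤ q trivial := by
    have h2 : X.presheaf.germ ⊤ (φ q) trivial ≫ φ.stalkMap q =
        φ.appTop ≫ (Spec (CommRingCat.of A)).presheaf.germ ⊤ q trivial :=
      Scheme.Hom.germ_stalkMap _ _ _ _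
    rw [h2, ← Scheme.Hom.comp_appTop_assoc, hα, ← Scheme.ΓSpecIso_inv_naturality_assoc]
  ext o
  have h2 := congrArg (fun e ↦ e.hom o) h1
  rw [RingHom.comp_apply, chartStalk, RingHom.comp_apply]
  exact ((RingEquiv.symm_apply_eq _).mpr h2.symm).symm

end Stalk

section Length

theorem length_quotient_span_pow {R : Type u} [CommRing R] [IsDomain R] [IsLocalRing R] {y : R}
    (hy : y ≠ 0) (hm : Ideal.span {y} = IsLocalRing.maximalIdeal R) (a : ℕ) :
    Module.length R (R ⧸ Ideal.span {y ^ a}) = a := by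
  have h1 : Ring.ord R y = 1 := by
    rw [Ring.ord, Module.length_eq_one_iff]
    have : (Ideal.span {y}).IsMaximal := hm ▸ IsLocalRing.maximalIdeal.isMaximal R
    rw [isSimpleModule_iff_isSimpleModule_of_algebraMap_surjective (S := R ⧸ Ideal.span {y})
      Ideal.Quotient.mk_surjective]
    let := Ideal.Quotient.field (Ideal.span {y})
    exact instIsSimpleModule _
  have h2 := Ring.ord_pow (mem_nonZeroDivisors_of_ne_zero hy) a
  rw [h1, nsmul_one] at h2
  exact h2

end Length

section Components

variable {O : Type u} [CommRing O] [IsDomain O] [IsDiscreteValuationRing O]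
variable {X : Scheme.{u}} {f : X ⟶ Spec (CommRingCat.of O)} {ϖ : O}

instance (f : X ⟶ Spec (CommRingCat.of O)) : IsClosedImmersion (specialFiberIncl f) := by
  have : IsClosedImmersion (Spec.map (CommRingCat.ofHom (IsLocalRing.residue O))) :=
    IsClosedImmersion.spec_of_surjective _ IsLocalRing.residue_surjective
  exact inferInstanceAs (IsClosedImmersion (pullback.fst f _))

theorem eq_of_specialFiberIncl_eq {p q : specialFiber f}
    (h : specialFiberIncl f p = specialFiberIncl f q) : p = q :=
  (specialFiberIncl f).isEmbedding.injective h

theorem specializes_of_pt_le {A : Type u} [CommRing A] {q q' : Spec (CommRingCat.of A)}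
    (h : pt q ≤ pt q') : q ⤳ q' :=
  (PrimeSpectrum.le_iff_specializes (R := A) q q').mp h

theorem pt_le_of_specializes {A : Type u} [CommRing A] {q q' : Spec (CommRingCat.of A)}
    (h : q ⤳ q') : pt q ≤ pt q' :=
  (PrimeSpectrum.le_iff_specializes (R := A) q q').mpr h

namespace SNCChart

variable (c : SNCChart f ϖ)

theorem exists_specialFiber (hϖ : Ideal.span {ϖ} = IsLocalRing.maximalIdeal O)
    {q : Spec (CommRingCat.of c.A)} (hq : c.α ϖ ∈ pt q) :
    ∃ p : specialFiber f, specialFiberIncl f p = c.φ q := by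
  refine mem_range_specialFiberIncl.mpr ?_
  rw [← Scheme.Hom.comp_apply, c.φ_comp, specMap_eq_closedPoint_iff hϖ]
  exact hq

theorem mem_of_specialFiber (hϖ : Ideal.span {ϖ} = IsLocalRing.maximalIdeal O)
    {q : Spec (CommRingCat.of c.A)} {p : specialFiber f} (h : specialFiberIncl f p = c.φ q) :
    c.α ϖ ∈ pt q := by
  have := mem_range_specialFiberIncl.mp ⟨p, h⟩
  rwa [← Scheme.Hom.comp_apply, c.φ_comp, specMap_eq_closedPoint_iff hϖ] at this

theorem exists_mem_of_mem {P : Ideal c.A} [P.IsPrime] (h : c.α ϖ ∈ P) : ∃ v ∈ c.V, c.x v ∈ P := by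
  have h1 : ∏ v ∈ c.V, c.x v ^ c.a v ∈ P := by
    have := (Ideal.span_singleton_le_iff_mem _).mpr h
    rw [c.span_eq] at this
    exact (Ideal.span_singleton_le_iff_mem _).mp this
  obtain ⟨v, hv, h2⟩ := (Ideal.IsPrime.prod_mem_iff (p := P)).mp h1
  exact ⟨v, hv, Ideal.IsPrime.mem_of_pow_mem inferInstance _ h2⟩

theorem mem_of_dvd {v : Fin c.n} (hv : v ∈ c.V) : c.α ϖ ∈ Ideal.span {c.x v} := by
  have h1 : c.α ϖ ∈ Ideal.span {c.α ϖ} := Ideal.mem_span_singleton_self _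
  rw [c.span_eq] at h1
  refine (Ideal.span_singleton_le_span_singleton.mpr ?_) h1
  exact (dvd_pow_self _ (by have := c.one_le v hv; omega)).trans (Finset.dvd_prod_of_mem _ hv)

theorem exists_eq_of_specializes {p : specialFiber f} {w : specialFiber f}
    {q : Spec (CommRingCat.of c.A)} (h : specialFiberIncl f p = c.φ q) (hw : w ⤳ p) :
    ∃ q', specialFiberIncl f w = c.φ q' ∧ pt q' ≤ pt q := by
  have h1 : specialFiberIncl f w ⤳ c.φ q := h ▸ hw.map (specialFiberIncl f).continuous
  obtain ⟨q', hq'⟩ := h1.mem_open c.φ.isOpenEmbedding.isOpen_range ⟨q, rfl⟩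
  rw [← hq'] at h1
  exact ⟨q', hq'.symm, pt_le_of_specializes
    (c.φ.isOpenEmbedding.isInducing.specializes_iff.mp h1)⟩

/-- The generic point of a coordinate hyperplane. -/
noncomputable def hyperplane (v : Fin c.n) : Spec (CommRingCat.of c.A) :=
  (⟨Ideal.span {c.x v}, c.strict.isPrime_span_singleton v⟩ : PrimeSpectrum c.A)

theorem pt_hyperplane (v : Fin c.n) : pt (c.hyperplane v) = Ideal.span {c.x v} := rfl

/-- In the local ring at the generic point of x_v = 0, the element x_v generates the maximal ideal
and the other factors of the monomial are units, so the fibre ideal is generated by x_v^{a_v}. -/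
theorem multiplicity_eq (hϖ : Ideal.span {ϖ} = IsLocalRing.maximalIdeal O) {η : specialFiber f}
    {v : Fin c.n} (hv : v ∈ c.V) (hη : specialFiberIncl f η = c.φ (c.hyperplane v)) :
    multiplicity f η = c.a v := by
  have h1 : multiplicity f η = (Module.length (X.presheaf.stalk (c.φ (c.hyperplane v)))
      (X.presheaf.stalk (c.φ (c.hyperplane v)) ⧸ fiberIdeal f (c.φ (c.hyperplane v)))).toNat := by
    rw [← hη]
    rfl
  let := (chartStalk c.φ (c.hyperplane v)).toAlgebra
  have hloc := isLocalization_chartStalk c.φ (c.hyperplane v)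
  have hdom := c.strict.isDomain
  have hdom' : IsDomain (X.presheaf.stalk (c.φ (c.hyperplane v))) :=
    IsLocalization.isDomain_of_atPrime _ (pt (c.hyperplane v))
  set θ := chartStalk c.φ (c.hyperplane v) with hθ
  have hmax : Ideal.span {θ (c.x v)} = IsLocalRing.maximalIdeal _ := by
    have := IsLocalization.AtPrime.map_eq_maximalIdeal (pt (c.hyperplane v))
      (X.presheaf.stalk (c.φ (c.hyperplane v)))
    rw [← this, pt_hyperplane, Ideal.map_span, Set.image_singleton]
    rfl
  have hne : θ (c.x v) ≠ 0 := by
    have hinj : Function.Injective (algebraMap c.A (X.presheaf.stalk (c.φ (c.hyperplane v)))) :=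
      IsLocalization.injective _ (Ideal.primeCompl_le_nonZeroDivisors (pt (c.hyperplane v)))
    intro h0
    exact c.strict.ne_zero v (hinj (h0.trans (map_zero _).symm))
  have hfib : fiberIdeal f (c.φ (c.hyperplane v)) = Ideal.span {θ (c.x v) ^ c.a v} := by
    rw [fiberIdeal_eq hϖ, toStalk_eq_chartStalk_comp c.φ c.φ_comp, RingHom.comp_apply,
      ← Set.image_singleton (f := chartStalk c.φ (c.hyperplane v)), ← Ideal.map_span, c.span_eq,
      Ideal.map_span, Set.image_singleton, map_prod, ← Finset.mul_prod_erase _ _ hv, map_pow]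
    refine Ideal.span_singleton_mul_right_unit ?_ _
    refine (IsUnit.prod_iff).mpr fun w hw ↦ ?_
    rw [map_pow]
    refine IsUnit.pow _ ?_
    refine IsLocalization.map_units (M := (pt (c.hyperplane v)).primeCompl) _
      ⟨c.x w, fun hmem ↦ ?_⟩
    exact c.strict.not_dvd (Finset.ne_of_mem_erase hw).symm (Ideal.mem_span_singleton.mp hmem)
  rw [h1, hfib, length_quotient_span_pow hne hmax]
  rfl

/-- A generization within the special fibre stays in the chart. Its prime contains some x_{v'} with
v' ∈ V and is contained in (x_v), so v' = v by strictness and the two points coincide. -/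
theorem mem_genericPoints_of_eq_hyperplane (hϖ : Ideal.span {ϖ} = IsLocalRing.maximalIdeal O)
    {η : specialFiber f} {v : Fin c.n} (hv : v ∈ c.V)
    (hη : specialFiberIncl f η = c.φ (c.hyperplane v)) : η ∈ genericPoints (specialFiber f) := by
  have key : ∀ w : specialFiber f, w ⤳ η → w = η := by
    intro w hw
    obtain ⟨q', hq', hle⟩ := c.exists_eq_of_specializes hη hw
    obtain ⟨v', hv', hmem⟩ := c.exists_mem_of_mem (c.mem_of_specialFiber hϖ hq')
    rw [pt_hyperplane] at hle
    have hvv : v = v' := by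
      by_contra hne
      exact c.strict.not_dvd hne (Ideal.mem_span_singleton.mp (hle hmem))
    subst hvv
    have : pt q' = pt (c.hyperplane v) :=
      le_antisymm hle ((Ideal.span_singleton_le_iff_mem _).mpr hmem)
    refine eq_of_specialFiberIncl_eq ?_
    rw [hq', hη, pt_injective this]
  refine ⟨isIrreducible_singleton.closure, fun T hT hηT ↦ ?_⟩
  have hgen := (hT.isGenericPoint_genericPoint_closure)
  have h1 : hT.genericPoint ⤳ η :=
    hgen.specializes (subset_closure (hηT (subset_closure rfl)))
  have h2 := key _ h1
  have h3 : closure T = closure {η} := by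
    rw [← h2]
    exact hgen.symm
  exact h3 ▸ subset_closure

/-- The components of the special fibre through a point of a chart are the coordinate hyperplanes
through this point. -/
theorem mults_eq [TopologicalSpace.NoetherianSpace (specialFiber f)]
    (hϖ : Ideal.span {ϖ} = IsLocalRing.maximalIdeal O) {p : specialFiber f}
    {q : Spec (CommRingCat.of c.A)} (h : specialFiberIncl f p = c.φ q) (H : Finset (Fin c.n))
    (hH : ∀ v, v ∈ H ↔ v ∈ c.V ∧ c.x v ∈ pt q) :
    mults f p = H.val.map c.a := by
  have hex : ∀ v ∈ H, ∃ η : specialFiber f, specialFiberIncl f η = c.φ (c.hyperplane v) :=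
    fun v hv ↦ c.exists_specialFiber hϖ (c.mem_of_dvd ((hH v).mp hv).1)
  choose η hη using hex
  symm
  refine Multiset.map_eq_map_of_bij_of_nodup _ _ H.nodup (comps f p).nodup
    (fun v hv ↦ ⟨η v hv, c.mem_genericPoints_of_eq_hyperplane hϖ ((hH v).mp hv).1 (hη v hv)⟩)
    ?_ ?_ ?_ ?_
  · intro v hv
    rw [Finset.mem_val, mem_comps]
    refine specializes_iff_mem_closure.mp ?_
    refine (specialFiberIncl f).isEmbedding.isInducing.specializes_iff.mp ?_
    rw [hη v hv, h]
    exact (specializes_of_pt_le ((Ideal.span_singleton_le_iff_mem _).mpr ((hH v).mp hv).2)).map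
      c.φ.continuous
  · intro v hv w hw hvw
    have h1 : η v hv = η w hw := congrArg Subtype.val hvw
    have h2 := c.φ.isOpenEmbedding.injective ((hη v hv).symm.trans (h1 ▸ hη w hw))
    by_contra hne
    refine c.strict.not_dvd hne (Ideal.mem_span_singleton.mp ?_)
    rw [← pt_hyperplane, h2]
    exact Ideal.mem_span_singleton_self _
  · intro i hi
    rw [Finset.mem_val, mem_comps] at hi
    -- The generic point of a component through p lies in the chart and its prime contains some x_v,
    -- v ∈ V. It is thus a specialization of the generic point of that hyperplane, and equal to it
    -- by maximality of components.
    have hip : i.1 ⤳ p := specializes_iff_mem_closure.mpr hi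
    obtain ⟨q', hq', hle⟩ := c.exists_eq_of_specializes h hip
    obtain ⟨v, hv, hmem⟩ := c.exists_mem_of_mem (c.mem_of_specialFiber hϖ hq')
    have hvH : v ∈ H := (hH v).mpr ⟨hv, hle hmem⟩
    refine ⟨v, hvH, Subtype.ext ?_⟩
    have h1 : η v hvH ⤳ i.1 := by
      refine (specialFiberIncl f).isEmbedding.isInducing.specializes_iff.mp ?_
      rw [hη v hvH, hq']
      exact (specializes_of_pt_le ((Ideal.span_singleton_le_iff_mem _).mpr hmem)).map
        c.φ.continuous
    refine h1.antisymm ?_ |>.eq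
    rw [specializes_iff_closure_subset]
    exact i.2.2 isIrreducible_singleton.closure (specializes_iff_closure_subset.mp h1)
  · intro v hv
    exact (c.multiplicity_eq hϖ ((hH v).mp hv).1 (hη v hv)).symm

end SNCChart

end Components


/-! ### Charts of the blowup: algebra -/

section BlowupRing

variable {A : Type u} [CommRing A] {ι : Type} (x : ι → A) (W : Finset ι) (s : ι)

/-- The coordinate ring of the chart of the blowup of the ideal generated by the `x w`, `w ∈ W`,
in which `x s` generates the exceptional divisor. -/
abbrev blowupRing : Type u :=
  chartRing (x s) fun w : {w // w ∈ W ∧ w ≠ s} ↦ x w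

open Classical in
/-- The quotient `x w / x s`. -/
noncomputable def blowupCoord (w : ι) : blowupRing x W s :=
  if h : w ∈ W ∧ w ≠ s then chartRing.t (x s) (fun w : {w // w ∈ W ∧ w ≠ s} ↦ x w) ⟨w, h⟩ else 1

open Classical in
/-- The strict system on a chart of the blowup. -/
noncomputable def blowupSystem (i : ι) : blowupRing x W s :=
  if h : i ∈ W ∧ i ≠ s then chartRing.t (x s) (fun w : {w // w ∈ W ∧ w ≠ s} ↦ x w) ⟨i, h⟩
  else algebraMap A _ (x i)

variable {x W s}

theorem blowupCoord_of_mem {w : ι} (h : w ∈ W ∧ w ≠ s) : blowupCoord x W s w =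
    chartRing.t (x s) (fun w : {w // w ∈ W ∧ w ≠ s} ↦ x w) ⟨w, h⟩ := dif_pos h

theorem blowupCoord_self : blowupCoord x W s s = 1 := dif_neg (by simp)

theorem blowupSystem_of_mem {w : ι} (h : w ∈ W ∧ w ≠ s) :
    blowupSystem x W s w = blowupCoord x W s w := by
  rw [blowupSystem, dif_pos h, blowupCoord_of_mem h]

theorem blowupSystem_of_notMem {w : ι} (h : ¬ (w ∈ W ∧ w ≠ s)) :
    blowupSystem x W s w = algebraMap A _ (x w) := dif_neg h

theorem algebraMap_eq_mul_blowupCoord {w : ι} (hw : w ∈ W) :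
    algebraMap A (blowupRing x W s) (x w) =
      algebraMap A (blowupRing x W s) (x s) * blowupCoord x W s w := by
  by_cases h : w = s
  · subst h
    rw [blowupCoord_self, mul_one]
  · rw [blowupCoord_of_mem ⟨hw, h⟩]
    exact chartRing.algebraMap_eq (x s) (fun w : {w // w ∈ W ∧ w ≠ s} ↦ x w) ⟨w, hw, h⟩

theorem map_span_eq_blowup (hs : s ∈ W) :
    (Ideal.span (x '' W)).map (algebraMap A (blowupRing x W s)) =
      Ideal.span {algebraMap A (blowupRing x W s) (x s)} := by
  rw [Ideal.map_span]
  apply le_antisymm <;> rw [Ideal.span_le]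
  · rintro _ ⟨_, ⟨w, hw, rfl⟩, rfl⟩
    rw [algebraMap_eq_mul_blowupCoord hw]
    exact Ideal.mul_mem_right _ _ (Ideal.mem_span_singleton_self _)
  · rintro _ rfl
    exact Ideal.subset_span ⟨_, ⟨s, hs, rfl⟩, rfl⟩

theorem exists_blowupRing_lift {R : Type*} [CommRing R] (ρ : A →+* R)
    (h : ∀ w ∈ W, ρ (x s) ∣ ρ (x w)) :
    ∃ β : blowupRing x W s →+* R, β.comp (algebraMap A _) = ρ := by
  choose r hr using h
  refine ⟨chartRing.lift ρ (fun w ↦ r w.1 w.2.1) fun w ↦ hr w.1 w.2.1, ?_⟩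
  ext a
  exact chartRing.lift_algebraMap (p := x s) (y := fun w : {w // w ∈ W ∧ w ≠ s} ↦ x w) ρ
    (fun w ↦ r w.1 w.2.1) (fun w ↦ hr w.1 w.2.1) a

theorem blowupRing_hom_ext {R : Type*} [CommRing R] {β γ : blowupRing x W s →+* R}
    (h : β.comp (algebraMap A _) = γ.comp (algebraMap A _))
    (hs : β (algebraMap A _ (x s)) ∈ nonZeroDivisors R) : β = γ :=
  chartRing.ringHom_ext_of_nonZeroDivisor (fun a ↦ congrArg (fun e ↦ e a) h) hs

theorem IsStrictSystem.blowupSystem [Finite ι] (hx : IsStrictSystem x) :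
    IsStrictSystem (blowupSystem x W s) := by
  have := Fintype.ofFinite {w // w ∈ W ∧ w ≠ s}
  refine chartRing.isStrictSystem {w // w ∈ W ∧ w ≠ s} hx s Subtype.val Subtype.val_injective
    (fun w ↦ w.2.2) _ _ rfl (fun w ↦ rfl) _ (fun w ↦ ?_) (fun i hi ↦ ?_)
  · rw [blowupSystem_of_mem w.2, blowupCoord_of_mem w.2]
  · exact blowupSystem_of_notMem fun h ↦ hi ⟨i, h⟩ rfl

theorem algebraMap_mem_nonZeroDivisors [Finite ι] (hx : IsStrictSystem x) :
    algebraMap A (blowupRing x W s) (x s) ∈ nonZeroDivisors (blowupRing x W s) := by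
  have h := hx.blowupSystem (W := W) (s := s)
  have := h.isDomain
  have h1 := h.ne_zero s
  rw [blowupSystem_of_notMem (by simp)] at h1
  exact mem_nonZeroDivisors_of_ne_zero h1

end BlowupRing

/-! ### Charts of the blowup: geometry -/

section Local

/-- The local section ρ over an open of Y makes h open, and makes the stalk map of ρ a split
epimorphism. Precomposing ρ with m gives an open immersion, so this stalk map is also a
monomorphism. Hence ρ, and with it h, is an isomorphism on stalks. -/
theorem isOpenImmersion_of_local_sections {T Y : Scheme.{u}} (h : T ⟶ Y)
    (hinj : Function.Injective h)
    (H : ∀ r : T, ∃ (N D : Scheme.{u}) (n : N ⟶ Y) (_ : IsOpenImmersion n) (ρ : N ⟶ T) (i : D ⟶ T)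
      (_ : IsOpenImmersion i) (m : D ⟶ N), ρ ≫ h = n ∧ m ≫ ρ = i ∧ r ∈ Set.range i) :
    IsOpenImmersion h := by
  have hopen : IsOpenMap h := by
    rw [isOpenMap_iff_nhds_le]
    intro r
    obtain ⟨N, D, n, hn, ρ, i, hi, m, h1, h2, r', rfl⟩ := H r
    have h3 : i r' = ρ (m r') := by rw [← Scheme.Hom.comp_apply, h2]
    have h4 : h (i r') = n (m r') := by rw [h3, ← Scheme.Hom.comp_apply, h1]
    rw [h4, ← n.isOpenEmbedding.map_nhds_eq, ← h1]
    rw [h3]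
    have h5 : Filter.map (ρ ≫ h) (nhds (m r')) = Filter.map h (Filter.map ρ (nhds (m r'))) := by
      rw [Filter.map_map]
      rfl
    rw [h5]
    exact Filter.map_mono (ρ.continuous.tendsto _)
  have hstalk : ∀ r, IsIso (h.stalkMap r) := by
    intro r
    obtain ⟨N, D, n, hn, ρ, i, hi, m, h1, h2, r', rfl⟩ := H r
    have hn' : IsIso ((ρ ≫ h).stalkMap (m r')) := by
      rw [h1]
      infer_instance
    have hi' : IsIso ((m ≫ ρ).stalkMap r') := by
      rw [h2]
      infer_instance
    have h0 : i r' = ρ (m r') := by rw [← Scheme.Hom.comp_apply, h2]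
    rw [h0]
    have h3 := Scheme.Hom.stalkMap_comp ρ h (m r')
    have h4 := Scheme.Hom.stalkMap_comp m ρ r'
    have h5 : IsIso (h.stalkMap (ρ (m r')) ≫ ρ.stalkMap (m r')) := by
      rw [← h3]
      exact hn'
    have h6 : IsIso (ρ.stalkMap (m r') ≫ m.stalkMap r') := by
      rw [← h4]
      exact hi'
    have h7 : Mono (ρ.stalkMap (m r')) := mono_of_mono _ (m.stalkMap r')
    have h8 : IsSplitEpi (ρ.stalkMap (m r')) :=
      IsSplitEpi.mk' ⟨inv (h.stalkMap (ρ (m r')) ≫ ρ.stalkMap (m r')) ≫ h.stalkMap (ρ (m r')),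
        by simp⟩
    have h9 : IsIso (ρ.stalkMap (m r')) := isIso_of_mono_of_isSplitEpi _
    exact IsIso.of_isIso_comp_right _ (ρ.stalkMap (m r'))
  exact IsOpenImmersion.of_isIso_stalkMap h
    (.of_continuous_injective_isOpenMap h.continuous hinj hopen)

/-- A morphism from an affine scheme lifts to an affine open of the target after localization. -/
theorem exists_localization_lift {Y : Scheme.{u}} {B S : Type u} [CommRing B] [CommRing S]
    (h : Spec (CommRingCat.of B) ⟶ Y) (n : Spec (CommRingCat.of S) ⟶ Y) [IsOpenImmersion n]
    (r : Spec (CommRingCat.of B)) (hr : h r ∈ Set.range n) :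
    ∃ (c : B) (μ : S →+* Localization.Away c) (r' : Spec (CommRingCat.of (Localization.Away c))),
      specMap (algebraMap B (Localization.Away c)) ≫ h = specMap μ ≫ n ∧
      specMap (algebraMap B (Localization.Away c)) r' = r := by
  have hopen : IsOpen (h ⁻¹' Set.range n) :=
    n.isOpenEmbedding.isOpen_range.preimage h.continuous
  obtain ⟨_, ⟨c, rfl⟩, hrc, hc⟩ :=
    (PrimeSpectrum.isTopologicalBasis_basic_opens (R := B)).exists_subset_of_mem_open
      (show r ∈ h ⁻¹' Set.range n from hr) hopen
  have hrange : Set.range (specMap (algebraMap B (Localization.Away c))) =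
      (PrimeSpectrum.basicOpen c : Set (PrimeSpectrum B)) :=
    PrimeSpectrum.localization_away_comap_range (Localization.Away c) c
  have hsub : Set.range (specMap (algebraMap B (Localization.Away c)) ≫ h) ⊆ Set.range n := by
    rintro _ ⟨z, rfl⟩
    rw [Scheme.Hom.comp_apply]
    exact hc (hrange.le ⟨z, rfl⟩)
  obtain ⟨r', hr'⟩ : r ∈ Set.range (specMap (algebraMap B (Localization.Away c))) :=
    hrange.ge hrc
  let l := IsOpenImmersion.lift n _ hsub
  have hl : l ≫ n = specMap (algebraMap B (Localization.Away c)) ≫ h :=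
    IsOpenImmersion.lift_fac _ _ _
  refine ⟨c, (Spec.preimage l).hom, r', ?_, hr'⟩
  have : specMap (Spec.preimage l).hom = l := Spec.map_preimage l
  rw [this, hl]

theorem specMap_injective {R S : Type u} [CommRing R] [CommRing S] {φ ψ : R →+* S}
    (h : specMap φ = specMap ψ) : φ = ψ :=
  congrArg CommRingCat.Hom.hom (Spec.map_injective h)

end Local

section BlowupChart

variable {X Y : Scheme.{u}} {b : Y ⟶ X} {I : X.IdealSheafData}

/-- The blowup of an ideal sheaf. -/
structure IsIdealBlowup (b : Y ⟶ X) (I : X.IdealSheafData) : Prop where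
  cartier : IsCartier (I.comap b)
  universal : ∀ (T : Scheme.{u}) (g : T ⟶ X), IsCartier (I.comap g) → ∃! h : T ⟶ Y, h ≫ b = g

variable {A : Type u} [CommRing A] {φ : Spec (CommRingCat.of A) ⟶ X} {ι : Type} {x : ι → A}
  {W : Finset ι}

theorem idealOn_eq_of_dvd (hJ : idealOn I φ = Ideal.span (x '' W)) {R : Type u} [CommRing R]
    (ρ : A →+* R) {w : ι} (hw : w ∈ W) (h : ∀ v ∈ W, ρ (x w) ∣ ρ (x v)) :
    idealOn I (specMap ρ ≫ φ) = Ideal.span {ρ (x w)} := by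
  rw [idealOn_specMap_comp, hJ, Ideal.map_span]
  apply le_antisymm <;> rw [Ideal.span_le]
  · rintro _ ⟨_, ⟨v, hv, rfl⟩, rfl⟩
    exact Ideal.mem_span_singleton.mpr (h v hv)
  · rintro _ rfl
    exact Ideal.subset_span ⟨_, ⟨w, hw, rfl⟩, rfl⟩

/-- Uniqueness in the universal property concerns only morphisms that pull the ideal back to a
Cartier divisor; the nonzerodivisor generator ensures this. -/
theorem IsIdealBlowup.hom_ext (hb : IsIdealBlowup b I) {R : Type u} [CommRing R]
    {g g' : Spec (CommRingCat.of R) ⟶ Y} (h : g ≫ b = g' ≫ b) {r : R}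
    (hr : r ∈ nonZeroDivisors R) (hI : idealOn I (g ≫ b) = Ideal.span {r}) : g = g' :=
  (hb.universal _ _ (isCartier_comap_of_idealOn_eq_span I hr hI)).unique rfl h.symm

theorem IsIdealBlowup.exists_chart [Finite ι] (hb : IsIdealBlowup b I)
    (hJ : idealOn I φ = Ideal.span (x '' W)) (hx : IsStrictSystem x) {s : ι} (hs : s ∈ W) :
    ∃ h : Spec (CommRingCat.of (blowupRing x W s)) ⟶ Y,
      h ≫ b = specMap (algebraMap A (blowupRing x W s)) ≫ φ := by
  refine (hb.universal _ (specMap (algebraMap A (blowupRing x W s)) ≫ φ)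
    (isCartier_comap_of_idealOn_eq_span I (algebraMap_mem_nonZeroDivisors hx) ?_)).exists
  rw [idealOn_specMap_comp, hJ, map_span_eq_blowup hs]

/-- A morphism to the blowup over the chart factors through the chart of the blowup where the
exceptional divisor is defined by `x w` as soon as `x w` generates the pullback of the ideal. -/
theorem IsIdealBlowup.exists_factor (hb : IsIdealBlowup b I)
    (hJ : idealOn I φ = Ideal.span (x '' W)) {w : ι} (hw : w ∈ W)
    {h : Spec (CommRingCat.of (blowupRing x W w)) ⟶ Y}
    (hh : h ≫ b = specMap (algebraMap A (blowupRing x W w)) ≫ φ)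
    {R : Type u} [CommRing R] {g : Spec (CommRingCat.of R) ⟶ Y} {ρ : A →+* R}
    (hg : g ≫ b = specMap ρ ≫ φ) (hnzd : ρ (x w) ∈ nonZeroDivisors R)
    (hdvd : ∀ v ∈ W, ρ (x w) ∣ ρ (x v)) :
    ∃ β : blowupRing x W w →+* R, β.comp (algebraMap A _) = ρ ∧ g = specMap β ≫ h := by
  obtain ⟨β, hβ⟩ := exists_blowupRing_lift ρ hdvd
  refine ⟨β, hβ, hb.hom_ext ?_ hnzd ?_⟩
  · rw [Category.assoc, hh, ← Category.assoc, specMap_comp, hβ, hg]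
  · rw [hg]
    exact idealOn_eq_of_dvd hJ ρ hw hdvd

/-- If all the quotients d_w = ρ(x_w)/g lay in a prime P, then (g) ⊆ P(g), and cancelling g would
put 1 in P. So at each point of the blowup some x_w already generates the exceptional ideal. -/
theorem exists_eq_mul_of_map_eq_span {S : Type u} [CommRing S] {ρ : A →+* S} {g : S}
    (hg : g ∈ nonZeroDivisors S) (h : (Ideal.span (x '' W)).map ρ = Ideal.span {g}) :
    ∃ d : ι → S, (∀ w ∈ W, ρ (x w) = d w * g) ∧
      ∀ P : Ideal S, P.IsPrime → ∃ w ∈ W, d w ∉ P := by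
  classical
  have h1 : ∀ w ∈ W, ∃ d, ρ (x w) = d * g := by
    intro w hw
    have : ρ (x w) ∈ Ideal.span {g} := h ▸ Ideal.mem_map_of_mem _ (Ideal.subset_span ⟨w, hw, rfl⟩)
    obtain ⟨d, hd⟩ := Ideal.mem_span_singleton'.mp this
    exact ⟨d, hd.symm⟩
  choose! d hd using h1
  refine ⟨d, hd, fun P hP ↦ ?_⟩
  by_contra! hdP
  have h2 : (Ideal.span (x '' W)).map ρ ≤ P * Ideal.span {g} := by
    rw [Ideal.map_span, Ideal.span_le]
    rintro _ ⟨_, ⟨w, hw, rfl⟩, rfl⟩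
    rw [hd w hw]
    exact Ideal.mul_mem_mul (hdP w hw) (Ideal.mem_span_singleton_self g)
  rw [h] at h2
  obtain ⟨e, he, heg⟩ := Ideal.mem_mul_span_singleton.mp (h2 (Ideal.mem_span_singleton_self g))
  have h3 : e = 1 := (mul_cancel_right_mem_nonZeroDivisors hg).mp (heg.trans (one_mul g).symm)
  exact hP.ne_top ((Ideal.eq_top_iff_one P).mpr (h3 ▸ he))

theorem map_algebraMap_mem_nonZeroDivisors {S : Type u} [CommRing S] (c : S) {g : S}
    (hg : g ∈ nonZeroDivisors S) :
    algebraMap S (Localization.Away c) g ∈ nonZeroDivisors (Localization.Away c) :=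
  IsLocalization.map_nonZeroDivisors_le (Submonoid.powers c) _ ⟨g, hg, rfl⟩

theorem exists_localization_away_eq {S : Type u} [CommRing S] {c : S}
    {z : Spec (CommRingCat.of S)} (hc : c ∉ pt z) :
    ∃ z', specMap (algebraMap S (Localization.Away c)) z' = z := by
  have : z ∈ Set.range (PrimeSpectrum.comap (algebraMap S (Localization.Away c))) := by
    rw [PrimeSpectrum.localization_away_comap_range (Localization.Away c) c]
    exact hc
  exact this

/-- Data presenting the blowup locally on the source. -/
theorem IsIdealBlowup.exists_local_presentation [IsOpenImmersion φ] (hb : IsIdealBlowup b I)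
    (hJ : idealOn I φ = Ideal.span (x '' W)) (y : Y) (hy : b y ∈ Set.range φ) :
    ∃ (S : Type u) (_ : CommRing S) (n : Spec (CommRingCat.of S) ⟶ Y) (_ : IsOpenImmersion n)
      (z : Spec (CommRingCat.of S)) (ρ : A →+* S) (g : S) (d : ι → S), n z = y ∧
      n ≫ b = specMap ρ ≫ φ ∧ g ∈ nonZeroDivisors S ∧
      (Ideal.span (x '' W)).map ρ = Ideal.span {g} ∧ (∀ w ∈ W, ρ (x w) = d w * g) ∧
      (∃ w ∈ W, d w ∉ pt z) := by
  obtain ⟨S, hS, n, hn, ρ, ⟨z, hz⟩, hρ, g, hg, hspan⟩ :=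
    exists_idealOn_eq_span_of_isCartier I hb.cartier φ y hy
  rw [hJ] at hspan
  obtain ⟨d, hd, hP⟩ := exists_eq_mul_of_map_eq_span hg hspan
  exact ⟨S, hS, n, hn, z, ρ, g, d, hz, hρ, hg, hspan, hd, hP _ inferInstance⟩

/-- Where d_w is inverted, x_w is itself a generator of the pulled back ideal and `exists_factor`
applies. -/
theorem IsIdealBlowup.exists_factor_of_presentation (hb : IsIdealBlowup b I)
    (hJ : idealOn I φ = Ideal.span (x '' W)) {w : ι} (hw : w ∈ W)
    {h : Spec (CommRingCat.of (blowupRing x W w)) ⟶ Y}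
    (hh : h ≫ b = specMap (algebraMap A (blowupRing x W w)) ≫ φ)
    {S : Type u} [CommRing S] {n : Spec (CommRingCat.of S) ⟶ Y} [IsOpenImmersion n]
    {z : Spec (CommRingCat.of S)} {ρ : A →+* S} {g : S} {d : ι → S}
    (hn : n ≫ b = specMap ρ ≫ φ) (hg : g ∈ nonZeroDivisors S)
    (hd : ∀ w ∈ W, ρ (x w) = d w * g) (hdw : d w ∉ pt z) :
    ∃ (S' : Type u) (_ : CommRing S') (n' : Spec (CommRingCat.of S') ⟶ Y)
      (_ : IsOpenImmersion n') (β : blowupRing x W w →+* S'), n z ∈ Set.range n' ∧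
      n' = specMap β ≫ h := by
  set γ := algebraMap S (Localization.Away (d w)) with hγ
  obtain ⟨u, hu⟩ : IsUnit (γ (d w)) := IsLocalization.Away.algebraMap_isUnit (d w)
  obtain ⟨z', hz'⟩ := exists_localization_away_eq hdw
  have hg' : γ g ∈ nonZeroDivisors _ := map_algebraMap_mem_nonZeroDivisors _ hg
  obtain ⟨β, hβ, hn'⟩ := hb.exists_factor hJ hw hh (g := specMap γ ≫ n) (ρ := γ.comp ρ)
    (by rw [Category.assoc, hn, ← Category.assoc, specMap_comp])
    (by
      rw [RingHom.comp_apply, hd w hw, map_mul, ← hu]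
      exact mul_mem u.isUnit.mem_nonZeroDivisors hg')
    (by
      intro v hv
      rw [RingHom.comp_apply, RingHom.comp_apply, hd w hw, hd v hv, map_mul, map_mul]
      exact mul_dvd_mul (hu ▸ u.isUnit.dvd) dvd_rfl)
  refine ⟨Localization.Away (d w), inferInstance, specMap γ ≫ n, inferInstance, β, ⟨z', ?_⟩, hn'⟩
  rw [Scheme.Hom.comp_apply, hz']

/-- The charts of the blowup cover the preimage of the chart. -/
theorem IsIdealBlowup.exists_mem_range [IsOpenImmersion φ] (hb : IsIdealBlowup b I)
    (hJ : idealOn I φ = Ideal.span (x '' W))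
    {h : ∀ s ∈ W, Spec (CommRingCat.of (blowupRing x W s)) ⟶ Y}
    (hh : ∀ s hs, h s hs ≫ b = specMap (algebraMap A (blowupRing x W s)) ≫ φ)
    (y : Y) (hy : b y ∈ Set.range φ) : ∃ s, ∃ hs : s ∈ W, y ∈ Set.range (h s hs) := by
  obtain ⟨S, hS, n, hn, z, ρ, g, d, rfl, hρ, hg, hspan, hd, w, hw, hdw⟩ :=
    hb.exists_local_presentation hJ y hy
  obtain ⟨S', _, n', _, β, ⟨z', hz'⟩, hβ⟩ :=
    hb.exists_factor_of_presentation hJ hw (hh w hw) hρ hg hd hdw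
  refine ⟨w, hw, specMap β z', ?_⟩
  rw [← Scheme.Hom.comp_apply, ← hβ, hz']

theorem comp_algebraMap_eq [IsOpenImmersion φ] {B S R : Type u} [CommRing B] [CommRing S]
    [CommRing R] {h : Spec (CommRingCat.of B) ⟶ Y} {n : Spec (CommRingCat.of S) ⟶ Y}
    {α : A →+* B} {ρ : A →+* S} (hh : h ≫ b = specMap α ≫ φ) (hn : n ≫ b = specMap ρ ≫ φ)
    {γ : B →+* R} {μ : S →+* R} (hμ : specMap γ ≫ h = specMap μ ≫ n) :
    μ.comp ρ = γ.comp α := by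
  apply specMap_injective
  rw [← cancel_mono φ, ← specMap_comp, ← specMap_comp, Category.assoc, Category.assoc, ← hh, ← hn,
    ← Category.assoc, ← Category.assoc, hμ]

/-- Around its image, a chart of the blowup has a local section. -/
theorem IsIdealBlowup.exists_section [Finite ι] [IsOpenImmersion φ] (hb : IsIdealBlowup b I)
    (hJ : idealOn I φ = Ideal.span (x '' W)) (hx : IsStrictSystem x) {s : ι} (hs : s ∈ W)
    {h : Spec (CommRingCat.of (blowupRing x W s)) ⟶ Y}
    (hh : h ≫ b = specMap (algebraMap A (blowupRing x W s)) ≫ φ)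
    (r : Spec (CommRingCat.of (blowupRing x W s))) :
    ∃ (S' : Type u) (_ : CommRing S') (n' : Spec (CommRingCat.of S') ⟶ Y)
      (_ : IsOpenImmersion n') (β : blowupRing x W s →+* S'), h r ∈ Set.range n' ∧
      n' = specMap β ≫ h := by
  obtain ⟨S, hS, n, hn, z, ρ, g, d, hz, hρ, hg, hspan, hd, -⟩ :=
    hb.exists_local_presentation hJ (h r) (by
      rw [← Scheme.Hom.comp_apply, hh, Scheme.Hom.comp_apply]
      exact ⟨_, rfl⟩)
  rw [← hz]
  refine hb.exists_factor_of_presentation hJ hs hh hρ hg hd ?_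
  obtain ⟨c, μ, r', hμ, rfl⟩ := exists_localization_lift h n r ⟨z, hz⟩
  set γ := algebraMap (blowupRing x W s) (Localization.Away c) with hγ
  have hz' : specMap μ r' = z := by
    refine n.isOpenEmbedding.injective ?_
    rw [hz, ← Scheme.Hom.comp_apply, ← hμ, Scheme.Hom.comp_apply]
  rw [← hz', mem_specMap]
  have h1 := comp_algebraMap_eq hh hρ hμ
  have hnzd := map_algebraMap_mem_nonZeroDivisors c
    (algebraMap_mem_nonZeroDivisors (W := W) (s := s) hx)
  -- Over the localization both g and x_s generate the pulled back ideal, so the quotient d_s =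
  -- x_s/g is invertible at the given point.
  have h2 : μ g ∈ Ideal.span {γ (algebraMap A _ (x s))} := by
    have h3 : (Ideal.span (x '' W)).map (μ.comp ρ) = Ideal.span {μ g} := by
      rw [← Ideal.map_map, hspan, Ideal.map_span, Set.image_singleton]
    rw [h1, ← Ideal.map_map, map_span_eq_blowup hs, Ideal.map_span, Set.image_singleton] at h3
    rw [h3]
    exact Ideal.mem_span_singleton_self _
  obtain ⟨k, hk⟩ := Ideal.mem_span_singleton'.mp h2
  have h4 : γ (algebraMap A _ (x s)) = μ (d s) * μ g := by
    rw [← map_mul, ← hd s hs, ← RingHom.comp_apply μ, h1, RingHom.comp_apply]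
  have h5 : μ (d s) * k = 1 := by
    refine (mul_cancel_right_mem_nonZeroDivisors hnzd).mp ?_
    rw [mul_assoc, hk, ← h4, one_mul]
  exact fun hmem ↦ Ideal.IsPrime.ne_top (I := pt r') inferInstance
    (Ideal.eq_top_of_isUnit_mem _ hmem (IsUnit.of_mul_eq_one _ h5))

/-- The charts of the blowup are open immersions. -/
theorem IsIdealBlowup.isOpenImmersion_chart [Finite ι] [IsOpenImmersion φ]
    (hb : IsIdealBlowup b I) (hJ : idealOn I φ = Ideal.span (x '' W)) (hx : IsStrictSystem x)
    {s : ι} (hs : s ∈ W) {h : Spec (CommRingCat.of (blowupRing x W s)) ⟶ Y}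
    (hh : h ≫ b = specMap (algebraMap A (blowupRing x W s)) ≫ φ) : IsOpenImmersion h := by
  -- The section given by β is also a left inverse of the chart locally: after localization, both
  -- composites agree on A, and x_s is a nonzerodivisor, so `blowupRing_hom_ext` identifies them.
  have key : ∀ (S' : Type u) [CommRing S'] (n' : Spec (CommRingCat.of S') ⟶ Y)
      [IsOpenImmersion n'] (β : blowupRing x W s →+* S'), n' = specMap β ≫ h →
      ∀ r, h r ∈ Set.range n' → ∃ (c : blowupRing x W s) (μ : S' →+* Localization.Away c)
        (r' : Spec (CommRingCat.of (Localization.Away c))),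
        specMap μ ≫ specMap β = specMap (algebraMap _ (Localization.Away c)) ∧
        specMap (algebraMap _ (Localization.Away c)) r' = r := by
    intro S' _ n' _ β hβ r hr
    obtain ⟨c, μ, r', hμ, hr'⟩ := exists_localization_lift h n' r hr
    refine ⟨c, μ, r', ?_, hr'⟩
    have hn' : n' ≫ b = specMap (β.comp (algebraMap A _)) ≫ φ := by
      rw [hβ, Category.assoc, hh, ← Category.assoc, specMap_comp]
    have h1 := comp_algebraMap_eq hh hn' hμ
    rw [specMap_comp]
    exact congrArg specMap (blowupRing_hom_ext (β := algebraMap _ (Localization.Away c))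
      (γ := μ.comp β) h1.symm (map_algebraMap_mem_nonZeroDivisors c
        (algebraMap_mem_nonZeroDivisors (W := W) (s := s) hx))).symm
  refine isOpenImmersion_of_local_sections h ?_ ?_
  · intro r₁ r₂ hr
    obtain ⟨S', _, n', _, β, hmem, hβ⟩ := hb.exists_section hJ hx hs hh r₁
    obtain ⟨c₁, μ₁, r₁', h₁, rfl⟩ := key S' n' β hβ r₁ hmem
    obtain ⟨c₂, μ₂, r₂', h₂, rfl⟩ := key S' n' β hβ r₂ (hr ▸ hmem)
    rw [← h₁, ← h₂, Scheme.Hom.comp_apply, Scheme.Hom.comp_apply] at hr ⊢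
    rw [← Scheme.Hom.comp_apply (specMap β), ← Scheme.Hom.comp_apply (specMap β), ← hβ] at hr
    rw [n'.isOpenEmbedding.injective hr]
  · intro r
    obtain ⟨S', _, n', hn', β, hmem, hβ⟩ := hb.exists_section hJ hx hs hh r
    obtain ⟨c, μ, r', h1, h2⟩ := key S' n' β hβ r hmem
    exact ⟨_, _, n', hn', specMap β, specMap (algebraMap _ (Localization.Away c)), inferInstance,
      specMap μ, hβ.symm, h1, r', h2⟩

/-- Overlaps of the charts of the blowup. -/
theorem IsIdealBlowup.mem_range_chart_iff [Finite ι] [IsOpenImmersion φ]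
    (hb : IsIdealBlowup b I) (hJ : idealOn I φ = Ideal.span (x '' W)) (hx : IsStrictSystem x)
    {s w : ι} (hs : s ∈ W) (hw : w ∈ W) {h : Spec (CommRingCat.of (blowupRing x W s)) ⟶ Y}
    (hh : h ≫ b = specMap (algebraMap A (blowupRing x W s)) ≫ φ)
    {h' : Spec (CommRingCat.of (blowupRing x W w)) ⟶ Y}
    (hh' : h' ≫ b = specMap (algebraMap A (blowupRing x W w)) ≫ φ)
    (r : Spec (CommRingCat.of (blowupRing x W s))) :
    h r ∈ Set.range h' ↔ blowupCoord x W s w ∉ pt r := by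
  have hnzd := algebraMap_mem_nonZeroDivisors (W := W) (s := s) hx
  constructor
  · intro hr
    have := hb.isOpenImmersion_chart hJ hx hw hh'
    obtain ⟨c, μ, r', hμ, rfl⟩ := exists_localization_lift h h' r hr
    set γ := algebraMap (blowupRing x W s) (Localization.Away c) with hγ
    have h1 := comp_algebraMap_eq hh hh' hμ
    have h2 : γ (algebraMap A _ (x s)) = γ (algebraMap A _ (x w)) * μ (blowupCoord x W w s) := by
      rw [← RingHom.comp_apply γ, ← RingHom.comp_apply γ, ← h1, RingHom.comp_apply,
        RingHom.comp_apply, ← map_mul, ← algebraMap_eq_mul_blowupCoord hs]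
    -- On the overlap, x_w/x_s and x_s/x_w are inverse to each other.
    have h3 : γ (blowupCoord x W s w) * μ (blowupCoord x W w s) = 1 := by
      refine (mul_cancel_left_mem_nonZeroDivisors
        (map_algebraMap_mem_nonZeroDivisors c hnzd)).mp ?_
      rw [← mul_assoc, ← map_mul, ← algebraMap_eq_mul_blowupCoord hw, mul_one]
      exact h2.symm
    rw [mem_specMap]
    exact fun hmem ↦ Ideal.IsPrime.ne_top (I := pt r') inferInstance
      (Ideal.eq_top_of_isUnit_mem _ hmem (IsUnit.of_mul_eq_one _ h3))
  · intro hr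
    obtain ⟨r', rfl⟩ := exists_localization_away_eq hr
    set γ := algebraMap (blowupRing x W s) (Localization.Away (blowupCoord x W s w)) with hγ
    obtain ⟨u, hu⟩ : IsUnit (γ (blowupCoord x W s w)) :=
      IsLocalization.Away.algebraMap_isUnit _
    have hval : ∀ v ∈ W, (γ.comp (algebraMap A _)) (x v) =
        γ (algebraMap A _ (x s)) * γ (blowupCoord x W s v) := fun v hv ↦ by
      rw [RingHom.comp_apply, ← map_mul, ← algebraMap_eq_mul_blowupCoord hv]
    obtain ⟨β, -, hβ⟩ := hb.exists_factor hJ hw hh' (g := specMap γ ≫ h)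
      (ρ := γ.comp (algebraMap A _)) (by rw [Category.assoc, hh, ← Category.assoc, specMap_comp])
      (by
        rw [hval w hw, ← hu]
        exact mul_mem (map_algebraMap_mem_nonZeroDivisors _ hnzd) u.isUnit.mem_nonZeroDivisors)
      (by
        intro v hv
        rw [hval w hw, hval v hv]
        exact mul_dvd_mul dvd_rfl (hu ▸ u.isUnit.dvd))
    refine ⟨specMap β r', ?_⟩
    rw [← Scheme.Hom.comp_apply, ← hβ, Scheme.Hom.comp_apply]

end BlowupChart


/-! ### The identity between weights -/

section WeightIdentity

variable (k : Type u) [Field k]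

theorem lefschetz_sub_one_sq : (lefschetz k - 1) * (lefschetz k - 1) = 0 := by
  have h : K0VarQMod.quot k ((K0VarQ.incl k (K0Var.mk (KVar.affineLine k)) - 1) ^ 2) = 0 :=
    Ideal.Quotient.eq_zero_iff_mem.mpr (Ideal.subset_span rfl)
  rw [map_pow, map_sub, map_one, sq] at h
  exact h

theorem weight_singleton (a : ℕ) : weight k {a} = if a = 1 then 1 else 0 := by
  simp [weight]

theorem weight_pair (a b : ℕ) : weight k {a, b} =
    if Nat.gcd a b = 1 then (1 / ((a * b : ℕ) : ℚ)) • (1 - lefschetz k) else 0 := by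
  have h : ({a, b} : Multiset ℕ) ≠ {1} := fun h ↦ by simpa using congrArg Multiset.card h
  rw [weight, if_neg h, zero_add]
  refine if_congr ?_ ?_ rfl
  · simp
    rfl
  · simp

theorem weight_of_three_le {m : Multiset ℕ} (h : 3 ≤ m.card) : weight k m = 0 := by
  rw [weight, if_neg (by rintro rfl; simp at h), if_neg (by omega), add_zero]

/-- Apart from {1}, every weight is a multiple of 1 - 𝕃, and (𝕃 - 1)² = 0. -/
theorem weight_mul_lefschetz_sub_one {m : Multiset ℕ} (h : m ≠ {1}) :
    weight k m * (lefschetz k - 1) = 0 := by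
  rw [weight, if_neg h, zero_add]
  split_ifs
  · rw [smul_mul_assoc, ← neg_sub (lefschetz k) 1, neg_mul, lefschetz_sub_one_sq, neg_zero,
      smul_zero]
  · rw [zero_mul]

theorem weight_mul_pow {m : Multiset ℕ} (h : m ≠ {1}) {n : ℕ} (hn : n ≠ 0) :
    weight k m * (lefschetz k - 1) ^ n = 0 := by
  obtain ⟨n, rfl⟩ := Nat.exists_eq_succ_of_ne_zero hn
  rw [pow_succ', ← mul_assoc, weight_mul_lefschetz_sub_one k h, zero_mul]

variable {ι : Type*} [DecidableEq ι]

/-- For nonempty T ⊆ W \ {v}, the terms of T and T ∪ {v} cancel. If a_v = 1, their weights are 1 - 𝕃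
and 1, against powers of 𝕃 - 1 whose exponents differ by one. If a_v ≠ 1, both weights vanish. Only
T = {v} is left. -/
theorem sum_weight_of_eq_singleton {v : ι} {W : Finset ι} (hv : v ∈ W) (a : ι → ℕ) :
    ∑ T ∈ W.powerset with T.Nonempty, weight k (a v ::ₘ (({v} : Finset ι) \ T).val.map a) *
      (lefschetz k - 1) ^ (T.card - 1) = weight k {a v} := by
  rw [Finset.sum_filter, ← Finset.insert_erase hv, Finset.sum_powerset_insert (by simp)]
  rw [← Finset.sum_add_distrib, Finset.sum_eq_single ∅]
  · simp
  · intro T hT hT0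
    have hvT : v ∉ T := fun h ↦ by simpa using Finset.mem_powerset.mp hT h
    have hne := Finset.nonempty_iff_ne_empty.mpr hT0
    have h1 : ({v} : Finset ι) \ T = {v} := by simpa using hvT
    have h2 : ({v} : Finset ι) \ insert v T = ∅ := by simp
    rw [if_pos hne, if_pos (Finset.insert_nonempty _ _), h1, h2,
      Finset.card_insert_of_notMem hvT]
    have h3 : (a v ::ₘ (({v} : Finset ι).val.map a)) = {a v, a v} := by simp
    have h4 : (a v ::ₘ ((∅ : Finset ι).val.map a)) = {a v} := by simp
    rw [h3, h4, weight_pair, weight_singleton]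
    simp only [Nat.gcd_self]
    obtain ⟨n, hn⟩ := Nat.exists_eq_succ_of_ne_zero hne.card_pos.ne'
    rw [hn]
    split_ifs with ha
    · rw [ha]
      simp only [mul_one, Nat.cast_one, div_one, one_smul, Nat.succ_eq_add_one,
        Nat.add_sub_cancel, one_mul]
      ring
    · simp
  · simp

/-- The weights of the strata of the exceptional divisor add up to the weight of the stratum of
the center. -/
theorem sum_weight_eq {H W : Finset ι} {a : ι → ℕ} (ha : ∀ v ∈ H, 1 ≤ a v)
    (hHW : (H ∩ W).Nonempty) :
    ∑ T ∈ W.powerset with T.Nonempty,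
      weight k ((∑ v ∈ H ∩ W, a v) ::ₘ (H \ T).val.map a) * (lefschetz k - 1) ^ (T.card - 1) =
      weight k (H.val.map a) := by
  obtain ⟨v, hv⟩ := hHW
  rw [Finset.mem_inter] at hv
  rcases Nat.lt_or_ge H.card 2 with hH | hH
  · have h1 : H = {v} :=
      (Finset.eq_singleton_iff_unique_mem).mpr ⟨hv.1, fun w hw ↦
        Finset.card_le_one.mp (by omega) w hw v hv.1⟩
    subst h1
    have h2 : ({v} : Finset ι) ∩ W = {v} := by simpa using hv.2
    rw [h2, Finset.sum_singleton, sum_weight_of_eq_singleton k hv.2]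
    simp
  set e := ∑ v ∈ H ∩ W, a v with he
  -- Only the T = {t} with t ∈ H survive: for t ∉ H at least three components meet, and a larger T
  -- brings a factor 𝕃 - 1 against a weight that is already a multiple of it.
  have hsingle : ∑ T ∈ W.powerset with T.Nonempty,
      weight k (e ::ₘ (H \ T).val.map a) * (lefschetz k - 1) ^ (T.card - 1) =
      ∑ t ∈ H ∩ W, weight k (e ::ₘ (H \ {t}).val.map a) := by
    symm
    refine Finset.sum_of_injOn (fun t ↦ {t}) (fun t _ u _ h ↦ Finset.singleton_injective h) ?_ ?_ ?_
    · intro t ht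
      have := (Finset.mem_inter.mp ht).2
      simpa using this
    · intro T hT hT'
      obtain ⟨hTW, hT0⟩ := Finset.mem_filter.mp hT
      rw [Finset.mem_powerset] at hTW
      by_cases hcard : T.card = 1
      · obtain ⟨t, rfl⟩ := Finset.card_eq_one.mp hcard
        have htH : t ∉ H := fun htH ↦ hT' ⟨t, by
          simpa using ⟨htH, Finset.singleton_subset_iff.mp hTW⟩, rfl⟩
        rw [weight_of_three_le, zero_mul]
        rw [Finset.sdiff_singleton_eq_erase, Finset.erase_eq_of_notMem htH, Multiset.card_cons,
          Multiset.card_map, Finset.card_val]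
        omega
      · refine weight_mul_pow k (fun h1 ↦ ?_) (by have := hT0.card_pos; omega)
        have h2 : H \ T = ∅ := by
          have := congrArg Multiset.card h1
          rw [Multiset.card_cons, Multiset.card_map, Finset.card_val, Multiset.card_singleton] at this
          exact Finset.card_eq_zero.mp (by omega)
        have h3 : H ∩ W = H := Finset.inter_eq_left.mpr ((Finset.sdiff_eq_empty_iff_subset.mp h2).trans hTW)
        -- The exceptional weight {1} would require H ⊆ T ⊆ W, but then e is a sum of at least two
        -- positive multiplicities.
        have h4 : H.card ≤ e := by
          rw [he, h3, Finset.card_eq_sum_ones]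
          exact Finset.sum_le_sum ha
        have h5 : e = 1 := by
          rw [h2] at h1
          simpa using h1
        omega
    · intro t _
      simp
  rw [hsingle]
  rcases hH.lt_or_eq with hH3 | hH2
  -- For |H| ≥ 3, exchanging one component for the exceptional one keeps their number, so both sides
  -- vanish.
  · rw [weight_of_three_le k (m := H.val.map a) (by rw [Multiset.card_map]; exact hH3)]
    refine Finset.sum_eq_zero fun t ht ↦ weight_of_three_le k ?_
    rw [Multiset.card_cons, Multiset.card_map, Finset.card_val, Finset.sdiff_singleton_eq_erase,
      Finset.card_erase_of_mem (Finset.mem_inter.mp ht).1]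
    omega
  · obtain ⟨w, hw⟩ := Finset.card_eq_one.mp (show (H.erase v).card = 1 by
      rw [Finset.card_erase_of_mem hv.1]; omega)
    have hwH : w ∈ H ∧ w ≠ v := by
      have : w ∈ H.erase v := hw ▸ Finset.mem_singleton_self w
      exact ⟨Finset.mem_of_mem_erase this, Finset.ne_of_mem_erase this⟩
    have hHeq : H = {v, w} := by rw [← Finset.insert_erase hv.1, hw]
    have hHv : H \ {v} = {w} := by rw [Finset.sdiff_singleton_eq_erase, hw]
    have hHw : H \ {w} = {v} := by
      rw [hHeq]
      ext i
      simp only [Finset.mem_sdiff, Finset.mem_insert, Finset.mem_singleton]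
      constructor
      · rintro ⟨h1 | h1, h2⟩
        · exact h1
        · exact absurd h1 h2
      · rintro rfl
        exact ⟨Or.inl rfl, hwH.2.symm⟩
    have hval : H.val.map a = {a v, a w} := by
      rw [hHeq, Finset.insert_val_of_notMem (by simpa using hwH.2.symm)]
      simp
    have hpair : ∀ b c : ℕ, b ::ₘ ({c} : Multiset ℕ) = {b, c} := fun _ _ ↦ rfl
    by_cases hwW : w ∈ W
    · have h1 : H ∩ W = {v, w} := by
        rw [← hHeq]
        exact Finset.inter_eq_left.mpr (by
          rw [hHeq]; intro i hi
          rcases Finset.mem_insert.mp hi with rfl | hi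
          · exact hv.2
          · rw [Finset.mem_singleton.mp hi]; exact hwW)
      have h2 : e = a v + a w := by rw [he, h1, Finset.sum_pair hwH.2.symm]
      rw [h1, Finset.sum_pair hwH.2.symm, hHv, hHw, h2, hval, Finset.singleton_val,
        Finset.singleton_val, Multiset.map_singleton, Multiset.map_singleton, hpair, hpair,
        weight_pair, weight_pair, weight_pair]
      have h3 : Nat.gcd (a v + a w) (a v) = Nat.gcd (a v) (a w) := by
        rw [add_comm, Nat.gcd_add_self_left, Nat.gcd_comm]
      have h4 : Nat.gcd (a v + a w) (a w) = Nat.gcd (a v) (a w) := Nat.gcd_add_self_left _ _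
      simp only [h3, h4]
      split_ifs
      -- 1/((a + b)a) + 1/((a + b)b) = 1/(ab).
      · rw [← add_smul]
        congr 1
        have hv1 : (a v : ℚ) ≠ 0 := by have := ha v hv.1; positivity
        have hw1 : (a w : ℚ) ≠ 0 := by have := ha w hwH.1; positivity
        have hvw : (a v : ℚ) + a w ≠ 0 := by have := ha v hv.1; positivity
        push_cast
        field_simp
      · rw [add_zero]
    -- The center lies on D_v but not in D_w: the exceptional divisor takes the place of D_v, with
    -- the same multiplicity.
    · have h1 : H ∩ W = {v} := by
        rw [hHeq]
        ext i
        simp only [Finset.mem_inter, Finset.mem_insert, Finset.mem_singleton]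
        constructor
        · rintro ⟨h1 | h1, h2⟩
          · exact h1
          · exact absurd (h1 ▸ h2) hwW
        · rintro rfl
          exact ⟨Or.inl rfl, hv.2⟩
      have h2 : e = a v := by rw [he, h1, Finset.sum_singleton]
      rw [h1, Finset.sum_singleton, hHv, h2, hval]
      simp

end WeightIdentity


/-! ### Pieces of the special fibre in a chart -/

section Strata

variable {O : Type u} [CommRing O] [IsDomain O] [IsDiscreteValuationRing O]
variable {X : Scheme.{u}} {f : X ⟶ Spec (CommRingCat.of O)} {ϖ : O}

instance [LocallyOfFiniteType f] : LocallyOfFiniteType (specialFiberStr f) :=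
  inferInstanceAs (LocallyOfFiniteType (pullback.snd f _))

instance [QuasiCompact f] : CompactSpace (specialFiber f) := by
  have : QuasiCompact (specialFiberStr f) := inferInstanceAs (QuasiCompact (pullback.snd f _))
  exact QuasiCompact.compactSpace_of_compactSpace (specialFiberStr f)

theorem noetherianSpace_of_locallyOfFiniteType {k : Type u} [Field k] {W : Scheme.{u}}
    (q : W ⟶ Spec (CommRingCat.of k)) [LocallyOfFiniteType q] [CompactSpace W] :
    TopologicalSpace.NoetherianSpace W := by
  have := LocallyOfFiniteType.isLocallyNoetherian q
  have : IsNoetherian W := { }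
  infer_instance

theorem isConstructible_preimage {W W' : Type*} [TopologicalSpace W] [TopologicalSpace W']
    [TopologicalSpace.NoetherianSpace W'] {g : W' → W} (hg : Continuous g) {C : Set W}
    (hC : Topology.IsConstructible C) : Topology.IsConstructible (g ⁻¹' C) :=
  hC.preimage hg fun _ _ _ _ _ _ ↦ TopologicalSpace.NoetherianSpace.isCompact _

theorem isConstructible_of_isOpen {W : Type*} [TopologicalSpace W]
    [TopologicalSpace.NoetherianSpace W] {U : Set W} (hU : IsOpen U) :
    Topology.IsConstructible U :=
  IsRetrocompact.isConstructible hU fun _ _ _ ↦ TopologicalSpace.NoetherianSpace.isCompact _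

namespace SNCChart

variable (c : SNCChart f ϖ) {R : Type u} [CommRing R] [Algebra (IsLocalRing.ResidueField O) R]
  {θ : c.A →+* R}

theorem sub_condition (hθ : ∀ o, θ (c.α o) = algebraMap _ R (IsLocalRing.residue O o)) :
    (specMap θ ≫ c.φ) ≫ f = specStr (IsLocalRing.ResidueField O) R ≫
      Spec.map (CommRingCat.ofHom (IsLocalRing.residue O)) := by
  have h : specStr (IsLocalRing.ResidueField O) R ≫
      Spec.map (CommRingCat.ofHom (IsLocalRing.residue O)) =
      specMap ((algebraMap (IsLocalRing.ResidueField O) R).comp (IsLocalRing.residue O)) :=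
    specMap_comp _ _
  rw [Category.assoc, c.φ_comp, specMap_comp, h]
  exact congrArg specMap (RingHom.ext hθ)

/-- A closed subscheme of a chart lying in the special fibre. -/
noncomputable def sub (hθ : ∀ o, θ (c.α o) = algebraMap _ R (IsLocalRing.residue O o)) :
    Spec (CommRingCat.of R) ⟶ specialFiber f :=
  pullback.lift (specMap θ ≫ c.φ) (specStr (IsLocalRing.ResidueField O) R) (c.sub_condition hθ)

variable (hθ : ∀ o, θ (c.α o) = algebraMap _ R (IsLocalRing.residue O o))

theorem sub_comp_str :
    c.sub hθ ≫ specialFiberStr f = specStr (IsLocalRing.ResidueField O) R :=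
  pullback.lift_snd _ _ _

theorem sub_comp_incl : c.sub hθ ≫ specialFiberIncl f = specMap θ ≫ c.φ :=
  pullback.lift_fst _ _ _

theorem incl_sub_apply (r : Spec (CommRingCat.of R)) :
    specialFiberIncl f (c.sub hθ r) = c.φ (specMap θ r) := by
  rw [← Scheme.Hom.comp_apply, sub_comp_incl, Scheme.Hom.comp_apply]

theorem isImmersion_sub (hs : Function.Surjective θ) : IsImmersion (c.sub hθ) := by
  have : IsClosedImmersion (specMap θ) := IsClosedImmersion.spec_of_surjective _ hs
  have : IsImmersion (c.sub hθ ≫ specialFiberIncl f) := by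
    rw [sub_comp_incl]
    infer_instance
  exact IsImmersion.of_comp (c.sub hθ) (specialFiberIncl f)

theorem mem_range_sub (hs : Function.Surjective θ) {p : specialFiber f}
    {q : Spec (CommRingCat.of c.A)} (hp : specialFiberIncl f p = c.φ q)
    (hq : RingHom.ker θ ≤ pt q) : ∃ r, c.sub hθ r = p ∧ specMap θ r = q := by
  obtain ⟨r, rfl⟩ := exists_specMap_eq hs hq
  exact ⟨r, eq_of_specialFiberIncl_eq ((c.incl_sub_apply hθ r).trans hp.symm), rfl⟩

variable {c} in
theorem hasClass_sub_image (hs : Function.Surjective θ) {E : Set (Spec (CommRingCat.of R))}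
    (hE : HasClass (specStr (IsLocalRing.ResidueField O) R) E) :
    HasClass (specialFiberStr f) (c.sub hθ '' E) ∧
      classOf (specialFiberStr f) (c.sub hθ '' E) =
        classOf (specStr (IsLocalRing.ResidueField O) R) E := by
  have := c.isImmersion_sub hθ hs
  exact ⟨hE.image _ (c.sub_comp_str hθ), classOf_image _ (c.sub_comp_str hθ) hE⟩

/-- The invariant of a subset of a chart that meets a fixed set of coordinate hyperplanes. -/
theorem tildeS_sub_image [TopologicalSpace.NoetherianSpace (specialFiber f)]
    (hϖ : Ideal.span {ϖ} = IsLocalRing.maximalIdeal O)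
    (hs : Function.Surjective θ) {E : Set (Spec (CommRingCat.of R))}
    (hE : HasClass (specStr (IsLocalRing.ResidueField O) R) E) (H : Finset (Fin c.n))
    (hH : ∀ r ∈ E, ∀ v, v ∈ H ↔ v ∈ c.V ∧ θ (c.x v) ∈ pt r) :
    tildeS f (c.sub hθ '' E) = weight (IsLocalRing.ResidueField O) (H.val.map c.a) *
      classOf (specStr (IsLocalRing.ResidueField O) R) E := by
  obtain ⟨h1, h2⟩ := hasClass_sub_image hθ hs hE
  rw [tildeS_of_mults_eq h1 (m := H.val.map c.a), h2]
  rintro _ ⟨r, hr, rfl⟩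
  exact c.mults_eq hϖ (c.incl_sub_apply hθ r) H (hH r hr)

theorem finiteType_sub [LocallyOfFiniteType f]
    (hθ : ∀ o, θ (c.α o) = algebraMap _ R (IsLocalRing.residue O o)) (hs : Function.Surjective θ) :
    LocallyOfFiniteType (specStr (IsLocalRing.ResidueField O) R) := by
  have := c.isImmersion_sub hθ hs
  rw [← c.sub_comp_str hθ]
  infer_instance

end SNCChart

end Strata

/-! ### Subsets on which the two invariants agree -/

section Compatible

variable {O : Type u} [CommRing O] [IsDomain O] [IsDiscreteValuationRing O]
variable {X Y : Scheme.{u}} {f : X ⟶ Spec (CommRingCat.of O)} {b : Y ⟶ X}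

/-- A subset of the special fibre whose invariant agrees with the one of its preimage. -/
structure IsCompatible (f : X ⟶ Spec (CommRingCat.of O)) (b : Y ⟶ X)
    (C : Set (specialFiber f)) : Prop where
  hasClass : HasClass (specialFiberStr f) C
  hasClass_preimage : HasClass (specialFiberStr (b ≫ f)) (specialFiberMap b f ⁻¹' C)
  tildeS_eq : tildeS f C = tildeS (b ≫ f) (specialFiberMap b f ⁻¹' C)

theorem tildeS_empty [TopologicalSpace.NoetherianSpace (specialFiber f)] :
    tildeS f (∅ : Set (specialFiber f)) = 0 := by
  rw [tildeS_of_mults_eq hasClass_empty (m := 0) (by simp), classOf_empty, mul_zero]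

theorem tildeS_biUnion [TopologicalSpace.NoetherianSpace (specialFiber f)] {κ : Type*}
    {E : κ → Set (specialFiber f)} (s : Finset κ)
    (h : ∀ i ∈ s, HasClass (specialFiberStr f) (E i))
    (hd : ∀ i ∈ s, ∀ j ∈ s, i ≠ j → Disjoint (E i) (E j)) :
    tildeS f (⋃ i ∈ s, E i) = ∑ i ∈ s, tildeS f (E i) := by
  classical
  induction s using Finset.induction_on with
  | empty => simpa using tildeS_empty
  | insert a s ha ih =>
    have h1 := (hasClass_biUnion s (fun i hi ↦ h i (by simp [hi]))
      (fun i hi j hj ↦ hd i (by simp [hi]) j (by simp [hj]))).1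
    rw [Finset.set_biUnion_insert, tildeS_union (h a (by simp)) h1, Finset.sum_insert ha,
      ih (fun i hi ↦ h i (by simp [hi])) (fun i hi j hj ↦ hd i (by simp [hi]) j (by simp [hj]))]
    rw [Set.disjoint_iUnion₂_right]
    intro i hi
    exact hd a (by simp) i (by simp [hi]) (by rintro rfl; exact ha hi)

variable [TopologicalSpace.NoetherianSpace (specialFiber f)]
  [TopologicalSpace.NoetherianSpace (specialFiber (b ≫ f))]

theorem IsCompatible.empty : IsCompatible f b ∅ where
  hasClass := hasClass_empty
  hasClass_preimage := hasClass_empty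
  tildeS_eq := by rw [Set.preimage_empty, tildeS_empty, tildeS_empty]

theorem IsCompatible.union {C D : Set (specialFiber f)} (hC : IsCompatible f b C)
    (hD : IsCompatible f b D) (h : Disjoint C D) : IsCompatible f b (C ∪ D) where
  hasClass := hC.hasClass.union hD.hasClass h
  hasClass_preimage := hC.hasClass_preimage.union hD.hasClass_preimage (h.preimage _)
  tildeS_eq := by
    rw [tildeS_union hC.hasClass hD.hasClass h, Set.preimage_union,
      tildeS_union hC.hasClass_preimage hD.hasClass_preimage (h.preimage _), hC.tildeS_eq,
      hD.tildeS_eq]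

theorem IsCompatible.biUnion {κ : Type*} {E : κ → Set (specialFiber f)} (s : Finset κ)
    (h : ∀ i ∈ s, IsCompatible f b (E i))
    (hd : ∀ i ∈ s, ∀ j ∈ s, i ≠ j → Disjoint (E i) (E j)) :
    IsCompatible f b (⋃ i ∈ s, E i) := by
  classical
  induction s using Finset.induction_on with
  | empty => simpa using IsCompatible.empty
  | insert a s ha ih =>
    rw [Finset.set_biUnion_insert]
    refine (h a (by simp)).union
      (ih (fun i hi ↦ h i (by simp [hi])) (fun i hi j hj ↦ hd i (by simp [hi]) j (by simp [hj]))) ?_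
    rw [Set.disjoint_iUnion₂_right]
    intro i hi
    exact hd a (by simp) i (by simp [hi]) (by rintro rfl; exact ha hi)

/-- Compatibility can be checked on the subsets of a chart that meet a fixed set of coordinate
hyperplanes. -/
theorem SNCChart.isCompatible_of_strata [LocallyOfFiniteType f] {ϖ : O} (c : SNCChart f ϖ)
    {R : Type u} [CommRing R] [Algebra (IsLocalRing.ResidueField O) R] {θ : c.A →+* R}
    (hθ : ∀ o, θ (c.α o) = algebraMap _ R (IsLocalRing.residue O o))
    (hs : Function.Surjective θ)
    (H : ∀ (E : Set (Spec (CommRingCat.of R))) (H : Finset (Fin c.n)),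
      HasClass (specStr (IsLocalRing.ResidueField O) R) E →
      (∀ r ∈ E, ∀ v, v ∈ H ↔ v ∈ c.V ∧ θ (c.x v) ∈ pt r) → IsCompatible f b (c.sub hθ '' E))
    {C : Set (specialFiber f)} (hC : Topology.IsConstructible C)
    (hCs : C ⊆ Set.range (c.sub hθ)) : IsCompatible f b C := by
  classical
  have := c.finiteType_sub hθ hs
  have : TopologicalSpace.NoetherianSpace (Spec (CommRingCat.of R)) :=
    noetherianSpace_of_locallyOfFiniteType (specStr (IsLocalRing.ResidueField O) R)
  have := c.isImmersion_sub hθ hs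
  -- The part of C where, among the x_v with v ∈ V, exactly those with v ∈ H vanish. These parts
  -- partition C as H runs over the subsets of V.
  let E : Finset (Fin c.n) → Set (Spec (CommRingCat.of R)) := fun H ↦
    {r | c.sub hθ r ∈ C ∧ ∀ v, v ∈ H ↔ v ∈ c.V ∧ θ (c.x v) ∈ pt r}
  have hclosed : ∀ v, IsClosed {r : Spec (CommRingCat.of R) | θ (c.x v) ∈ pt r} := by
    intro v
    have h1 : {r : Spec (CommRingCat.of R) | θ (c.x v) ∈ pt r} =
        (PrimeSpectrum.zeroLocus ({θ (c.x v)} : Set R) : Set (PrimeSpectrum R)) :=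
      Set.ext fun r ↦ (Set.singleton_subset_iff (a := θ (c.x v)) (s := (pt r : Set R))).symm
    rw [h1]
    exact PrimeSpectrum.isClosed_zeroLocus ({θ (c.x v)} : Set R)
  have hE : ∀ H ∈ c.V.powerset, HasClass (specStr (IsLocalRing.ResidueField O) R) (E H) := by
    intro H hH
    have h1 : E H = c.sub hθ ⁻¹' C ∩ ⋂ v ∈ c.V,
        (if v ∈ H then {r | θ (c.x v) ∈ pt r} else {r | θ (c.x v) ∈ pt r}ᶜ) := by
      ext r
      simp only [E, Set.mem_ofPred_eq, Set.mem_inter_iff, Set.mem_preimage, Set.mem_iInter]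
      refine and_congr_right fun _ ↦ ⟨fun h v hv ↦ ?_, fun h v ↦ ⟨fun hvH ↦ ?_, fun hv ↦ ?_⟩⟩
      · split_ifs with hvH
        · exact ((h v).mp hvH).2
        · exact fun hmem ↦ hvH ((h v).mpr ⟨hv, hmem⟩)
      · have hvV := Finset.mem_powerset.mp hH hvH
        have := h v hvV
        rw [if_pos hvH] at this
        exact ⟨hvV, this⟩
      · by_contra hvH
        have := h v hv.1
        rw [if_neg hvH] at this
        exact this hv.2
    rw [h1]
    refine (IsClassTest.biInter c.V (fun v _ ↦ ?_) _ (hasClass_of_isConstructible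
      (isConstructible_preimage (c.sub hθ).continuous hC))).1
    split_ifs
    · exact isClassTest_of_isClosed (hclosed v)
    · exact (isClassTest_of_isClosed (hclosed v)).compl
  have hCE : C = ⋃ H ∈ c.V.powerset, c.sub hθ '' E H := by
    ext p
    simp only [Set.mem_iUnion]
    constructor
    · intro hp
      obtain ⟨r, rfl⟩ := hCs hp
      exact ⟨c.V.filter fun v ↦ θ (c.x v) ∈ pt r, by simp, r, ⟨hp, by simp⟩, rfl⟩
    · rintro ⟨H, hH, r, hr, rfl⟩
      exact hr.1
  rw [hCE]
  refine IsCompatible.biUnion _ (fun H' hH' ↦ H _ H' (hE H' hH') fun r hr ↦ hr.2) ?_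
  intro H₁ _ H₂ _ hne
  rw [Set.disjoint_left]
  rintro _ ⟨r₁, h₁, rfl⟩ ⟨r₂, h₂, h⟩
  have := (c.sub hθ).isEmbedding.injective h
  subst this
  exact hne (Finset.ext fun v ↦ (h₁.2 v).trans (h₂.2 v).symm)

end Compatible


/-! ### The blowup away from the center -/

section Center

variable {X Y : Scheme.{u}} {b : Y ⟶ X} {I : X.IdealSheafData}

theorem idealOn_eq_top_iff {A : Type u} [CommRing A] {φ : Spec (CommRingCat.of A) ⟶ X} :
    idealOn I φ = ⊤ ↔ I.comap φ = ⊤ := by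
  have h : topIdeal (⊤ : (Spec (CommRingCat.of A)).IdealSheafData) = ⊤ := rfl
  rw [idealOn]
  refine ⟨fun h' ↦ top_le_iff.mp (topIdeal_le_topIdeal.mp ?_), fun h' ↦ h' ▸ h⟩
  rw [h']
  exact le_top

/-- Away from the center, the blowup is an isomorphism. -/
theorem IsIdealBlowup.exists_chart_of_eq_top (hb : IsIdealBlowup b I) {A : Type u} [CommRing A]
    {φ : Spec (CommRingCat.of A) ⟶ X} [IsOpenImmersion φ] (hI : idealOn I φ = ⊤) :
    ∃ h : Spec (CommRingCat.of A) ⟶ Y, IsOpenImmersion h ∧ h ≫ b = φ ∧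
      ∀ y, b y ∈ Set.range φ → y ∈ Set.range h := by
  have hcart : ∀ {T : Scheme.{u}} {g : T ⟶ X}, I.comap g = ⊤ → IsCartier (I.comap g) := by
    intro T g hg t
    obtain ⟨U, hU, ht, -⟩ := exists_isAffineOpen_mem_and_subset (TopologicalSpace.Opens.mem_top t)
    refine ⟨⟨U, hU⟩, ht, 1, one_mem _, ?_⟩
    rw [hg, Ideal.span_singleton_one]
    rfl
  have hφ := idealOn_eq_top_iff.mp hI
  obtain ⟨h, hh, -⟩ := hb.universal _ φ (hcart hφ)
  let N := b ⁻¹ᵁ φ.opensRange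
  have hN : Set.range (N.ι ≫ b) ⊆ Set.range φ := by
    rintro _ ⟨y, rfl⟩
    exact y.2
  let ρ := IsOpenImmersion.lift φ (N.ι ≫ b) hN
  have hρ : ρ ≫ φ = N.ι ≫ b := IsOpenImmersion.lift_fac _ _ _
  -- Both morphisms lie over the same morphism to X, along which the ideal becomes the unit ideal,
  -- so the universal property identifies them.
  have hρh : ρ ≫ h = N.ι := by
    refine (hb.universal _ (N.ι ≫ b) (hcart ?_)).unique ?_ rfl
    · rw [← hρ, Scheme.IdealSheafData.comap_comp, hφ, Scheme.IdealSheafData.comap_top]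
    · rw [Category.assoc, hh, hρ]
  have hhN : Set.range h ⊆ Set.range N.ι := by
    rintro _ ⟨r, rfl⟩
    rw [Scheme.Opens.range_ι]
    change b (h r) ∈ Set.range φ
    rw [← Scheme.Hom.comp_apply, hh]
    exact ⟨r, rfl⟩
  let m := IsOpenImmersion.lift N.ι h hhN
  have hm : m ≫ N.ι = h := IsOpenImmersion.lift_fac _ _ _
  have hmρ : m ≫ ρ = 𝟙 _ := by
    rw [← cancel_mono φ, Category.assoc, hρ, ← Category.assoc, hm, hh, Category.id_comp]
  refine ⟨h, isOpenImmersion_of_local_sections h ?_ fun r ↦ ?_, hh, fun y hy ↦ ?_⟩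
  · intro r r' hr
    apply φ.isOpenEmbedding.injective
    rw [← hh, Scheme.Hom.comp_apply, Scheme.Hom.comp_apply, hr]
  · exact ⟨N, _, N.ι, inferInstance, ρ, 𝟙 _, inferInstance, m, hρh, hmρ, r, rfl⟩
  · let y' : N := ⟨y, hy⟩
    refine ⟨ρ y', ?_⟩
    exact congrArg (fun e : (N : Scheme) ⟶ Y ↦ e y') hρh

theorem le_pt_of_mem_range {Z : Scheme.{u}} (i : Z ⟶ X) [IsClosedImmersion i] {A : Type u}
    [CommRing A] {φ : Spec (CommRingCat.of A) ⟶ X} {q : Spec (CommRingCat.of A)}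
    (h : φ q ∈ Set.range i) : idealOn i.ker φ ≤ pt q := by
  have h1 : q ∈ (i.ker.comap φ).support := by
    rw [Scheme.IdealSheafData.support_comap]
    exact i.range_subset_ker_support h
  rw [Scheme.IdealSheafData.mem_support_iff] at h1
  have h2 := h1 ⟨⊤, isAffineOpen_top _⟩
  rw [Scheme.mem_zeroLocus_iff] at h2
  intro a ha
  by_contra haq
  refine h2 _ ha ?_
  change q ∈ (Spec (CommRingCat.of A)).basicOpen ((Scheme.ΓSpecIso (CommRingCat.of A)).inv a)
  rw [basicOpen_eq_of_affine]
  exact haq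

end Center

/-! ### Monomial charts on the blowup -/

section Charts

variable {O : Type u} [CommRing O] [IsDomain O] [IsDiscreteValuationRing O]
variable {X Y : Scheme.{u}} {f : X ⟶ Spec (CommRingCat.of O)} {b : Y ⟶ X} {ϖ : O}

/-- The center factors through the special fibre, where ϖ vanishes. This is what forces V ∩ W to be
nonempty. -/
theorem mem_idealOn_of_comp {Z : Scheme.{u}} (j : Z ⟶ specialFiber f)
    [IsClosedImmersion j]
    (hϖ : Ideal.span {ϖ} = IsLocalRing.maximalIdeal O) (c : SNCChart f ϖ) :
    c.α ϖ ∈ idealOn (j ≫ specialFiberIncl f).ker c.φ := by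
  obtain ⟨I, hI⟩ := exists_topIdeal_eq (Ideal.span {ϖ})
  have h1 : (j ≫ specialFiberIncl f) ≫ f =
      (j ≫ specialFiberStr f) ≫ specMap (IsLocalRing.residue O) := by
    rw [Category.assoc, Category.assoc]
    exact congrArg (j ≫ ·) pullback.condition
  have h2 : I.comap (specMap (IsLocalRing.residue O)) = ⊥ := by
    rw [eq_bot_iff, ← topIdeal_le_topIdeal, topIdeal_comap, hI, hϖ, Ideal.map_le_iff_le_comap]
    intro a ha
    have : IsLocalRing.residue O a = 0 := (IsLocalRing.residue_eq_zero_iff a).mpr ha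
    rw [Ideal.mem_comap, this]
    exact zero_mem _
  have h3 : I.comap f ≤ (j ≫ specialFiberIncl f).ker := by
    rw [← Scheme.IdealSheafData.map_bot, Scheme.IdealSheafData.le_map_iff_comap_le,
      ← Scheme.IdealSheafData.comap_comp, h1, Scheme.IdealSheafData.comap_comp, h2,
      Scheme.IdealSheafData.comap_bot]
  have h4 := topIdeal_le_topIdeal.mpr ((Scheme.IdealSheafData.map_gc c.φ).monotone_l h3)
  refine h4 ?_
  rw [← Scheme.IdealSheafData.comap_comp, c.φ_comp, topIdeal_comap, hI]
  exact Ideal.mem_map_of_mem _ (Ideal.mem_span_singleton_self ϖ)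

namespace SNCChart

/-- A chart viewed on a scheme over `X`. -/
def transport (c : SNCChart f ϖ) (h : Spec (CommRingCat.of c.A) ⟶ Y) [IsOpenImmersion h]
    (hh : h ≫ b = c.φ) : SNCChart (b ≫ f) ϖ where
  A := c.A
  α := c.α
  φ := h
  φ_comp := by rw [← Category.assoc, hh, c.φ_comp]
  n := c.n
  x := c.x
  strict := c.strict
  V := c.V
  a := c.a
  one_le := c.one_le
  span_eq := c.span_eq

variable (c : SNCChart f ϖ) (W : Finset (Fin c.n)) (s : Fin c.n)

/-- The multiplicity of the exceptional divisor. -/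
def excMult : ℕ := ∑ v ∈ c.V ∩ W, c.a v

/-- Writing x_v = x_s · (x_v/x_s) for v ∈ W collects the exponents a_v, v ∈ V ∩ W, on x_s; the
factor v = s, if present, contributes to this power only. -/
theorem map_prod_eq (hs : s ∈ W) :
    algebraMap c.A (blowupRing c.x W s) (∏ v ∈ c.V, c.x v ^ c.a v) =
      ∏ v ∈ insert s c.V, blowupSystem c.x W s v ^ Function.update c.a s (c.excMult W) v := by
  have h1 : ∀ v ∈ c.V, algebraMap c.A (blowupRing c.x W s) (c.x v ^ c.a v) =
      (if v ∈ W then blowupSystem c.x W s s ^ c.a v else 1) *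
        (if v = s then 1 else blowupSystem c.x W s v ^ c.a v) := by
    intro v hv
    have hss : blowupSystem c.x W s s = algebraMap c.A _ (c.x s) :=
      blowupSystem_of_notMem (by simp)
    by_cases hvs : v = s
    · subst hvs
      rw [if_pos hs, if_pos rfl, mul_one, hss, map_pow]
    · by_cases hvW : v ∈ W
      · rw [if_pos hvW, if_neg hvs, hss, map_pow, algebraMap_eq_mul_blowupCoord hvW, mul_pow,
          blowupSystem_of_mem ⟨hvW, hvs⟩]
      · rw [if_neg hvW, if_neg hvs, one_mul, map_pow, blowupSystem_of_notMem (by tauto)]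
  rw [map_prod, Finset.prod_congr rfl h1, Finset.prod_mul_distrib,
    ← Finset.insert_erase (Finset.mem_insert_self s c.V),
    Finset.prod_insert (Finset.notMem_erase _ _), Function.update_self]
  congr 1
  · rw [← Finset.prod_filter, Finset.filter_mem_eq_inter, Finset.prod_pow_eq_pow_sum, excMult]
  · rw [Finset.erase_insert_eq_erase]
    symm
    refine Finset.prod_subset_one_on_sdiff (Finset.erase_subset _ _) ?_ ?_
    · intro v hv
      rw [if_pos]
      simp only [Finset.mem_sdiff, Finset.mem_erase, not_and_or, not_not] at hv
      tauto
    · intro v hv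
      rw [if_neg (Finset.ne_of_mem_erase hv), Function.update_of_ne (Finset.ne_of_mem_erase hv)]

/-- A chart of the blowup. -/
noncomputable def blowup (hs : s ∈ W) (hVW : (c.V ∩ W).Nonempty)
    (h : Spec (CommRingCat.of (blowupRing c.x W s)) ⟶ Y) [IsOpenImmersion h]
    (hh : h ≫ b = specMap (algebraMap c.A (blowupRing c.x W s)) ≫ c.φ) :
    SNCChart (b ≫ f) ϖ where
  A := blowupRing c.x W s
  α := (algebraMap c.A (blowupRing c.x W s)).comp c.α
  φ := h
  φ_comp := by rw [← Category.assoc, hh, Category.assoc, c.φ_comp, specMap_comp]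
  n := c.n
  x := blowupSystem c.x W s
  strict := c.strict.blowupSystem
  -- On this chart x_s defines the exceptional divisor, which lies in the special fibre whether or
  -- not s ∈ V, because V ∩ W is nonempty.
  V := insert s c.V
  a := Function.update c.a s (c.excMult W)
  one_le := by
    intro v hv
    by_cases hvs : v = s
    · subst hvs
      rw [Function.update_self]
      obtain ⟨w, hw⟩ := hVW
      exact (c.one_le w (Finset.mem_inter.mp hw).1).trans
        (Finset.single_le_sum (f := c.a) (fun _ _ ↦ Nat.zero_le _) hw)
    · rw [Function.update_of_ne hvs]
      exact c.one_le v (Finset.mem_of_mem_insert_of_ne hv hvs)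
  span_eq := by
    have h1 := congrArg (Ideal.map (algebraMap c.A (blowupRing c.x W s))) c.span_eq
    rw [Ideal.map_span, Ideal.map_span, Set.image_singleton, Set.image_singleton,
      c.map_prod_eq W s hs] at h1
    exact h1

/-- The x_w, w ∈ W, generate a prime ideal. It contains ϖ, hence some x_v with v ∈ V, and strictness
gives v ∈ W. -/
theorem inter_nonempty_of_mem (h : c.α ϖ ∈ Ideal.span (c.x '' W)) : (c.V ∩ W).Nonempty := by
  have := (c.strict W).1
  obtain ⟨v, hv, hx⟩ := c.exists_mem_of_mem h
  refine ⟨v, Finset.mem_inter.mpr ⟨hv, ?_⟩⟩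
  by_contra hvW
  exact (c.strict W).2 v hvW hx

end SNCChart

end Charts


/-! ### Compatibility away from the center -/

section Compatibility

variable {O : Type u} [CommRing O] [IsDomain O] [IsDiscreteValuationRing O]
variable {X Y : Scheme.{u}} {f : X ⟶ Spec (CommRingCat.of O)} {b : Y ⟶ X} {ϖ : O}

theorem incl_specialFiberMap (y : specialFiber (b ≫ f)) :
    specialFiberIncl f (specialFiberMap b f y) = b (specialFiberIncl (b ≫ f) y) := by
  have : specialFiberMap b f ≫ specialFiberIncl f = specialFiberIncl (b ≫ f) ≫ b :=
    pullback.lift_fst _ _ _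
  rw [← Scheme.Hom.comp_apply, this, Scheme.Hom.comp_apply]

/-- The image of t in Y is a finite union of images of subsets of noetherian spectra, and every
subset of a noetherian space is compact. -/
theorem isCompact_of_subset_charts {T : Scheme.{u}} (e : T ⟶ Y) [IsClosedImmersion e] {κ : Type*}
    [Finite κ] {B : κ → Type u} [∀ i, CommRing (B i)] [∀ i, IsNoetherianRing (B i)]
    (h : ∀ i, Spec (CommRingCat.of (B i)) ⟶ Y) {t : Set T}
    (ht : ∀ p ∈ t, ∃ i, e p ∈ Set.range (h i)) : IsCompact t := by
  rw [e.isEmbedding.isInducing.isCompact_iff]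
  have h1 : e '' t = ⋃ i, h i '' (h i ⁻¹' (e '' t)) := by
    ext y
    simp only [Set.mem_iUnion]
    constructor
    · rintro ⟨p, hp, rfl⟩
      obtain ⟨i, r, hr⟩ := ht p hp
      exact ⟨i, r, ⟨p, hp, hr.symm⟩, hr⟩
    · rintro ⟨i, r, hr, rfl⟩
      exact hr
  rw [h1]
  refine isCompact_iUnion fun i ↦ ?_
  have : TopologicalSpace.NoetherianSpace (Spec (CommRingCat.of (B i))) :=
    inferInstanceAs (TopologicalSpace.NoetherianSpace (PrimeSpectrum (B i)))
  exact (TopologicalSpace.NoetherianSpace.isCompact _).image (h i).continuous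

namespace SNCChart

variable (c : SNCChart f ϖ)

theorem isNoetherianRing (hf : IsSNCModel f) : IsNoetherianRing c.A := by
  have := hf.isLocallyNoetherian
  have := isLocallyNoetherian_of_isOpenImmersion c.φ
  exact isLocallyNoetherian_Spec.mp this

theorem exists_algebra (hϖ : Ideal.span {ϖ} = IsLocalRing.maximalIdeal O) {J : Ideal c.A}
    (hJ : c.α ϖ ∈ J) : ∃ _ : Algebra (IsLocalRing.ResidueField O) (c.A ⧸ J),
      ∀ o, Ideal.Quotient.mk J (c.α o) = algebraMap _ (c.A ⧸ J) (IsLocalRing.residue O o) := by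
  refine ⟨RingHom.toAlgebra (R := IsLocalRing.ResidueField O) (S := c.A ⧸ J)
    (Ideal.Quotient.lift (IsLocalRing.maximalIdeal O)
    ((Ideal.Quotient.mk J).comp c.α) fun o ho ↦ ?_), fun o ↦ rfl⟩
  rw [← hϖ] at ho
  obtain ⟨o, rfl⟩ := Ideal.mem_span_singleton'.mp ho
  rw [RingHom.comp_apply, map_mul, Ideal.Quotient.eq_zero_iff_mem]
  exact Ideal.mul_mem_left _ _ hJ

/-- Compatibility away from the center. -/
theorem isCompatible_of_eq_top [LocallyOfFiniteType f]
    [TopologicalSpace.NoetherianSpace (specialFiber f)]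
    [TopologicalSpace.NoetherianSpace (specialFiber (b ≫ f))]
    (hϖ : Ideal.span {ϖ} = IsLocalRing.maximalIdeal O) {I : X.IdealSheafData}
    (hb : IsIdealBlowup b I) (hI : idealOn I c.φ = ⊤) {C : Set (specialFiber f)}
    (hC : Topology.IsConstructible C) (hCs : ∀ p ∈ C, specialFiberIncl f p ∈ Set.range c.φ) :
    IsCompatible f b C := by
  obtain ⟨h, hopen, hh, hrange⟩ := hb.exists_chart_of_eq_top hI
  let J := Ideal.span {c.α ϖ}
  obtain ⟨_, hθ⟩ := c.exists_algebra hϖ (Ideal.mem_span_singleton_self (c.α ϖ))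
  have hs : Function.Surjective (Ideal.Quotient.mk J) := Ideal.Quotient.mk_surjective
  let c' : SNCChart (b ≫ f) ϖ := c.transport h hh
  let θ' : c'.A →+* c.A ⧸ J := Ideal.Quotient.mk J
  have hθ' : ∀ o, θ' (c'.α o) = algebraMap _ (c.A ⧸ J) (IsLocalRing.residue O o) := hθ
  have hs' : Function.Surjective θ' := hs
  have hincl : ∀ r, specialFiberIncl (b ≫ f) (c'.sub hθ' r) =
      h (specMap (Ideal.Quotient.mk J) r) := c'.incl_sub_apply hθ'
  have key : ∀ r, specialFiberMap b f (c'.sub hθ' r) = c.sub hθ r := fun r ↦ by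
    apply eq_of_specialFiberIncl_eq
    rw [incl_specialFiberMap, hincl, incl_sub_apply, ← Scheme.Hom.comp_apply, hh]
  refine c.isCompatible_of_strata hθ hs (fun E H hE hH ↦ ?_) hC fun p hp ↦ ?_
  · have h1 : specialFiberMap b f ⁻¹' (c.sub hθ '' E) = c'.sub hθ' '' E := by
      ext y
      constructor
      · rintro ⟨r, hr, hy⟩
        refine ⟨r, hr, eq_of_specialFiberIncl_eq ?_⟩
        have h2 := congrArg (specialFiberIncl f) hy
        rw [incl_specialFiberMap, incl_sub_apply] at h2
        obtain ⟨q, hq⟩ := hrange (specialFiberIncl (b ≫ f) y) (h2 ▸ ⟨_, rfl⟩)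
        rw [hincl, ← hq]
        congr 1
        apply c.φ.isOpenEmbedding.injective
        refine h2.trans ?_
        rw [← hq, ← Scheme.Hom.comp_apply, hh]
      · rintro ⟨r, hr, rfl⟩
        exact ⟨r, hr, (key r).symm⟩
    refine ⟨(hasClass_sub_image hθ hs hE).1, h1 ▸ (hasClass_sub_image (c := c') hθ' hs' hE).1, ?_⟩
    -- The transported chart has the same coordinates and exponents, hence the same weight, and the
    -- same E parametrizes both sides.
    rw [h1, c.tildeS_sub_image hθ hϖ hs hE H hH, c'.tildeS_sub_image hθ' hϖ hs' hE H hH]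
    rfl
  · obtain ⟨q, hq⟩ := hCs p hp
    obtain ⟨r, hr, -⟩ := c.mem_range_sub hθ hs hq.symm (by
      rw [Ideal.mk_ker]
      exact (Ideal.span_singleton_le_iff_mem _).mpr (c.mem_of_specialFiber hϖ hq.symm))
    exact ⟨r, hr⟩

end SNCChart

end Compatibility


/-! ### The exceptional divisor as an affine space over the center -/

section Exceptional

variable {A : Type u} [CommRing A] {ι : Type} (x : ι → A) (W : Finset ι)

theorem span_image_eq_insert {s : ι} (hs : s ∈ W) : Ideal.span (x '' W) =
    Ideal.span (insert (x s) (Set.range fun w : {w // w ∈ W ∧ w ≠ s} ↦ x w)) := by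
  congr 1
  ext a
  simp only [Set.mem_image, Set.mem_insert_iff, Set.mem_range, Subtype.exists, Finset.mem_coe]
  constructor
  · rintro ⟨w, hw, rfl⟩
    by_cases h : w = s
    · exact Or.inl (h ▸ rfl)
    · exact Or.inr ⟨w, ⟨hw, h⟩, rfl⟩
  · rintro (rfl | ⟨w, hw, rfl⟩)
    · exact ⟨s, hs, rfl⟩
    · exact ⟨w, hw.1, rfl⟩

/-- The restriction from a chart of the blowup to the exceptional divisor. -/
noncomputable def excHom {s : ι} (hs : s ∈ W) : blowupRing x W s →+*
    MvPolynomial {w // w ∈ W ∧ w ≠ s} (A ⧸ Ideal.span (x '' W)) :=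
  chartRing.toPoly _ _ _ (span_image_eq_insert x W hs)

variable {W} {s : ι} (hs : s ∈ W)

theorem excHom_surjective : Function.Surjective (excHom x W hs) :=
  chartRing.toPoly_surjective _ _ _

theorem excHom_algebraMap (a : A) :
    excHom x W hs (algebraMap A _ a) = MvPolynomial.C (Ideal.Quotient.mk _ a) :=
  chartRing.toPoly_algebraMap _ _ _ a

theorem ker_excHom :
    RingHom.ker (excHom x W hs) = Ideal.span {algebraMap A (blowupRing x W s) (x s)} :=
  chartRing.ker_toPoly _ _ _

theorem excHom_blowupCoord {w : ι} (hw : w ∈ W ∧ w ≠ s) :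
    excHom x W hs (blowupCoord x W s w) = MvPolynomial.X ⟨w, hw⟩ := by
  rw [blowupCoord_of_mem hw]
  exact chartRing.toPoly_t _ _ _ _

theorem mk_eq_zero {w : ι} (hw : w ∈ W) :
    Ideal.Quotient.mk (Ideal.span (x '' (W : Set ι))) (x w) = 0 :=
  Ideal.Quotient.eq_zero_iff_mem.mpr (Ideal.subset_span ⟨w, hw, rfl⟩)

/-- The exponent is |T| - 1 because the coordinate of s is normalized to 1 and is not a variable of
the chart. -/
theorem prod_eq_pow [DecidableEq ι] {R : Type*} [CommRing R] {L : R}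
    [Fintype {w // w ∈ W ∧ w ≠ s}] {T : Finset ι} (hT : T ⊆ W) (hsT : s ∈ T)
    {g : {w // w ∈ W ∧ w ≠ s} → R} (h₁ : ∀ w, w.1 ∈ T → g w = L) (h₂ : ∀ w, w.1 ∉ T → g w = 1) :
    ∏ w, g w = L ^ (T.card - 1) := by
  have h : ∀ w, g w = if w.1 ∈ T then L else 1 := fun w ↦ by
    split_ifs with hw
    exacts [h₁ w hw, h₂ w hw]
  rw [Finset.prod_congr rfl fun w _ ↦ h w, Finset.prod_ite, Finset.prod_const,
    Finset.prod_const_one, mul_one]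
  congr 1
  rw [← Finset.card_erase_of_mem hsT, ← Finset.card_map (Function.Embedding.subtype _)]
  congr 1
  ext w
  simp only [Finset.mem_map, Finset.mem_filter, Finset.mem_univ, true_and,
    Function.Embedding.subtype_apply, Subtype.exists, exists_and_left, Finset.mem_erase]
  constructor
  · rintro ⟨w, h1, h2, rfl⟩
    exact ⟨h2.2, h1⟩
  · rintro ⟨h1, h2⟩
    exact ⟨w, h2, ⟨hT h2, h1⟩, rfl⟩

end Exceptional

/-! ### Strata of the exceptional divisor -/

section Center

variable {O : Type u} [CommRing O] [IsDomain O] [IsDiscreteValuationRing O]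
variable {X Y : Scheme.{u}} {f : X ⟶ Spec (CommRingCat.of O)} {b : Y ⟶ X} {ϖ : O}

namespace SNCChart

variable (c : SNCChart f ϖ) {W : Finset (Fin c.n)}
  [Algebra (IsLocalRing.ResidueField O) (c.A ⧸ Ideal.span (c.x '' W))]

theorem excHom_condition
    (hθ : ∀ o, Ideal.Quotient.mk (Ideal.span (c.x '' W)) (c.α o) =
      algebraMap _ _ (IsLocalRing.residue O o))
    {s : Fin c.n} (hs : s ∈ W) (hVW : (c.V ∩ W).Nonempty)
    (h : Spec (CommRingCat.of (blowupRing c.x W s)) ⟶ Y) [IsOpenImmersion h]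
    (hh : h ≫ b = specMap (algebraMap c.A (blowupRing c.x W s)) ≫ c.φ) (o : O) :
    excHom c.x W hs ((c.blowup W s hs hVW h hh).α o) =
    algebraMap (IsLocalRing.ResidueField O) (MvPolynomial {w // w ∈ W ∧ w ≠ s}
      (c.A ⧸ Ideal.span (c.x '' W))) (IsLocalRing.residue O o) := by
  rw [MvPolynomial.algebraMap_apply, ← hθ]
  exact excHom_algebraMap c.x hs (c.α o)

variable (hθ : ∀ o, Ideal.Quotient.mk (Ideal.span (c.x '' W)) (c.α o) =
    algebraMap _ _ (IsLocalRing.residue O o))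
  {s : Fin c.n} (hs : s ∈ W) (hVW : (c.V ∩ W).Nonempty)
  (h : Spec (CommRingCat.of (blowupRing c.x W s)) ⟶ Y) [IsOpenImmersion h]
  (hh : h ≫ b = specMap (algebraMap c.A (blowupRing c.x W s)) ≫ c.φ)

/-- The exceptional divisor of a chart of the blowup. -/
noncomputable def exc : Spec (CommRingCat.of (MvPolynomial {w // w ∈ W ∧ w ≠ s}
    (c.A ⧸ Ideal.span (c.x '' W)))) ⟶ specialFiber (b ≫ f) :=
  (c.blowup W s hs hVW h hh).sub (θ := excHom c.x W hs) (c.excHom_condition hθ hs hVW h hh)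

theorem incl_exc_apply (r : Spec (CommRingCat.of (MvPolynomial {w // w ∈ W ∧ w ≠ s}
    (c.A ⧸ Ideal.span (c.x '' W))))) : specialFiberIncl (b ≫ f) (c.exc hθ hs hVW h hh r) =
      h (specMap (excHom c.x W hs) r) :=
  (c.blowup W s hs hVW h hh).incl_sub_apply (c.excHom_condition hθ hs hVW h hh) r

theorem exc_map_apply (r : Spec (CommRingCat.of (MvPolynomial {w // w ∈ W ∧ w ≠ s}
    (c.A ⧸ Ideal.span (c.x '' W))))) : specialFiberMap b f (c.exc hθ hs hVW h hh r) =
      c.sub hθ (specMap MvPolynomial.C r) := by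
  apply eq_of_specialFiberIncl_eq
  rw [incl_specialFiberMap, incl_exc_apply, incl_sub_apply, ← Scheme.Hom.comp_apply, hh,
    Scheme.Hom.comp_apply, specMap_specMap, specMap_specMap]
  have e : (excHom c.x W hs).comp (algebraMap c.A (blowupRing c.x W s)) =
      MvPolynomial.C.comp (Ideal.Quotient.mk (Ideal.span (c.x '' W))) :=
    RingHom.ext fun a ↦ excHom_algebraMap c.x hs a
  rw [e]

theorem exists_exc_eq {y : specialFiber (b ≫ f)}
    {q : Spec (CommRingCat.of (blowupRing c.x W s))} (hy : specialFiberIncl (b ≫ f) y = h q)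
    (hq : algebraMap c.A (blowupRing c.x W s) (c.x s) ∈ pt q) :
    ∃ r, c.exc hθ hs hVW h hh r = y ∧ specMap (excHom c.x W hs) r = q := by
  have hker : RingHom.ker (excHom c.x W hs) ≤ pt q := by
    rwa [ker_excHom, Ideal.span_singleton_le_iff_mem]
  exact (c.blowup W s hs hVW h hh).mem_range_sub (c.excHom_condition hθ hs hVW h hh)
    (excHom_surjective c.x hs) hy hker

/-- The strata of the exceptional divisor over a stratum of the center. -/
theorem exc_image_class [LocallyOfFiniteType f]
    [TopologicalSpace.NoetherianSpace (specialFiber (b ≫ f))]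
    (hϖ : Ideal.span {ϖ} = IsLocalRing.maximalIdeal O)
    {E : Set (Spec (CommRingCat.of (c.A ⧸ Ideal.span (c.x '' W))))}
    (hE : HasClass (specStr (IsLocalRing.ResidueField O) _) E) {H : Finset (Fin c.n)}
    (hH : ∀ r ∈ E, ∀ v, v ∈ H ↔ v ∈ c.V ∧ Ideal.Quotient.mk _ (c.x v) ∈ pt r)
    {T : Finset (Fin c.n)} (hT : T ⊆ W) (hsT : s ∈ T) :
    HasClass (specialFiberStr (b ≫ f)) (c.exc hθ hs hVW h hh '' torusCell {w | w.1 ∈ T} E) ∧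
      tildeS (b ≫ f) (c.exc hθ hs hVW h hh '' torusCell {w | w.1 ∈ T} E) =
        weight (IsLocalRing.ResidueField O) (c.excMult W ::ₘ (H \ T).val.map c.a) *
          (classOf (specStr (IsLocalRing.ResidueField O) _) E *
            (lefschetz (IsLocalRing.ResidueField O) - 1) ^ (T.card - 1)) := by
  classical
  have := Fintype.ofFinite {w // w ∈ W ∧ w ≠ s}
  obtain ⟨h1, h2⟩ := torusCell_class (IsLocalRing.ResidueField O) {w // w ∈ W ∧ w ≠ s} hE
    {w | w.1 ∈ T}
  replace h2 := h2.trans (congrArg (_ * ·) (prod_eq_pow hT hsT (fun w hw ↦ if_pos hw)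
    fun w hw ↦ if_neg hw))
  have hcond := c.excHom_condition hθ hs hVW h hh
  refine ⟨(hasClass_sub_image (c := c.blowup W s hs hVW h hh) hcond
    (excHom_surjective c.x hs) h1).1, ?_⟩
  -- On the cell x_s vanishes. For v ∈ W other than s, the strict transform t_v = 0 passes through
  -- the point exactly when v ∉ T, and the hyperplanes with v ∉ W are simply pulled back.
  have hpat : ∀ r ∈ torusCell {w : {w // w ∈ W ∧ w ≠ s} | w.1 ∈ T} E, ∀ v : Fin c.n,
      v ∈ insert s (H \ T) ↔
        v ∈ insert s c.V ∧ excHom c.x W hs (blowupSystem c.x W s v) ∈ pt r := by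
    intro r hr v
    obtain ⟨hr1, hr2⟩ := hr
    have hHv := hH _ hr1 v
    by_cases hvs : v = s
    · subst hvs
      rw [blowupSystem_of_notMem (by simp), excHom_algebraMap, mk_eq_zero c.x hs, map_zero]
      simp
    · rw [Finset.mem_insert, Finset.mem_insert, Finset.mem_sdiff, or_iff_right hvs,
        or_iff_right hvs]
      by_cases hvW : v ∈ W
      · rw [mk_eq_zero c.x hvW] at hHv
        rw [blowupSystem_of_mem ⟨hvW, hvs⟩, excHom_blowupCoord c.x hs ⟨hvW, hvs⟩, hHv]
        have h3 := hr2 ⟨v, hvW, hvs⟩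
        have h4 : (0 : c.A ⧸ Ideal.span (c.x '' (W : Set (Fin c.n)))) ∈
            pt (specMap MvPolynomial.C r) := zero_mem _
        simp only [Set.mem_ofPred_eq] at h3
        tauto
      · rw [blowupSystem_of_notMem (by tauto), excHom_algebraMap, hHv]
        have h3 : v ∉ T := fun h ↦ hvW (hT h)
        rw [and_iff_left h3]
        exact Iff.rfl
  refine ((c.blowup W s hs hVW h hh).tildeS_sub_image hcond hϖ (excHom_surjective c.x hs) h1
    (insert s (H \ T)) hpat).trans ?_
  -- As s ∈ T, the index s is free in H \ T and now stands for the exceptional divisor; the strict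
  -- transform of x_s = 0 does not meet this chart.
  have h3 : (insert s (H \ T)).val.map (Function.update c.a s (c.excMult W)) =
      c.excMult W ::ₘ (H \ T).val.map c.a := by
    have hsH : s ∉ H \ T := fun h ↦ (Finset.mem_sdiff.mp h).2 hsT
    rw [Finset.insert_val_of_notMem hsH, Multiset.map_cons, Function.update_self]
    congr 1
    refine Multiset.map_congr rfl fun v hv ↦ Function.update_of_ne ?_ _ _
    rintro rfl
    exact hsH hv
  rw [h2, ← h3]
  rfl

/-- The strata of the exceptional divisor in terms of the charts of the blowup. -/
theorem mem_exc_image_iff {I : X.IdealSheafData} (hb : IsIdealBlowup b I)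
    (hJ : idealOn I c.φ = Ideal.span (c.x '' W))
    {E : Set (Spec (CommRingCat.of (c.A ⧸ Ideal.span (c.x '' W))))}
    (hc : ∀ w ∈ W, Spec (CommRingCat.of (blowupRing c.x W w)) ⟶ Y)
    (hhc : ∀ w hw, hc w hw ≫ b = specMap (algebraMap c.A (blowupRing c.x W w)) ≫ c.φ)
    [IsOpenImmersion (hc s hs)] {T : Finset (Fin c.n)} (hsT : s ∈ T)
    (y : specialFiber (b ≫ f)) :
    y ∈ c.exc hθ hs hVW (hc s hs) (hhc s hs) '' torusCell {w | w.1 ∈ T} E ↔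
      specialFiberMap b f y ∈ c.sub hθ '' E ∧
        ∀ w hw, specialFiberIncl (b ≫ f) y ∈ Set.range (hc w hw) ↔ w ∈ T := by
  -- Nonvanishing of t_w on chart s means lying in chart w. The cell of T thus has a description
  -- that does not depend on the choice of s ∈ T.
  have hX : ∀ r w hw, (hc s hs (specMap (excHom c.x W hs) r) ∈ Set.range (hc w hw) ↔
      ∀ hws : w ≠ s, MvPolynomial.X ⟨w, hw, hws⟩ ∉ pt r) := by
    intro r w hw
    rw [hb.mem_range_chart_iff hJ c.strict hs hw (hhc s hs) (hhc w hw), mem_specMap]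
    by_cases hws : w = s
    · subst hws
      rw [blowupCoord_self, map_one]
      refine iff_of_true (fun h1 ↦ ?_) (fun h ↦ absurd rfl h)
      exact Ideal.IsPrime.ne_top (I := pt r) inferInstance ((Ideal.eq_top_iff_one _).mpr h1)
    · rw [excHom_blowupCoord c.x hs ⟨hw, hws⟩]
      exact ⟨fun h _ ↦ h, fun h ↦ h hws⟩
  constructor
  · rintro ⟨r, ⟨hr1, hr2⟩, rfl⟩
    refine ⟨⟨_, hr1, (c.exc_map_apply hθ hs hVW _ _ r).symm⟩, fun w hw ↦ ?_⟩
    rw [incl_exc_apply, hX]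
    by_cases hws : w = s
    · subst hws
      exact iff_of_true (fun h ↦ absurd rfl h) hsT
    · exact ⟨fun h ↦ (hr2 ⟨w, hw, hws⟩).mp (h hws), fun h _ ↦ (hr2 ⟨w, hw, hws⟩).mpr h⟩
  · rintro ⟨⟨r₀, hr₀, hy⟩, hT⟩
    obtain ⟨q, hq⟩ := (hT s hs).mpr hsT
    have h1 := congrArg (specialFiberIncl f) hy
    have h0 : b (hc s hs q) = c.φ (specMap (algebraMap c.A (blowupRing c.x W s)) q) := by
      rw [← Scheme.Hom.comp_apply, hhc, Scheme.Hom.comp_apply]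
    rw [incl_specialFiberMap, incl_sub_apply, ← hq] at h1
    replace h1 := h1.trans h0
    have h2 := c.φ.isOpenEmbedding.injective h1
    obtain ⟨r, hr, rfl⟩ := c.exists_exc_eq hθ hs hVW (hc s hs) (hhc s hs) hq.symm (by
      change c.x s ∈ pt (specMap (algebraMap c.A (blowupRing c.x W s)) q)
      rw [← h2, mem_specMap, mk_eq_zero c.x hs]
      exact zero_mem _)
    refine ⟨r, ⟨?_, fun w ↦ ?_⟩, hr⟩
    · have h3 := (c.exc_map_apply hθ hs hVW (hc s hs) (hhc s hs) r).symm.trans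
        ((congrArg (specialFiberMap b f) hr).trans hy.symm)
      have := c.isImmersion_sub hθ Ideal.Quotient.mk_surjective
      rwa [(c.sub hθ).isEmbedding.injective h3]
    · have h3 := hT w.1 w.2.1
      rw [← hq, hX] at h3
      exact ⟨fun h ↦ h3.mp fun _ ↦ h, fun h ↦ h3.mpr h w.2.2⟩

end SNCChart

end Center


/-! ### Compatibility on the center and gluing -/

section Gluing

variable {O : Type u} [CommRing O] [IsDomain O] [IsDiscreteValuationRing O]
variable {X Y : Scheme.{u}} {f : X ⟶ Spec (CommRingCat.of O)} {b : Y ⟶ X} {ϖ : O}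

namespace SNCChart

variable (c : SNCChart f ϖ) {W : Finset (Fin c.n)} [LocallyOfFiniteType f]
  [TopologicalSpace.NoetherianSpace (specialFiber f)]
  [TopologicalSpace.NoetherianSpace (specialFiber (b ≫ f))]

/-- Compatibility for a stratum of the center. -/
theorem isCompatible_center_stratum
    [Algebra (IsLocalRing.ResidueField O) (c.A ⧸ Ideal.span (c.x '' W))]
    (hθ : ∀ o, Ideal.Quotient.mk (Ideal.span (c.x '' W)) (c.α o) =
      algebraMap _ _ (IsLocalRing.residue O o))
    (hϖ : Ideal.span {ϖ} = IsLocalRing.maximalIdeal O) {I : X.IdealSheafData}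
    (hb : IsIdealBlowup b I) (hJ : idealOn I c.φ = Ideal.span (c.x '' W))
    (hVW : (c.V ∩ W).Nonempty)
    {E : Set (Spec (CommRingCat.of (c.A ⧸ Ideal.span (c.x '' W))))}
    (hE : HasClass (specStr (IsLocalRing.ResidueField O) _) E) {H : Finset (Fin c.n)}
    (hH : ∀ r ∈ E, ∀ v, v ∈ H ↔ v ∈ c.V ∧ Ideal.Quotient.mk _ (c.x v) ∈ pt r) :
    IsCompatible f b (c.sub hθ '' E) := by
  classical
  -- A point of E is needed to read off that H ⊆ V and H ∩ W = V ∩ W.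
  rcases E.eq_empty_or_nonempty with rfl | ⟨r₀, hr₀⟩
  · rw [Set.image_empty]
    exact IsCompatible.empty
  have hHV : H ⊆ c.V := fun v hv ↦ ((hH r₀ hr₀ v).mp hv).1
  have hHW : H ∩ W = c.V ∩ W := by
    ext v
    simp only [Finset.mem_inter]
    refine and_congr_left fun hvW ↦ ?_
    rw [hH r₀ hr₀, mk_eq_zero c.x hvW]
    exact and_iff_left (zero_mem _)
  choose h hh using fun s (hs : s ∈ W) ↦ hb.exists_chart hJ c.strict hs
  have hopen : ∀ s hs, IsOpenImmersion (h s hs) := fun s hs ↦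
    hb.isOpenImmersion_chart hJ c.strict hs (hh s hs)
  -- Sorting points by the exact set T of charts containing them partitions the preimage. T is
  -- nonempty because the charts cover, and any s ∈ T identifies Q T with a torus cell in chart s.
  let Q : Finset (Fin c.n) → Set (specialFiber (b ≫ f)) := fun T ↦
    {y | specialFiberMap b f y ∈ c.sub hθ '' E ∧
      ∀ w hw, specialFiberIncl (b ≫ f) y ∈ Set.range (h w hw) ↔ w ∈ T}
  let 𝒯 := W.powerset.filter Finset.Nonempty
  have hmem : ∀ {T}, T ∈ 𝒯 ↔ T ⊆ W ∧ T.Nonempty := fun {T} ↦ by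
    simp only [𝒯, Finset.mem_filter, Finset.mem_powerset]
  have hQ : ∀ T ∈ 𝒯, HasClass (specialFiberStr (b ≫ f)) (Q T) ∧
      tildeS (b ≫ f) (Q T) =
        weight (IsLocalRing.ResidueField O) (c.excMult W ::ₘ (H \ T).val.map c.a) *
          (classOf (specStr (IsLocalRing.ResidueField O) _) E *
            (lefschetz (IsLocalRing.ResidueField O) - 1) ^ (T.card - 1)) := by
    intro T hT
    obtain ⟨hTW, s, hs⟩ := hmem.mp hT
    have h1 : Q T = c.exc hθ (hTW hs) hVW (h s (hTW hs)) (hh s (hTW hs)) ''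
        torusCell {w | w.1 ∈ T} E :=
      Set.ext fun y ↦ (c.mem_exc_image_iff hθ (hTW hs) hVW hb hJ h hh hs y).symm
    rw [h1]
    exact c.exc_image_class hθ (hTW hs) hVW _ _ hϖ hE hH hTW hs
  have hdisj : ∀ T ∈ 𝒯, ∀ T' ∈ 𝒯, T ≠ T' → Disjoint (Q T) (Q T') := by
    intro T hT T' hT' hne
    rw [Set.disjoint_left]
    rintro y ⟨-, hy⟩ ⟨-, hy'⟩
    refine hne (Finset.ext fun w ↦ ⟨fun hw ↦ ?_, fun hw ↦ ?_⟩)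
    · exact (hy' w ((hmem.mp hT).1 hw)).mp ((hy w _).mpr hw)
    · exact (hy w ((hmem.mp hT').1 hw)).mp ((hy' w _).mpr hw)
  have hunion : specialFiberMap b f ⁻¹' (c.sub hθ '' E) = ⋃ T ∈ 𝒯, Q T := by
    ext y
    simp only [Set.mem_iUnion, Set.mem_preimage]
    constructor
    · intro hy
      have hy' : b (specialFiberIncl (b ≫ f) y) ∈ Set.range c.φ := by
        obtain ⟨r, -, hr⟩ := hy
        rw [← incl_specialFiberMap, ← hr, incl_sub_apply]
        exact ⟨_, rfl⟩
      obtain ⟨s, hs, hys⟩ := hb.exists_mem_range hJ hh _ hy'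
      refine ⟨W.filter fun w ↦ ∃ hw, specialFiberIncl (b ≫ f) y ∈ Set.range (h w hw),
        hmem.mpr ⟨Finset.filter_subset _ _, s, Finset.mem_filter.mpr ⟨hs, hs, hys⟩⟩, hy,
        fun w hw ↦ ?_⟩
      rw [Finset.mem_filter]
      exact ⟨fun h ↦ ⟨hw, hw, h⟩, fun h ↦ h.2.2⟩
    · rintro ⟨T, -, hy⟩
      exact hy.1
  obtain ⟨h1, -⟩ := hasClass_biUnion 𝒯 (fun T hT ↦ (hQ T hT).1) hdisj
  have hs : Function.Surjective (Ideal.Quotient.mk (Ideal.span (c.x '' (W : Set (Fin c.n))))) :=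
    Ideal.Quotient.mk_surjective
  refine ⟨(hasClass_sub_image hθ hs hE).1, hunion ▸ h1, ?_⟩
  -- Both sides become [E] times a combination of weights, and `sum_weight_eq` equates the
  -- coefficients.
  rw [hunion, tildeS_biUnion 𝒯 (fun T hT ↦ (hQ T hT).1) hdisj,
    c.tildeS_sub_image hθ hϖ hs hE H hH,
    ← sum_weight_eq (IsLocalRing.ResidueField O) (W := W) (fun v hv ↦ c.one_le v (hHV hv))
      (hHW ▸ hVW), Finset.sum_mul]
  refine Finset.sum_congr rfl fun T hT ↦ ?_
  rw [(hQ T hT).2, hHW, excMult]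
  ring

/-- Compatibility on the center. -/
theorem isCompatible_of_center (hϖ : Ideal.span {ϖ} = IsLocalRing.maximalIdeal O)
    {I : X.IdealSheafData} (hb : IsIdealBlowup b I)
    (hJ : idealOn I c.φ = Ideal.span (c.x '' W)) (hmem : c.α ϖ ∈ idealOn I c.φ)
    {C : Set (specialFiber f)} (hC : Topology.IsConstructible C)
    (hCs : ∀ p ∈ C, ∃ q, c.φ q = specialFiberIncl f p ∧ idealOn I c.φ ≤ pt q) :
    IsCompatible f b C := by
  rw [hJ] at hmem hCs
  obtain ⟨_, hθ⟩ := c.exists_algebra hϖ hmem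
  have hs : Function.Surjective (Ideal.Quotient.mk (Ideal.span (c.x '' (W : Set (Fin c.n))))) :=
    Ideal.Quotient.mk_surjective
  refine c.isCompatible_of_strata hθ hs (fun E H hE hH ↦ ?_) hC fun p hp ↦ ?_
  · exact c.isCompatible_center_stratum hθ hϖ hb hJ (c.inter_nonempty_of_mem W hmem) hE hH
  · obtain ⟨q, hq, hle⟩ := hCs p hp
    obtain ⟨r, hr, -⟩ := c.mem_range_sub hθ hs hq.symm (by rwa [Ideal.mk_ker])
    exact ⟨r, hr⟩

end SNCChart

/-- The special fibre of the blowup is noetherian. -/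
theorem noetherianSpace_specialFiber_blowup (hϖ : Ideal.span {ϖ} = IsLocalRing.maximalIdeal O)
    (hf : IsSNCModel f) {Z : Scheme.{u}} (i : Z ⟶ X) [IsClosedImmersion i]
    (hnc : HasNormalCrossings f i) (hb : IsIdealBlowup b i.ker) :
    TopologicalSpace.NoetherianSpace (specialFiber (b ≫ f)) := by
  have := hf.quasiCompact
  -- A space is noetherian when all its subsets are compact. Compactness of X_k reduces this to
  -- preimages of single charts, which finitely many noetherian charts of the blowup cover.
  have key : ∀ t : Set (specialFiber (b ≫ f)),
      t ⊆ specialFiberMap b f ⁻¹' Set.univ → IsCompact t := by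
    refine (isCompact_univ (X := specialFiber f)).induction_on
      (p := fun S ↦ ∀ t : Set (specialFiber (b ≫ f)), t ⊆ specialFiberMap b f ⁻¹' S →
        IsCompact t) ?_ ?_ ?_ ?_
    · intro t ht
      rw [Set.subset_empty_iff.mp ht]
      exact isCompact_empty
    · exact fun S S' hS h t ht ↦ h t (ht.trans (Set.preimage_mono hS))
    · intro S S' hS hS' t ht
      have h1 : t = t ∩ specialFiberMap b f ⁻¹' S ∪ t ∩ specialFiberMap b f ⁻¹' S' := by
        rw [← Set.inter_union_distrib_left]
        exact (Set.inter_eq_left.mpr ht).symm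
      rw [h1]
      exact (hS _ Set.inter_subset_right).union (hS' _ Set.inter_subset_right)
    · intro p _
      have hnhds : ∀ c : SNCChart f ϖ, specialFiberIncl f p ∈ Set.range c.φ →
          specialFiberIncl f ⁻¹' Set.range c.φ ∈ nhdsWithin p Set.univ := fun c hc ↦
        mem_nhdsWithin_of_mem_nhds ((c.φ.isOpenEmbedding.isOpen_range.preimage
          (specialFiberIncl f).continuous).mem_nhds hc)
      have hmem : ∀ (c : SNCChart f ϖ) {y : specialFiber (b ≫ f)},
          y ∈ specialFiberMap b f ⁻¹' (specialFiberIncl f ⁻¹' Set.range c.φ) →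
          b (specialFiberIncl (b ≫ f) y) ∈ Set.range c.φ := fun c y hy ↦ by
        rwa [← incl_specialFiberMap]
      by_cases hp : specialFiberIncl f p ∈ Set.range i
      · obtain ⟨z, hz⟩ := hp
        obtain ⟨c, W, h1, hJ⟩ := exists_chart_of_mem hϖ hf i hnc z
        refine ⟨_, hnhds c (hz ▸ h1), fun t ht ↦ ?_⟩
        choose h hh using fun s (hs : s ∈ W) ↦ hb.exists_chart hJ c.strict hs
        have := c.isNoetherianRing hf
        have : ∀ s, IsNoetherianRing (blowupRing c.x W s) := fun s ↦
          Algebra.FiniteType.isNoetherianRing c.A _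
        refine isCompact_of_subset_charts (specialFiberIncl (b ≫ f)) (κ := W)
          (B := fun s ↦ blowupRing c.x W s) (fun s ↦ h s.1 s.2) fun y hy ↦ ?_
        obtain ⟨s, hs, hys⟩ := hb.exists_mem_range hJ hh _ (hmem c (ht hy))
        exact ⟨⟨s, hs⟩, hys⟩
      · obtain ⟨c, h1, hI⟩ := exists_chart_of_notMem hϖ hf i p hp
        refine ⟨_, hnhds c h1, fun t ht ↦ ?_⟩
        obtain ⟨h, -, -, hrange⟩ := hb.exists_chart_of_eq_top hI
        have := c.isNoetherianRing hf
        exact isCompact_of_subset_charts (specialFiberIncl (b ≫ f)) (κ := Unit)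
          (B := fun _ ↦ c.A) (fun _ ↦ h) fun y hy ↦ ⟨(), hrange _ (hmem c (ht hy))⟩
  exact TopologicalSpace.noetherianSpace_iff_isCompact.mpr fun t ↦ key t fun _ _ ↦ trivial

/-- Compatibility can be checked locally on the special fibre. -/
theorem isCompatible_of_local [TopologicalSpace.NoetherianSpace (specialFiber f)]
    [TopologicalSpace.NoetherianSpace (specialFiber (b ≫ f))] {S : Set (specialFiber f)}
    (h : ∀ p ∈ S, ∃ U, IsOpen U ∧ p ∈ U ∧ ∀ C, Topology.IsConstructible C → C ⊆ U → C ⊆ S →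
      IsCompatible f b C) {C : Set (specialFiber f)} (hC : Topology.IsConstructible C)
    (hCS : C ⊆ S) : IsCompatible f b C := by
  -- Quantifying over all constructible subsets of U makes the property stable under unions: C
  -- splits into its parts inside U and outside U.
  suffices H : ∃ U, IsOpen U ∧ S ⊆ U ∧ ∀ C, Topology.IsConstructible C → C ⊆ U → C ⊆ S →
      IsCompatible f b C by
    obtain ⟨U, -, hSU, hU⟩ := H
    exact hU C hC (hCS.trans hSU) hCS
  refine (TopologicalSpace.NoetherianSpace.isCompact S).induction_on
    (p := fun T ↦ ∃ U, IsOpen U ∧ T ⊆ U ∧ ∀ C, Topology.IsConstructible C → C ⊆ U → C ⊆ S →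
      IsCompatible f b C) ?_ ?_ ?_ ?_
  · refine ⟨∅, isOpen_empty, subset_rfl, fun C _ hC _ ↦ ?_⟩
    rw [Set.subset_empty_iff.mp hC]
    exact IsCompatible.empty
  · rintro T T' hT ⟨U, hU, hTU, h⟩
    exact ⟨U, hU, hT.trans hTU, h⟩
  · rintro T T' ⟨U, hU, hTU, h₁⟩ ⟨U', hU', hTU', h₂⟩
    refine ⟨U ∪ U', hU.union hU', Set.union_subset_union hTU hTU', fun C hC hCU hCS ↦ ?_⟩
    have hU'' := isConstructible_of_isOpen hU
    rw [← Set.inter_union_sdiff C U]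
    refine (h₁ _ (hC.inter hU'') Set.inter_subset_right (Set.inter_subset_left.trans hCS)).union
      (h₂ _ (hC.sdiff hU'') ?_ (Set.sdiff_subset.trans hCS)) Set.disjoint_sdiff_inter.symm
    exact fun p hp ↦ (hCU hp.1).resolve_left hp.2
  · intro p hp
    obtain ⟨U, hU, hpU, h⟩ := h p hp
    exact ⟨U, mem_nhdsWithin_of_mem_nhds (hU.mem_nhds hpU), U, hU, subset_rfl, h⟩

/-- The invariant is unchanged by the blowup of a center with normal crossings. -/
theorem tildeS_preimage_blowup (hf : IsSNCModel f) {Z : Scheme.{u}} (j : Z ⟶ specialFiber f)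
    [IsClosedImmersion j] (hnc : HasNormalCrossings f (j ≫ specialFiberIncl f))
    (hb : IsBlowup b (j ≫ specialFiberIncl f)) {C : Set (specialFiber f)}
    (hC : Topology.IsConstructible C) :
    tildeS f C = tildeS (b ≫ f) (specialFiberMap b f ⁻¹' C) := by
  have := hf.locallyOfFiniteType
  have := hf.quasiCompact
  obtain ⟨ϖ, hϖ'⟩ := IsPrincipalIdealRing.principal (IsLocalRing.maximalIdeal O)
  have hϖ : Ideal.span {ϖ} = IsLocalRing.maximalIdeal O := hϖ'.symm
  set i := j ≫ specialFiberIncl f with hi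
  have hb' : IsIdealBlowup b i.ker := ⟨hb.cartier, hb.universal⟩
  have : TopologicalSpace.NoetherianSpace (specialFiber f) :=
    noetherianSpace_of_locallyOfFiniteType (specialFiberStr f)
  have := noetherianSpace_specialFiber_blowup hϖ hf i hnc hb'
  have hopen : ∀ c : SNCChart f ϖ, IsOpen (specialFiberIncl f ⁻¹' Set.range c.φ) := fun c ↦
    c.φ.isOpenEmbedding.isOpen_range.preimage (specialFiberIncl f).continuous
  have hij : ∀ z, i z = specialFiberIncl f (j z) := fun z ↦ Scheme.Hom.comp_apply _ _ _
  -- C is cut into its part on the center and its part off it. Each is handled chart by chart, since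
  -- the two kinds of chart describe the preimage differently.
  have hin : ∀ C, Topology.IsConstructible C → C ⊆ Set.range j → IsCompatible f b C := by
    refine fun C ↦ isCompatible_of_local ?_
    rintro _ ⟨z, rfl⟩
    obtain ⟨c, W, h1, hJ⟩ := exists_chart_of_mem hϖ hf i hnc z
    refine ⟨_, hopen c, (hij z ▸ h1 : specialFiberIncl f (j z) ∈ Set.range c.φ), fun C hC hCU hCj ↦ ?_⟩
    refine c.isCompatible_of_center hϖ hb' hJ (mem_idealOn_of_comp j hϖ c) hC fun p hp ↦ ?_
    obtain ⟨q, hq⟩ := hCU hp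
    obtain ⟨z, rfl⟩ := hCj hp
    exact ⟨q, hq, le_pt_of_mem_range i ⟨z, (hij z).trans hq.symm⟩⟩
  have hout : ∀ C, Topology.IsConstructible C → C ⊆ (Set.range j)ᶜ → IsCompatible f b C := by
    refine fun C ↦ isCompatible_of_local fun p hp ↦ ?_
    obtain ⟨c, h1, hI⟩ := exists_chart_of_notMem hϖ hf i p (by
      rintro ⟨z, hz⟩
      exact hp ⟨z, eq_of_specialFiberIncl_eq ((hij z).symm.trans hz)⟩)
    exact ⟨_, hopen c, h1, fun C hC hCU _ ↦ c.isCompatible_of_eq_top hϖ hb' hI hC hCU⟩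
  have hj : Topology.IsConstructible (Set.range j) := by
    simpa using (isConstructible_of_isOpen
      (j.isClosedEmbedding.isClosed_range.isOpen_compl)).compl
  have h := (hin (C ∩ Set.range j) (hC.inter hj) Set.inter_subset_right).union
    (hout (C \ Set.range j) (hC.sdiff hj) fun _ hp ↦ hp.2) Set.disjoint_sdiff_inter.symm
  rw [Set.inter_union_sdiff] at h
  exact h.tildeS_eq

end Gluing

end MotivicSerre

theorem proposition2p1
    -- a complete discrete valuation ring with perfect residue field
    {O : Type u} [CommRing O] [IsDomain O] [IsDiscreteValuationRing O]
    [IsAdicComplete (IsLocalRing.maximalIdeal O) O] [PerfectField (IsLocalRing.ResidueField O)]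
    {X Y Z : Scheme.{u}} (f : X ⟶ Spec (CommRingCat.of O)) (hf : MotivicSerre.IsSNCModel f)
    -- the center: a smooth irreducible closed subscheme of the special fibre
    (j : Z ⟶ MotivicSerre.specialFiber f) (hj : IsClosedImmersion j)
    (hZ : Smooth (j ≫ MotivicSerre.specialFiberStr f)) (hZirr : IrreducibleSpace Z)
    (hnc : MotivicSerre.HasNormalCrossings f (j ≫ MotivicSerre.specialFiberIncl f))
    -- the blowup
    (b : Y ⟶ X) (hb : MotivicSerre.IsBlowup b (j ≫ MotivicSerre.specialFiberIncl f))
    (C : Set (MotivicSerre.specialFiber f)) (hC : Topology.IsConstructible C) :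
    MotivicSerre.tildeS f C =
      MotivicSerre.tildeS (b ≫ f) (MotivicSerre.specialFiberMap b f ⁻¹' C) :=
  MotivicSerre.tildeS_preimage_blowup hf j hnc hb hC
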